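/- Let $p_0,p_1,p_2,p_3\in\mathbb R^3$ be the vertices of a regular tetrahedron with unit edges, let $T$ be its surface (the union of its four faces) and $V=\{p_0,\dots,p_3\}$. The surface $T\setminus V$ is flat: two adjacent faces unfold isometrically to a planar rhombus, and these unfoldings, on the open rhombi, are its charts. For $\lambda\in\mathbb R$, a function $u:T\to\mathbb R$ is a *solution of $-\Delta u=\lambda u$ on $T$* if in every such chart it lies in $H^1$ of the open rhombus and satisfies $\int\nabla u\cdot\nabla\varphi=\lambda\int u\varphi$ for all $\varphi\in C_c^\infty$ of the open rhombus (so nothing is prescribed at the vertices apart from finite energy). Let $E_\lambda$ be the space of continuous solutions, and call $\lambda$ an eigenvalue if $E_\lambda\neq0$. Let $L=\mathbb Z(2,0)+\mathbb Z(1,\sqrt3)$, let $\mathbb R^2/L$ be the hexagonal torus, and let $R(z)=-z$ on $\mathbb R^2/L$ (induced by the half-turn of $\mathbb{R}^2$ about $(\tfrac32,\tfrac{\sqrt3}2)$). Put $\vec u=(\tfrac12,\tfrac{\sqrt3}6)$, $\vec v=(0,\tfrac{\sqrt3}3)$ and, for $k,j\in\mathbb Z$, $c_{k,j}(x)=\cos\bigl(2\pi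 x\cdot(k\vec u+j\vec v)\bigr)$. Then there is a continuous map $\pi:\mathbb R^2/L\to T$, affine from the triangle $(0,0),(1,0),(\tfrac12,\tfrac{\sqrt3}2)$ onto the face $p_0p_1p_2$, which is a two-fold branched cover: it is a two-sheeted, locally isometric covering over $T\setminus V$, each vertex has exactly one preimage, and $\pi(z)=\pi(w)$ if and only if $w\in\{z,Rz\}$. A function on $T$ is smooth on $T\setminus V$ if and only if its lift by $\pi$ is smooth off the preimages of the vertices. Moreover: 1. Every solution $u$ of $-\Delta u=\lambda u$ on $T$ agrees almost everywhere with a unique continuous function $v$ on $T$. This $v$ lies in $E_\lambda$ and is nonsingular: its lift $\tilde v=v\circ\pi$ is smooth everywhere, also over the vertices. Furthermore $\tilde v\circ R=\tilde v$ and $-\Delta\tilde v=\lambda\tilde v$ everywhere. Conversely, every $C^2$ function $w$ on the torus with $w\circ R=w$ and $-\Delta w=\lambda w$ equals $v\circ\pi$ for some $v\in E_\lambda$. 2. For every $\lambda\in\mathbb R$, the lifts to $\mathbb R^2$ of the elements of $E_\lambda$ are exactly the finite linear combinations of the functions $c_{k,j}$ with $\tfrac{4\pi^2}3(j^2+k^2+jk)=\lambda$.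 Thus the eigenvalues are exactly the numbers $\tfrac{4\pi^2}3(j^2+k^2+jk)$ with $k,j\in\mathbb Z$. 3. For every integer $N\ge0$, $\dim E_{4\pi^2N/3}$ is finite and equals the (finite) number of $(k,j)\in\mathbb Z^2$ with $j^2+k^2+jk=N$, $k\ge0$, and $j\ge0$ whenever $k=0$ (that is, the number of representations up to $(k,j)\sim(-k,-j)$). 4. Say that $v\in E_\lambda$ is of type $1^+$ (respectively $1^-$) if it is invariant (respectively changes sign) under each reflection of the tetrahedron, that is, under the reflection in the perpendicular bisector plane of each edge. Set $$\begin{aligned}u_\pm^{k,j}={}&c_{k,j}+c_{k+j,-k}+c_{j,-(k+j)}\\&\pm\bigl(c_{j,k}+c_{k+j,-j}+c_{k,-(k+j)}\bigr)\qquad(0<j<k),\end{aligned}$$ $$u_+^{k,0}=c_{k,0}+c_{k,-k}+c_{0,k},\quad u_+^{k,k}=c_{k,k}+c_{2k,-k}+c_{k,-2k}\quad(k>0),\qquad u_+^{0,0}=1.$$ For every $\lambda$, the lifts to $\mathbb{R}^2$ of the type $1^+$ elements of $E_\lambda$ form the space with basis the functions $u_+^{k,j}$, $0\le j\le k$, $k,j$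 both even, $\tfrac{4\pi^2}3(j^2+k^2+jk)=\lambda$. The lifts of the type $1^-$ elements form the space with basis the functions $u_-^{k,j}$, $0<j<k$, $k,j$ both even, $\tfrac{4\pi^2}3(j^2+k^2+jk)=\lambda$. 5. These are orbit sums over the dual lattice. The dual of $L$ is $L^*=\mathbb Z\vec u+\mathbb Z\vec v$. Let $D$ be the group of linear isometries of $\mathbb R^2$ preserving $L^*$. For integers $0\le j\le k$, $k\neq0$, the sum of $\cos(2\pi x\cdot w)$ over the orbit $w\in D(k\vec u+j\vec v)$ is $2u_+^{k,j}(x)$. For $0<j<k$, $\sum_{A\in D}\det(A)\cos\bigl(2\pi x\cdot A(k\vec u+j\vec v)\bigr)=2u_-^{k,j}(x)$. -/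

import Mathlib

open MeasureTheory Topology
open scoped ContDiff

noncomputable section

namespace Tetra

/-! ### The surface of a regular tetrahedron -/

/-- The Euclidean plane. -/
abbrev Plane : Type := EuclideanSpace ℝ (Fin 2)

/-- Euclidean three-space. -/
abbrev Space : Type := EuclideanSpace ℝ (Fin 3)

/-- The surface of the tetrahedron with vertices `p 0, …, p 3`: the union of its four faces, where
the `i`-th face is the triangle spanned by the vertices other than `p i`. -/
def surface (p : Fin 4 → Space) : Set Space :=
  ⋃ i : Fin 4, convexHull ℝ (p '' {i}ᶜ)

/-- The surface as a topological space (with the topology of three-space). -/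
abbrev Surface (p : Fin 4 → Space) : Type := surface p

/-- The set of the four vertices, inside the surface. -/
def vertexSet (p : Fin 4 → Space) : Set (Surface p) :=
  {x | ∃ i, (x : Space) = p i}

/-- The open rhombus with vertices `(0,0)`, `(1/2, √3/2)`, `(1,0)`, `(1/2, -√3/2)`: two open
equilateral unit triangles together with the open edge from `(0,0)` to `(1,0)` between them. -/
def rhombus : Set Plane :=
  {x | 0 < x 0 - |x 1| / √3 ∧ x 0 + |x 1| / √3 < 1}

/-- Folding of the rhombus onto two adjacent faces.  For an ordering `e` of the vertices, the upper
triangle `(0,0), (1,0), (1/2, √3/2)` is mapped affinely onto the face `p (e 0), p (e 1), p (e 2)`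
and the lower triangle `(0,0), (1,0), (1/2, -√3/2)` onto the face `p (e 0), p (e 1), p (e 3)`.
For a regular tetrahedron with unit edges these maps, restricted to the open rhombus, are the flat
charts of the surface without its vertices. -/
def chart (p : Fin 4 → Space) (e : Equiv.Perm (Fin 4)) (x : Plane) : Space :=
  (1 - x 0 - |x 1| / √3) • p (e 0) + (x 0 - |x 1| / √3) • p (e 1)
    + (2 * |x 1| / √3) • (if 0 ≤ x 1 then p (e 2) else p (e 3))

theorem comb_mem_surface (p : Fin 4 → Space) {a b c l : Fin 4} (ha : a ≠ l) (hb : b ≠ l)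
    (hc : c ≠ l) {r s t : ℝ} (hr : 0 ≤ r) (hs : 0 ≤ s) (ht : 0 ≤ t) (h : r + s + t = 1) :
    r • p a + s • p b + t • p c ∈ surface p := by
  refine Set.mem_iUnion.2 ⟨l, ?_⟩
  have mem : ∀ {i : Fin 4}, i ≠ l → p i ∈ convexHull ℝ (p '' {l}ᶜ) := fun {i} hi =>
    subset_convexHull ℝ _ ⟨i, by simpa using hi, rfl⟩
  have key := (convex_convexHull ℝ (p '' {l}ᶜ)).sum_mem (t := Finset.univ)
    (w := ![r, s, t]) (z := ![p a, p b, p c])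
    (by intro i _; fin_cases i <;> simp [hr, hs, ht])
    (by simp [Fin.sum_univ_three, h])
    (by intro i _; fin_cases i <;> simp [mem ha, mem hb, mem hc])
  simpa [Fin.sum_univ_three] using key

theorem chart_mem_surface (p : Fin 4 → Space) (e : Equiv.Perm (Fin 4)) {x : Plane}
    (hx : x ∈ rhombus) : chart p e x ∈ surface p := by
  obtain ⟨h1, h2⟩ := hx
  have h3 : 0 ≤ |x 1| / √3 := by positivity
  have h4 : 0 ≤ 2 * |x 1| / √3 := by positivity
  have h5 : (1 - x 0 - |x 1| / √3) + (x 0 - |x 1| / √3) + 2 * |x 1| / √3 = 1 := by ring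
  unfold chart
  split_ifs
  · exact comb_mem_surface p (l := e 3) (by simp) (by simp) (by simp)
      (by linarith) h1.le h4 h5
  · exact comb_mem_surface p (l := e 2) (by simp) (by simp) (by simp)
      (by linarith) h1.le h4 h5

open Classical in
/-- A function on the surface, read in the chart belonging to `e` (and `0` off the rhombus). -/
def pull (p : Fin 4 → Space) (e : Equiv.Perm (Fin 4)) (u : Surface p → ℝ) (x : Plane) : ℝ :=
  if hx : x ∈ rhombus then u ⟨chart p e x, chart_mem_surface p e hx⟩ else 0

/-- Equality almost everywhere on the surface: equality almost everywhere in every chart. -/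
def AEEqSurface (p : Fin 4 → Space) (u v : Surface p → ℝ) : Prop :=
  ∀ e, pull p e u =ᵐ[volume.restrict rhombus] pull p e v

/-! ### The Laplacian of the surface -/

/-- Test functions on an open set `Ω` of the plane: smooth with compact support inside `Ω`. -/
def IsTest (Ω : Set Plane) (φ : Plane → ℝ) : Prop :=
  ContDiff ℝ ∞ φ ∧ HasCompactSupport φ ∧ tsupport φ ⊆ Ω

/-- `g` is the weak gradient of `f` on the open set `Ω`. -/
def HasWeakGradient (Ω : Set Plane) (f : Plane → ℝ) (g : Plane → Plane) : Prop :=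
  ∀ φ, IsTest Ω φ → ∫ x in Ω, f x • gradient φ x = -∫ x in Ω, φ x • g x

/-- `u` is a finite energy solution of `-Δ u = lam u` on the flat surface without its vertices: in
every flat chart `u` belongs to the Sobolev space `H¹` of the open rhombus, and
`∫ ⟪∇ u, ∇ φ⟫ = lam ∫ u φ` for all test functions `φ` on the rhombus.  Nothing is
required at the vertices, and `u` matters only up to null sets. -/
def IsLaplaceSolution (p : Fin 4 → Space) (lam : ℝ) (u : Surface p → ℝ) : Prop :=
  ∀ e : Equiv.Perm (Fin 4), ∃ g : Plane → Plane,
    MemLp (pull p e u) 2 (volume.restrict rhombus) ∧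
    MemLp g 2 (volume.restrict rhombus) ∧
    HasWeakGradient rhombus (pull p e u) g ∧
    ∀ φ, IsTest rhombus φ →
      ∫ x in rhombus, inner ℝ (g x) (gradient φ x) = lam * ∫ x in rhombus, pull p e u x * φ x

theorem pull_add (p : Fin 4 → Space) (e : Equiv.Perm (Fin 4)) (u v : Surface p → ℝ) :
    pull p e (u + v) = pull p e u + pull p e v := by
  funext x
  by_cases hx : x ∈ rhombus <;> simp [pull, hx]

theorem pull_smul (p : Fin 4 → Space) (e : Equiv.Perm (Fin 4)) (c : ℝ) (u : Surface p → ℝ) :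
    pull p e (c • u) = c • pull p e u := by
  funext x
  by_cases hx : x ∈ rhombus <;> simp [pull, hx]

theorem IsTest.memLp {Ω : Set Plane} {φ : Plane → ℝ} (h : IsTest Ω φ) :
    MemLp φ 2 (volume.restrict Ω) :=
  (h.1.continuous.memLp_of_hasCompactSupport h.2.1).restrict Ω

theorem IsTest.gradient_memLp {Ω : Set Plane} {φ : Plane → ℝ} (h : IsTest Ω φ) :
    MemLp (gradient φ) 2 (volume.restrict Ω) := by
  have hc : Continuous (gradient φ) :=
    (InnerProductSpace.toDual ℝ Plane).symm.continuous.comp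
      (h.1.continuous_fderiv (by simp))
  have hs : HasCompactSupport (gradient φ) :=
    (h.2.1.fderiv (𝕜 := ℝ)).comp_left (g := (InnerProductSpace.toDual ℝ Plane).symm) (map_zero _)
  exact (hc.memLp_of_hasCompactSupport hs).restrict Ω

theorem integrable_smul_of_memLp {Ω : Set Plane} {f : Plane → ℝ} {g : Plane → Plane}
    (hf : MemLp f 2 (volume.restrict Ω)) (hg : MemLp g 2 (volume.restrict Ω)) :
    Integrable (fun x => f x • g x) (volume.restrict Ω) :=
  memLp_one_iff_integrable.1 (MemLp.smul (r := 1) hg hf)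

theorem integrable_inner_of_memLp {Ω : Set Plane} {f g : Plane → Plane}
    (hf : MemLp f 2 (volume.restrict Ω)) (hg : MemLp g 2 (volume.restrict Ω)) :
    Integrable (fun x => inner ℝ (f x) (g x)) (volume.restrict Ω) :=
  memLp_one_iff_integrable.1 (MemLp.of_bilin (r := 1) (fun a b => inner ℝ a b) 1 hf hg
    (hf.1.inner hg.1) (Filter.Eventually.of_forall fun x => by
      rw [one_mul]
      exact nnnorm_inner_le_nnnorm (𝕜 := ℝ) (f x) (g x)))

theorem IsLaplaceSolution.add {p : Fin 4 → Space} {lam : ℝ} {u v : Surface p → ℝ}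
    (hu : IsLaplaceSolution p lam u) (hv : IsLaplaceSolution p lam v) :
    IsLaplaceSolution p lam (u + v) := by
  intro e
  obtain ⟨g, a1, a2, a3, a4⟩ := hu e
  obtain ⟨k, b1, b2, b3, b4⟩ := hv e
  rw [pull_add]
  refine ⟨g + k, a1.add b1, a2.add b2, fun φ hφ => ?_, fun φ hφ => ?_⟩
  · have e1 := integral_add (integrable_smul_of_memLp a1 hφ.gradient_memLp)
      (integrable_smul_of_memLp b1 hφ.gradient_memLp)
    have e2 := integral_add (integrable_smul_of_memLp hφ.memLp a2)
      (integrable_smul_of_memLp hφ.memLp b2)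
    simp only [Pi.add_apply, add_smul, smul_add]
    rw [e1, e2, a3 φ hφ, b3 φ hφ, neg_add]
  · have e1 := integral_add (integrable_inner_of_memLp a2 hφ.gradient_memLp)
      (integrable_inner_of_memLp b2 hφ.gradient_memLp)
    have e2 := integral_add (a1.integrable_mul hφ.memLp) (b1.integrable_mul hφ.memLp)
    simp only [Pi.mul_apply] at e2
    simp only [Pi.add_apply, inner_add_left, add_mul]
    rw [e1, e2, a4 φ hφ, b4 φ hφ, mul_add]

theorem IsLaplaceSolution.smul {p : Fin 4 → Space} {lam : ℝ} {u : Surface p → ℝ} (c : ℝ)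
    (hu : IsLaplaceSolution p lam u) : IsLaplaceSolution p lam (c • u) := by
  intro e
  obtain ⟨g, a1, a2, a3, a4⟩ := hu e
  rw [pull_smul]
  refine ⟨c • g, a1.const_smul c, a2.const_smul c, fun φ hφ => ?_, fun φ hφ => ?_⟩
  · have e3 := a3 φ hφ
    simp only [Pi.smul_apply, smul_assoc, smul_comm _ c] at *
    rw [integral_smul, integral_smul, e3, smul_neg]
  · have e3 := a4 φ hφ
    simp only [Pi.smul_apply, inner_smul_left, smul_eq_mul, mul_assoc, conj_trivial] at *
    rw [integral_const_mul, integral_const_mul, e3]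
    ring

/-- The eigenspace of the Laplacian for `lam`: the continuous functions on the surface that solve
`-Δ u = lam u`. -/
def eigenspace (p : Fin 4 → Space) (lam : ℝ) : Submodule ℝ C(Surface p, ℝ) where
  carrier := {v | IsLaplaceSolution p lam v}
  zero_mem' := by
    have h0 : ∀ e, pull p e ((0 : C(Surface p, ℝ)) : Surface p → ℝ) = 0 := fun e => by
      funext x
      by_cases hx : x ∈ rhombus <;> simp [pull, hx]
    intro e
    rw [h0]
    exact ⟨0, MemLp.zero, MemLp.zero, fun φ _ => by simp, fun φ _ => by simp⟩
  add_mem' := fun ha hb => by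
    simpa using IsLaplaceSolution.add ha hb
  smul_mem' := fun c _ ha => by
    simpa using IsLaplaceSolution.smul c ha

/-! ### The hexagonal torus -/

/-- The lattice generated by `(2, 0)` and `(1, √3)`. -/
def hexLattice : AddSubgroup Plane :=
  AddSubgroup.closure {!₂[2, 0], !₂[1, √3]}

/-- The hexagonal torus. -/
abbrev HexTorus : Type := Plane ⧸ hexLattice

/-- The class of a point of the plane in the torus. -/
def toTorus (x : Plane) : HexTorus := QuotientAddGroup.mk x

/-- The half-turn of the torus.  It is induced by the rotation of the plane by `180°` about the
centre `(3/2, √3/2)` of the fundamental parallelogram. -/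
def halfTurn (z : HexTorus) : HexTorus := -z

/-- `π` is a two-fold branched cover of the surface by the torus, branched over the vertices, with
the half-turn as covering involution, and locally isometric elsewhere; it maps the triangle
`(0,0), (1,0), (1/2, √3/2)` affinely to the face `p 0, p 1, p 2`. -/
structure IsTwofoldBranchedCover (p : Fin 4 → Space) (π : C(HexTorus, Surface p)) : Prop where
  /-- Away from the vertices `π` is a covering map. -/
  covering : IsCoveringMapOn π (vertexSet p)ᶜ
  /-- Two sheets away from the vertices. -/
  two_sheets : ∀ y, y ∉ vertexSet p → (π ⁻¹' {y}).ncard = 2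
  /-- Over a vertex the two sheets come together. -/
  branched : ∀ y, y ∈ vertexSet p → (π ⁻¹' {y}).ncard = 1
  /-- The points of the torus that are identified are exactly those swapped by the half-turn. -/
  identified : ∀ z w, π z = π w ↔ w = z ∨ w = halfTurn z
  /-- Up to a rigid motion of the plane every flat chart of the surface is a piece of `π`. -/
  isometric : ∀ e : Equiv.Perm (Fin 4), ∃ A : Plane ≃ᵃⁱ[ℝ] Plane,
    ∀ x ∈ rhombus, (π (toTorus (A x)) : Space) = chart p e x
  /-- Position of one face. -/
  face : ∀ s t : ℝ, 0 ≤ s → 0 ≤ t → s + t ≤ 1 →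
    (π (toTorus (s • !₂[1, 0] + t • !₂[1 / 2, √3 / 2])) : Space) =
      (1 - s - t) • p 0 + s • p 1 + t • p 2

/-- The lift of a function on the surface to a (periodic) function on the plane. -/
def lift {p : Fin 4 → Space} (π : C(HexTorus, Surface p)) :
    C(Surface p, ℝ) →ₗ[ℝ] (Plane → ℝ) where
  toFun v := fun x => v (π (toTorus x))
  map_add' _ _ := rfl
  map_smul' _ _ := rfl

/-- A function on the surface is nonsingular if its lift is smooth everywhere, including the points
over the vertices. -/
def Nonsingular {p : Fin 4 → Space} (π : C(HexTorus, Surface p)) (v : C(Surface p, ℝ)) : Prop :=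
  ContDiff ℝ ∞ (lift π v)

/-! ### The trigonometric functions -/

/-- The vector `k u + j v` with `u = (1/2, √3/6)` and `v = (0, √3/3)`. -/
def dualVec (k j : ℤ) : Plane :=
  (k : ℝ) • !₂[1 / 2, √3 / 6] + (j : ℝ) • !₂[0, √3 / 3]

/-- The dual of the lattice of the torus. -/
def dualLattice : Set Plane :=
  {w | ∀ l ∈ hexLattice, ∃ n : ℤ, inner ℝ l w = (n : ℝ)}

/-- The plane wave `cos (2π x · w)`. -/
def cosWave (w : Plane) (x : Plane) : ℝ := Real.cos (2 * Real.pi * inner ℝ x w)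

/-- The function `cos (2π x · (k u + j v))`. -/
def planeCos (k j : ℤ) : Plane → ℝ := cosWave (dualVec k j)

/-- The number `(4π²/3)(j² + k² + jk)`. -/
def eigenvalue (k j : ℤ) : ℝ :=
  4 * Real.pi ^ 2 / 3 * ((j : ℝ) ^ 2 + (k : ℝ) ^ 2 + (j : ℝ) * (k : ℝ))

/-- The functions of type `1⁺` (for `ε = 1`, invariant) or `1⁻` (for `ε = -1`, changing sign) with
respect to every reflection of the tetrahedron, that is, with respect to the reflection in the
perpendicular bisector plane of every edge. -/
def symmetryType (p : Fin 4 → Space) (ε : ℝ) : Submodule ℝ C(Surface p, ℝ) where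
  carrier := {v | ∀ i j, i ≠ j → ∀ x y : Surface p,
    haveI : Nonempty (AffineSubspace.perpBisector (p i) (p j)) :=
      AffineSubspace.perpBisector_nonempty.to_subtype
    (y : Space) = EuclideanGeometry.reflection (AffineSubspace.perpBisector (p i) (p j)) (x : Space)
      → v y = ε * v x}
  zero_mem' := by
    intro i j _ x y _
    simp
  add_mem' := by
    intro a b ha hb i j hij x y h
    simp [ha i j hij x y h, hb i j hij x y h, mul_add]
  smul_mem' := by
    intro c a ha i j hij x y h
    simp [ha i j hij x y h, mul_left_comm]

/-- The six-term sums of a generic orbit, with signs `ε` on the second half. -/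
def genericSum (ε : ℝ) (k j : ℤ) : Plane → ℝ :=
  planeCos k j + planeCos (k + j) (-k) + planeCos j (-(k + j))
    + ε • (planeCos j k + planeCos (k + j) (-j) + planeCos k (-(k + j)))

/-- The `1⁺` function of the orbit of `k u + j v`, for `0 ≤ j ≤ k`: the constant `1` for the
origin, three terms for the two types of six-element orbits (`j = 0` and `j = k`), six terms for a
generic orbit. -/
def uPlus (k j : ℤ) : Plane → ℝ :=
  if j = 0 then
    if k = 0 then 1 else planeCos k 0 + planeCos k (-k) + planeCos 0 k
  else if j = k then planeCos k k + planeCos (2 * k) (-k) + planeCos k (-(2 * k))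
  else genericSum 1 k j

/-- The `1⁻` function of a generic orbit, `0 < j < k`. -/
def uMinus (k j : ℤ) : Plane → ℝ := genericSum (-1) k j

/-- The dihedral group of the linear isometries that preserve the dual lattice. -/
def hexSymmetries : Set (Plane ≃ₗᵢ[ℝ] Plane) :=
  {A | A '' dualLattice = dualLattice}

/-- The orbit of a vector under the dihedral group. -/
def hexOrbit (w : Plane) : Set Plane := {w' | ∃ A ∈ hexSymmetries, A w = w'}

/-- Orbits of type `1⁺` for `lam`: one pair for each orbit with both entries even. -/
def plusIndex (lam : ℝ) : Set (ℤ × ℤ) :=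
  {q | 0 ≤ q.2 ∧ q.2 ≤ q.1 ∧ Even q.1 ∧ Even q.2 ∧ lam = eigenvalue q.1 q.2}

/-- Orbits of type `1⁻` for `lam`: one pair for each generic orbit with both entries even. -/
def minusIndex (lam : ℝ) : Set (ℤ × ℤ) :=
  {q | 0 < q.2 ∧ q.2 < q.1 ∧ Even q.1 ∧ Even q.2 ∧ lam = eigenvalue q.1 q.2}

/-- The ways of writing `N = j² + k² + jk` with `k ≥ 0`, where for `k = 0` only `j ≥ 0` is
admitted, so that `(k, j)` and `(-k, -j)` are not both counted. -/
def representations (N : ℕ) : Set (ℤ × ℤ) :=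
  {q | 0 ≤ q.1 ∧ (q.1 = 0 → 0 ≤ q.2) ∧ q.2 ^ 2 + q.1 ^ 2 + q.2 * q.1 = (N : ℤ)}

end Tetra

end

/-! Rolling the tetrahedron over the plane tiled by unit triangles gives an explicit folding map
`fold` onto the surface. In the oblique coordinates `s` and `r` the edges of the tiling lie where
`s`, `r` or `r - s` is an integer, and the barycentric coordinates `bary` of the image are affine in
the triangle waves of these three numbers. Two points fold together exactly when they agree modulo
`L` up to sign (`bary_eq_bary_iff`). So `fold` induces a map from the torus that identifies `z` with
`-z`, and the fixed points of the half-turn are the points over the vertices. The isometries of the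
tiling realize all permutations of the vertices (`exists_realizes`), hence every chart is the
folding map after an isometry of the plane.

A finite energy solution therefore solves its weak equations on each isometric copy of the rhombus
in the plane. The gradients given by different charts agree on overlaps by uniqueness, partitions of
unity glue the equations, and the lattice points that remain are removable: for square integrable
data in dimension two, cutoffs at scale `ε` have bounded Dirichlet energy (`WeakDiv.of_punctured`).
The result is a periodic, even weak solution on the whole plane
(`IsLaplaceSolution.exists_gradient`). Testing it with a wave of frequency `w` gives `(4π²|w|² -
lam)` times the Fourier coefficient equal to zero (`wave_coefficient_eq_zero`). Only finitely many
coefficients survive and evenness removes the sines, so the solution is almost everywhere a finite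
sum of cosines. Smoothness over the vertices comes for free, without elliptic regularity. Conversely
such sums are classical solutions that descend to the surface (`isLaplaceSolution_of_lift`).

Multiplicities follow because a cosine is half the sum of two opposite characters and distinct
characters are independent (`coeff_of_cosSum_eq_zero`): the only relations among the cosines come
from `(k, j) ~ (-k, -j)`.

For the symmetry types, each reflection of the tetrahedron lifts to an isometry of the plane. A
function of type `1⁺` or `1⁻` is then periodic under the translations by `L/2`, which leaves only
even `k` and `j`, and averaging over the symmetries of a face turns each wave into a multiple of the
six-term sum. Rotation, swap and negation bring `(k, j)` into the chamber `0 ≤ j ≤ k`. Finally the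
symmetry group of the dual lattice is listed as twelve elements, six up to sign, and the sign
accounts for the factor 2 in the orbit sums. -/

noncomputable section

namespace Tetra

/-! ### Oblique coordinates and the triangle wave -/

/-- The oblique coordinate `x₀ - x₁ / √3` on the plane. -/
def sCoord : Plane →L[ℝ] ℝ :=
  EuclideanSpace.proj (0 : Fin 2) - (1 / √3) • EuclideanSpace.proj (1 : Fin 2)

/-- The oblique coordinate `x₀ + x₁ / √3` on the plane. -/
def rCoord : Plane →L[ℝ] ℝ :=
  EuclideanSpace.proj (0 : Fin 2) + (1 / √3) • EuclideanSpace.proj (1 : Fin 2)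

/-- The point with given oblique coordinates. -/
def pt (s r : ℝ) : Plane := !₂[(s + r) / 2, √3 / 2 * (r - s)]

theorem sCoord_apply (x : Plane) : sCoord x = x 0 - x 1 / √3 := by
  simp [sCoord, div_eq_inv_mul]

theorem rCoord_apply (x : Plane) : rCoord x = x 0 + x 1 / √3 := by
  simp [rCoord, div_eq_inv_mul]

theorem sqrt_three_sq : √3 * √3 = 3 := Real.mul_self_sqrt (by norm_num)

theorem sqrt_three_ne : √3 ≠ 0 := by positivity

@[simp] theorem sCoord_pt (s r : ℝ) : sCoord (pt s r) = s := by
  have := sqrt_three_ne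
  rw [sCoord_apply]
  simp only [pt, PiLp.toLp_apply, Matrix.cons_val_zero, Matrix.cons_val_one]
  field_simp
  ring

@[simp] theorem rCoord_pt (s r : ℝ) : rCoord (pt s r) = r := by
  have := sqrt_three_ne
  rw [rCoord_apply]
  simp only [pt, PiLp.toLp_apply, Matrix.cons_val_zero, Matrix.cons_val_one]
  field_simp
  ring

theorem apply_zero_eq (x : Plane) : x 0 = (sCoord x + rCoord x) / 2 := by
  rw [sCoord_apply, rCoord_apply]
  ring

theorem apply_one_eq (x : Plane) : x 1 = √3 / 2 * (rCoord x - sCoord x) := by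
  have := sqrt_three_ne
  rw [sCoord_apply, rCoord_apply]
  field_simp
  ring

theorem plane_ext {x y : Plane} (h0 : x 0 = y 0) (h1 : x 1 = y 1) : x = y := by
  ext i
  fin_cases i
  · exact h0
  · exact h1

theorem coord_ext {x y : Plane} (hs : sCoord x = sCoord y) (hr : rCoord x = rCoord y) : x = y :=
  plane_ext (by rw [apply_zero_eq, hs, hr, ← apply_zero_eq])
    (by rw [apply_one_eq, hs, hr, ← apply_one_eq])

@[simp] theorem pt_coord (x : Plane) : pt (sCoord x) (rCoord x) = x := coord_ext (by simp) (by simp)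

/-- The triangle wave of period two: the distance to the nearest even integer. -/
def wave (x : ℝ) : ℝ := ‖(x : AddCircle (2 : ℝ))‖

theorem continuous_wave : Continuous wave :=
  continuous_norm.comp (AddCircle.continuous_mk' 2)

@[simp] theorem wave_neg (x : ℝ) : wave (-x) = wave x := by simp [wave]

theorem wave_sub_comm (x y : ℝ) : wave (x - y) = wave (y - x) := by
  rw [← neg_sub, wave_neg]

theorem wave_add_two_mul (x : ℝ) (n : ℤ) : wave (x + 2 * n) = wave x := by
  unfold wave
  congr 1
  have := AddCircle.coe_add_period (p := (2 : ℝ)) x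
  rw [AddCircle.coe_add]
  have h : ((2 * (n : ℝ) : ℝ) : AddCircle (2 : ℝ)) = 0 := by
    rw [AddCircle.coe_eq_zero_iff]
    exact ⟨n, by simp [mul_comm]⟩
  rw [h, add_zero]

theorem wave_eq_abs {x : ℝ} (h : |x| ≤ 1) : wave x = |x| := by
  unfold wave
  rw [AddCircle.norm_coe_eq_abs_iff _ (by norm_num)]
  simpa using h

theorem exists_reduced (x : ℝ) : ∃ n : ℤ, |x + 2 * n| ≤ 1 := by
  refine ⟨-round (x / 2), ?_⟩
  have := abs_sub_round (x / 2)
  rw [abs_le] at this ⊢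
  push_cast
  constructor <;> linarith [this.1, this.2]

/-- Even shifts bring both arguments into `[-1, 1]`, where the wave is the absolute value. -/
theorem wave_eq_iff {x y : ℝ} :
    wave x = wave y ↔ ∃ n : ℤ, y = x + 2 * n ∨ y = -x + 2 * n := by
  constructor
  · intro h
    obtain ⟨m, hm⟩ := exists_reduced x
    obtain ⟨n, hn⟩ := exists_reduced y
    rw [← wave_add_two_mul x m, ← wave_add_two_mul y n, wave_eq_abs hm, wave_eq_abs hn,
      abs_eq_abs] at h
    rcases h with h | h
    · exact ⟨m - n, Or.inl (by push_cast; linarith)⟩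
    · exact ⟨-m - n, Or.inr (by push_cast; linarith)⟩
  · rintro ⟨n, rfl | rfl⟩
    · rw [wave_add_two_mul]
    · rw [wave_add_two_mul, wave_neg]

theorem wave_add_one (x : ℝ) : wave (x + 1) = 1 - wave x := by
  obtain ⟨m, hm⟩ := exists_reduced x
  rw [← wave_add_two_mul x m, wave_eq_abs hm, ← wave_add_two_mul (x + 1) m]
  rw [abs_le] at hm
  rcases le_total 0 (x + 2 * m) with h | h
  · rw [abs_of_nonneg h, ← wave_add_two_mul _ (-1), wave_eq_abs (by
      rw [abs_le]; push_cast; constructor <;> linarith), abs_of_nonpos (by push_cast; linarith)]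
    push_cast
    ring
  · rw [abs_of_nonpos h, wave_eq_abs (by rw [abs_le]; constructor <;> linarith),
      abs_of_nonneg (by linarith)]
    ring

theorem wave_add_intCast (x : ℝ) (n : ℤ) :
    wave (x + n) = if Even n then wave x else 1 - wave x := by
  split_ifs with h
  · obtain ⟨k, rfl⟩ := h
    rw [← wave_add_two_mul x k]
    push_cast
    ring_nf
  · obtain ⟨k, rfl⟩ := Int.not_even_iff_odd.1 h
    rw [← wave_add_one, ← wave_add_two_mul (x + 1) k]
    push_cast
    ring_nf

theorem wave_eq_zero_or_one_iff {x : ℝ} : wave x = 0 ∨ wave x = 1 ↔ ∃ n : ℤ, x = n := by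
  constructor
  · intro h
    obtain ⟨m, hm⟩ := exists_reduced x
    rw [← wave_add_two_mul x m, wave_eq_abs hm] at h
    rcases h with h | h
    · exact ⟨-2 * m, by push_cast; linarith [abs_eq_zero.1 h]⟩
    · rcases (abs_eq zero_le_one).1 h with h | h
      · exact ⟨1 - 2 * m, by push_cast; linarith⟩
      · exact ⟨-1 - 2 * m, by push_cast; linarith⟩
  · rintro ⟨n, rfl⟩
    have h0 : wave 0 = 0 := by simp [wave]
    have := wave_add_intCast 0 n
    rw [zero_add, h0] at this
    rw [this]
    split_ifs <;> simp

/-! ### Folding the plane onto the surface -/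

/-- The barycentric coordinates, with respect to the four vertices, of the image of a point of the
plane under the folding map. -/
def bary (x : Plane) : Fin 4 → ℝ :=
  ![1 - (wave (sCoord x) + wave (rCoord x - sCoord x) + wave (rCoord x)) / 2,
    (wave (sCoord x) + wave (rCoord x) - wave (rCoord x - sCoord x)) / 2,
    (wave (rCoord x - sCoord x) + wave (rCoord x) - wave (sCoord x)) / 2,
    (wave (sCoord x) + wave (rCoord x - sCoord x) - wave (rCoord x)) / 2]

theorem continuous_bary : Continuous bary := by
  have h1 := continuous_wave.comp sCoord.continuous
  have h2 := continuous_wave.comp rCoord.continuous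
  have h3 := continuous_wave.comp (rCoord.continuous.sub sCoord.continuous)
  simp only [Function.comp_def] at h1 h2 h3
  refine continuous_pi fun i => ?_
  fin_cases i <;> simp only [bary] <;> simp <;> fun_prop

theorem sum_bary (x : Plane) : ∑ i, bary x i = 1 := by
  simp [bary, Fin.sum_univ_four]
  ring

/-- The sums of the barycentric coordinates with indices `{1, 3}`, `{2, 3}` and `{1, 2}` recover the
three waves. -/
theorem bary_eq_iff {x y : Plane} : bary x = bary y ↔
    wave (sCoord x) = wave (sCoord y) ∧ wave (rCoord x - sCoord x) = wave (rCoord y - sCoord y) ∧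
      wave (rCoord x) = wave (rCoord y) := by
  constructor
  · intro h
    have h1 := congrFun h 1
    have h2 := congrFun h 2
    have h3 := congrFun h 3
    simp [bary] at h1 h2 h3
    refine ⟨?_, ?_, ?_⟩ <;> linarith
  · rintro ⟨h1, h2, h3⟩
    simp [bary, h1, h2, h3]

/-- An isometry of the plane realizes a permutation of the vertices. -/
def Realizes (e : Equiv.Perm (Fin 4)) (A : Plane ≃ᵃⁱ[ℝ] Plane) : Prop :=
  ∀ x i, bary (A x) (e i) = bary x i

theorem Realizes.mul {e e' : Equiv.Perm (Fin 4)} {A A' : Plane ≃ᵃⁱ[ℝ] Plane}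
    (h : Realizes e A) (h' : Realizes e' A') : Realizes (e * e') (A * A') := fun x i => by
  rw [Equiv.Perm.mul_apply, AffineIsometryEquiv.coe_mul, Function.comp_apply, h, h']

theorem Realizes.one : Realizes 1 1 := fun _ _ => rfl

theorem norm_sq_plane (x : Plane) : ‖x‖ ^ 2 = x 0 ^ 2 + x 1 ^ 2 := by
  rw [EuclideanSpace.norm_sq_eq, Fin.sum_univ_two, Real.norm_eq_abs, Real.norm_eq_abs, sq_abs,
    sq_abs]

/-- An involutive linear map of the plane that preserves `x₀² + x₁²`, as a linear isometry. -/
def involution (f : Plane →ₗ[ℝ] Plane) (hf : Function.Involutive f)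
    (hn : ∀ x, f x 0 ^ 2 + f x 1 ^ 2 = x 0 ^ 2 + x 1 ^ 2) : Plane ≃ₗᵢ[ℝ] Plane where
  toLinearEquiv := LinearEquiv.ofInvolutive f hf
  norm_map' x := by
    have h : ‖f x‖ ^ 2 = ‖x‖ ^ 2 := by rw [norm_sq_plane, norm_sq_plane, hn]
    exact (pow_left_inj₀ (norm_nonneg _) (norm_nonneg _) two_ne_zero).1 h

/-- The reflection `(x₀, x₁) ↦ (x₀, -x₁)`; it swaps the oblique coordinates. -/
def reflH : Plane ≃ₗᵢ[ℝ] Plane :=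
  involution
    { toFun := fun x => !₂[x 0, -x 1]
      map_add' := fun x y => plane_ext (by simp) (by simp; ring)
      map_smul' := fun c x => plane_ext (by simp) (by simp) }
    (fun x => plane_ext (by simp) (by simp)) (fun x => by simp)

/-- The reflection in the line through the origin of angle `30°`. -/
def reflD : Plane ≃ₗᵢ[ℝ] Plane :=
  involution
    { toFun := fun x => !₂[x 0 / 2 + √3 / 2 * x 1, √3 / 2 * x 0 - x 1 / 2]
      map_add' := fun x y => plane_ext (by simp; ring) (by simp; ring)
      map_smul' := fun c x => plane_ext (by simp; ring) (by simp; ring) }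
    (fun x => plane_ext
      (by simp; linear_combination (x 0 / 4) * sqrt_three_sq)
      (by simp; linear_combination (x 1 / 4) * sqrt_three_sq))
    (fun x => by simp; linear_combination ((x 0 ^ 2 + x 1 ^ 2) / 4) * sqrt_three_sq)

theorem reflH_apply (x : Plane) : reflH x = !₂[x 0, -x 1] := rfl

theorem reflD_apply (x : Plane) :
    reflD x = !₂[x 0 / 2 + √3 / 2 * x 1, √3 / 2 * x 0 - x 1 / 2] := rfl

@[simp] theorem sCoord_reflH (x : Plane) : sCoord (reflH x) = rCoord x := by
  rw [sCoord_apply, rCoord_apply, reflH_apply]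
  simp
  ring

@[simp] theorem rCoord_reflH (x : Plane) : rCoord (reflH x) = sCoord x := by
  rw [sCoord_apply, rCoord_apply, reflH_apply]
  simp
  ring

@[simp] theorem sCoord_reflD (x : Plane) : sCoord (reflD x) = rCoord x - sCoord x := by
  have := sqrt_three_ne
  rw [sCoord_apply, sCoord_apply, rCoord_apply, reflD_apply]
  simp
  field_simp
  linear_combination (x 1) * sqrt_three_sq

@[simp] theorem rCoord_reflD (x : Plane) : rCoord (reflD x) = rCoord x := by
  have := sqrt_three_ne
  rw [rCoord_apply, rCoord_apply, reflD_apply]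
  simp
  field_simp
  linear_combination (x 1) * sqrt_three_sq

/-- The reflection `(x₀, x₁) ↦ (1 - x₀, x₁)`. -/
def reflV : Plane ≃ᵃⁱ[ℝ] Plane :=
  ((reflH.trans (LinearIsometryEquiv.neg ℝ)).toAffineIsometryEquiv).trans
    (AffineIsometryEquiv.constVAdd ℝ Plane (pt 1 1))

theorem reflV_apply (x : Plane) : reflV x = pt 1 1 + -reflH x := rfl

@[simp] theorem sCoord_reflV (x : Plane) : sCoord (reflV x) = 1 - rCoord x := by
  rw [reflV_apply, map_add, map_neg, sCoord_pt, sCoord_reflH, sub_eq_add_neg]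

@[simp] theorem rCoord_reflV (x : Plane) : rCoord (reflV x) = 1 - sCoord x := by
  rw [reflV_apply, map_add, map_neg, rCoord_pt, rCoord_reflH, sub_eq_add_neg]

theorem wave_one_sub (x : ℝ) : wave (1 - x) = 1 - wave x := by
  rw [sub_eq_neg_add, wave_add_one, wave_neg]

theorem realizes_reflH : Realizes (Equiv.swap 2 3) reflH.toAffineIsometryEquiv := fun x i => by
  have h := wave_sub_comm (sCoord x) (rCoord x)
  fin_cases i <;> simp [bary, Equiv.swap_apply_def, h] <;> ring

theorem realizes_reflD : Realizes (Equiv.swap 1 2) reflD.toAffineIsometryEquiv := fun x i => by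
  fin_cases i <;> simp [bary, Equiv.swap_apply_def] <;> ring

theorem realizes_reflV : Realizes (Equiv.swap 0 1) reflV := fun x i => by
  fin_cases i <;> simp [bary, Equiv.swap_apply_def, wave_one_sub] <;> ring

/-- The permutation of the vertices realized by the translation with oblique coordinates
`m` and `n`. -/
def cellPerm (m n : ℤ) : Equiv.Perm (Fin 4) :=
  if Even m then (if Even n then 1 else Equiv.swap 0 2 * Equiv.swap 1 3)
  else if Even n then Equiv.swap 0 3 * Equiv.swap 1 2 else Equiv.swap 0 1 * Equiv.swap 2 3

/-- An odd shift replaces a wave by one minus the wave. Of `m`, `n`, `n - m` either none or exactly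
two are odd, and complementing two of the three waves permutes the barycentric coordinates by a
double transposition. -/
theorem bary_pt_add (m n : ℤ) (x : Plane) (i : Fin 4) :
    bary (pt m n + x) (cellPerm m n i) = bary x i := by
  have h1 : wave (sCoord (pt m n + x)) = if Even m then wave (sCoord x) else 1 - wave (sCoord x) := by
    rw [map_add, sCoord_pt, add_comm, wave_add_intCast]
  have h2 : wave (rCoord (pt m n + x)) = if Even n then wave (rCoord x) else 1 - wave (rCoord x) := by
    rw [map_add, rCoord_pt, add_comm, wave_add_intCast]
  have h3 : wave (rCoord (pt m n + x) - sCoord (pt m n + x)) =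
      if Even (n - m) then wave (rCoord x - sCoord x) else 1 - wave (rCoord x - sCoord x) := by
    rw [← wave_add_intCast, map_add, map_add, rCoord_pt, sCoord_pt]
    congr 1
    push_cast
    ring
  generalize pt (m : ℝ) n + x = y at h1 h2 h3 ⊢
  by_cases hm : Even m <;> by_cases hn : Even n <;>
    simp only [Int.even_sub, hm, hn, if_true, if_false, iff_true, iff_false, not_true]  at h1 h2 h3 <;>
    fin_cases i <;> simp [bary, cellPerm, hm, hn, h1, h2, h3, Equiv.swap_apply_def] <;> ring

theorem realizes_constVAdd (m n : ℤ) :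
    Realizes (cellPerm m n) (AffineIsometryEquiv.constVAdd ℝ Plane (pt m n)) :=
  fun x i => bary_pt_add m n x i

/-- The three reflections realize the adjacent transpositions, and these generate the symmetric
group. -/
theorem exists_realizes (e : Equiv.Perm (Fin 4)) : ∃ A, Realizes e A := by
  have he : e ∈ Submonoid.closure
      (Set.range fun i : Fin 3 => Equiv.swap i.castSucc i.succ) := by
    rw [Equiv.Perm.mclosure_swap_castSucc_succ]
    trivial
  induction he using Submonoid.closure_induction with
  | mem x hx =>
    obtain ⟨i, rfl⟩ := hx
    fin_cases i
    · exact ⟨_, realizes_reflV⟩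
    · exact ⟨_, realizes_reflD⟩
    · exact ⟨_, realizes_reflH⟩
  | one => exact ⟨_, Realizes.one⟩
  | mul x y _ _ hx hy =>
    obtain ⟨A, hA⟩ := hx
    obtain ⟨B, hB⟩ := hy
    exact ⟨_, hA.mul hB⟩

/-! ### The lattice and the torus -/

theorem mem_hexLattice_iff {x : Plane} :
    x ∈ hexLattice ↔ ∃ m n : ℤ, sCoord x = 2 * m ∧ rCoord x = 2 * n := by
  have h1 : (!₂[2, 0] : Plane) = pt 2 2 := plane_ext (by simp [pt]) (by simp [pt])
  have h2 : (!₂[1, √3] : Plane) = pt 0 2 := plane_ext (by simp [pt]) (by simp [pt])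
  unfold hexLattice
  rw [h1, h2, AddSubgroup.mem_closure_pair]
  constructor
  · rintro ⟨m, n, rfl⟩
    refine ⟨m, m + n, ?_, ?_⟩ <;>
      simp only [map_add, map_zsmul, sCoord_pt, rCoord_pt, zsmul_eq_mul] <;> push_cast <;> ring
  · rintro ⟨m, n, hm, hn⟩
    refine ⟨m, n - m, coord_ext ?_ ?_⟩ <;>
      simp only [map_add, map_zsmul, sCoord_pt, rCoord_pt, zsmul_eq_mul, hm, hn] <;> push_cast <;>
      ring

theorem exists_cell (x : Plane) : ∃ (m n : ℤ) (y : Plane), x = pt m n + y ∧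
    0 ≤ sCoord y ∧ sCoord y < 1 ∧ 0 ≤ rCoord y ∧ rCoord y < 1 := by
  refine ⟨⌊sCoord x⌋, ⌊rCoord x⌋, x - pt ⌊sCoord x⌋ ⌊rCoord x⌋, by abel, ?_, ?_, ?_, ?_⟩ <;>
    simp only [map_sub, sCoord_pt, rCoord_pt] <;>
    linarith [Int.floor_le (sCoord x), Int.lt_floor_add_one (sCoord x), Int.floor_le (rCoord x),
      Int.lt_floor_add_one (rCoord x)]

/-- On this triangle the folding map is affine: it is the face `p 0, p 1, p 2` in its initial
position. -/
theorem bary_of_le {x : Plane} (h0 : 0 ≤ sCoord x) (h1 : sCoord x ≤ rCoord x)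
    (h2 : rCoord x ≤ 1) :
    bary x = ![1 - rCoord x, sCoord x, rCoord x - sCoord x, 0] := by
  rw [bary, wave_eq_abs (by rw [abs_le]; constructor <;> linarith),
    wave_eq_abs (by rw [abs_le]; constructor <;> linarith),
    wave_eq_abs (by rw [abs_le]; constructor <;> linarith), abs_of_nonneg h0,
    abs_of_nonneg (by linarith), abs_of_nonneg (by linarith)]
  ext i
  fin_cases i <;> simp <;> ring

theorem bary_of_ge {x : Plane} (h0 : 0 ≤ rCoord x) (h1 : rCoord x ≤ sCoord x)
    (h2 : sCoord x ≤ 1) :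
    bary x = ![1 - sCoord x, rCoord x, 0, sCoord x - rCoord x] := by
  rw [bary, wave_eq_abs (by rw [abs_le]; constructor <;> linarith),
    wave_eq_abs (by rw [abs_le]; constructor <;> linarith),
    wave_eq_abs (by rw [abs_le]; constructor <;> linarith), abs_of_nonneg (by linarith),
    abs_of_nonpos (by linarith), abs_of_nonneg (by linarith)]
  ext i
  fin_cases i <;> simp <;> ring

theorem bary_nonneg_and_exists_zero (x : Plane) :
    (∀ i, 0 ≤ bary x i) ∧ ∃ l, bary x l = 0 := by
  obtain ⟨m, n, y, rfl, h1, h2, h3, h4⟩ := exists_cell x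
  have key : (∀ i, 0 ≤ bary y i) ∧ ∃ l, bary y l = 0 := by
    rcases le_total (sCoord y) (rCoord y) with h | h
    · rw [bary_of_le h1 h h4.le]
      refine ⟨fun i => ?_, 3, by simp⟩
      fin_cases i <;> simp <;> linarith
    · rw [bary_of_ge h3 h h2.le]
      refine ⟨fun i => ?_, 2, by simp⟩
      fin_cases i <;> simp <;> linarith
  obtain ⟨h5, l, hl⟩ := key
  refine ⟨fun i => ?_, cellPerm m n l, by rw [bary_pt_add, hl]⟩
  have := bary_pt_add m n y ((cellPerm m n).symm i)
  rw [Equiv.apply_symm_apply] at this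
  rw [this]
  exact h5 _

theorem exists_bary_eq {w : Fin 4 → ℝ} (h0 : ∀ i, 0 ≤ w i) (h1 : ∑ i, w i = 1) {l : Fin 4}
    (hl : w l = 0) : ∃ x, bary x = w := by
  have base : ∀ w : Fin 4 → ℝ, (∀ i, 0 ≤ w i) → ∑ i, w i = 1 → w 3 = 0 → ∃ x, bary x = w := by
    intro w h0 h1 h3
    rw [Fin.sum_univ_four] at h1
    have := h0 0
    have := h0 1
    have := h0 2
    refine ⟨pt (w 1) (w 1 + w 2), ?_⟩
    rw [bary_of_le (by simpa) (by simpa) (by simp; linarith)]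
    ext i
    fin_cases i <;> simp <;> linarith
  -- The double transpositions act transitively on the vertices, so a translation reduces any face
  -- to the one opposite vertex 3.
  obtain ⟨m, n, hmn⟩ : ∃ m n : ℤ, cellPerm m n 3 = l := by
    fin_cases l
    · exact ⟨1, 0, by simp [cellPerm, Equiv.swap_apply_def]⟩
    · exact ⟨0, 1, by simp [cellPerm, Equiv.swap_apply_def]⟩
    · exact ⟨1, 1, by simp [cellPerm, Equiv.swap_apply_def]⟩
    · exact ⟨0, 0, by simp [cellPerm]⟩
  obtain ⟨x, hx⟩ := base (w ∘ cellPerm m n) (fun i => h0 _)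
    (by rw [← h1]; exact Equiv.sum_comp (cellPerm m n) w) (by simp [hmn, hl])
  refine ⟨pt m n + x, funext fun i => ?_⟩
  have := bary_pt_add m n x ((cellPerm m n).symm i)
  rw [Equiv.apply_symm_apply] at this
  rw [this, hx]
  simp

/-- The folding map of the plane onto the surface. -/
def fold (p : Fin 4 → Space) (x : Plane) : Space := ∑ i, bary x i • p i

theorem continuous_fold (p : Fin 4 → Space) : Continuous (fold p) :=
  continuous_finsetSum _ fun i _ => ((continuous_apply i).comp continuous_bary).smul continuous_const

theorem Realizes.fold_eq {e : Equiv.Perm (Fin 4)} {A : Plane ≃ᵃⁱ[ℝ] Plane} (h : Realizes e A)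
    (p : Fin 4 → Space) (x : Plane) : fold p (A x) = fold (p ∘ e) x := by
  unfold fold
  rw [← Equiv.sum_comp e]
  simp [h x]

theorem fold_mem_surface (p : Fin 4 → Space) (x : Plane) : fold p x ∈ surface p := by
  obtain ⟨h0, l, hl⟩ := bary_nonneg_and_exists_zero x
  refine Set.mem_iUnion.2 ⟨l, ?_⟩
  have hs : fold p x = ∑ i ∈ Finset.univ.erase l, bary x i • p i := by
    unfold fold
    rw [← Finset.add_sum_erase _ _ (Finset.mem_univ l), hl, zero_smul, zero_add]
  rw [hs]
  refine (convex_convexHull ℝ _).sum_mem (fun i _ => h0 i) ?_ fun i hi =>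
    subset_convexHull ℝ _ ⟨i, by simpa using hi, rfl⟩
  have := sum_bary x
  rwa [← Finset.add_sum_erase _ _ (Finset.mem_univ l), hl, zero_add] at this

theorem exists_fold_eq {p : Fin 4 → Space} {y : Space} (hy : y ∈ surface p) :
    ∃ x, fold p x = y := by
  obtain ⟨l, hl⟩ := Set.mem_iUnion.1 hy
  have hsub : convexHull ℝ (p '' {l}ᶜ) ⊆
      (fun w : Fin 4 → ℝ => ∑ i, w i • p i) '' {w | (∀ i, 0 ≤ w i) ∧ ∑ i, w i = 1 ∧ w l = 0} := by
    refine convexHull_min ?_ ?_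
    · rintro _ ⟨i, hi, rfl⟩
      refine ⟨Pi.single i 1, ⟨fun j => ?_, by simp, ?_⟩, ?_⟩
      · by_cases h : j = i
        · subst h; simp
        · simp [h]
      · rw [Pi.single_eq_of_ne]
        exact fun h => hi h.symm
      · simp [Pi.single_apply]
    · rintro _ ⟨w, ⟨a1, a2, a3⟩, rfl⟩ _ ⟨w', ⟨b1, b2, b3⟩, rfl⟩ a b ha hb hab
      refine ⟨a • w + b • w', ⟨fun i => ?_, ?_, ?_⟩, ?_⟩
      · have := a1 i
        have := b1 i
        simp only [Pi.add_apply, Pi.smul_apply, smul_eq_mul]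
        positivity
      · simp [Finset.sum_add_distrib, ← Finset.mul_sum, a2, b2, hab]
      · simp [a3, b3]
      · simp [add_smul, Finset.sum_add_distrib, Finset.smul_sum, smul_smul]
  obtain ⟨w, ⟨h0, h1, h2⟩, rfl⟩ := hsub hl
  obtain ⟨x, hx⟩ := exists_bary_eq h0 h1 h2
  exact ⟨x, by simp [fold, hx]⟩

theorem bary_add_lattice {x l : Plane} (hl : l ∈ hexLattice) : bary (x + l) = bary x := by
  obtain ⟨m, n, hm, hn⟩ := mem_hexLattice_iff.1 hl
  rw [bary_eq_iff, map_add, map_add, hm, hn, wave_add_two_mul, wave_add_two_mul,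
    ← wave_add_two_mul (rCoord x - sCoord x) (n - m)]
  refine ⟨rfl, ?_, rfl⟩
  congr 1
  push_cast
  ring

theorem bary_neg (x : Plane) : bary (-x) = bary x := by
  rw [bary_eq_iff, map_neg, map_neg, wave_neg, wave_neg, ← wave_neg (rCoord x - sCoord x)]
  refine ⟨rfl, ?_, rfl⟩
  congr 1
  ring

/-- Each of `s`, `r`, `r - s` is determined modulo 2 up to a sign. Two of the three signs must
coincide, and as the third number is a sum or difference of the other two, that common sign holds
for all. -/
theorem bary_eq_bary_iff {x y : Plane} :
    bary x = bary y ↔ y - x ∈ hexLattice ∨ y + x ∈ hexLattice := by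
  constructor
  · intro h
    obtain ⟨h1, h2, h3⟩ := bary_eq_iff.1 h
    obtain ⟨a, ha⟩ := wave_eq_iff.1 h1
    obtain ⟨b, hb⟩ := wave_eq_iff.1 h2
    obtain ⟨c, hc⟩ := wave_eq_iff.1 h3
    simp only [mem_hexLattice_iff, map_add, map_sub]
    rcases ha with ha | ha <;> rcases hc with hc | hc
    · exact Or.inl ⟨a, c, by linarith, by linarith⟩
    · rcases hb with hb | hb
      · exact Or.inl ⟨a, a + b, by linarith, by push_cast; linarith⟩
      · exact Or.inr ⟨c - b, c, by push_cast; linarith, by linarith⟩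
    · rcases hb with hb | hb
      · exact Or.inl ⟨c - b, c, by push_cast; linarith, by linarith⟩
      · exact Or.inr ⟨a, a + b, by linarith, by push_cast; linarith⟩
    · exact Or.inr ⟨a, c, by linarith, by linarith⟩
  · rintro (h | h)
    · rw [← bary_add_lattice h]
      simp
    · rw [← bary_neg x, ← bary_add_lattice h]
      simp

/-! ### Regular tetrahedra -/

section Regular

variable {p : Fin 4 → Space} (hp : ∀ i j, i ≠ j → dist (p i) (p j) = 1)

include hp

/-- For weights of sum zero, `|∑ cᵢ pᵢ|²` is `-½ ∑ cᵢ cⱼ |pᵢ - pⱼ|²`. With all mutual distances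
equal to 1 this is `½ ∑ cᵢ²`, so the vertices are affinely independent. -/
theorem weights_eq_zero {c : Fin 4 → ℝ} (h0 : ∑ i, c i = 0) (h : ∑ i, c i • p i = 0) : c = 0 := by
  have key := EuclideanGeometry.inner_weightedVSub (s₁ := Finset.univ) (s₂ := Finset.univ)
    (w₁ := c) (w₂ := c) p h0 p h0
  rw [Finset.univ.weightedVSub_eq_linear_combination h0, h, inner_zero_left] at key
  have hd : ∀ i j, dist (p i) (p j) * dist (p i) (p j) = if i = j then 0 else 1 := by
    intro i j
    split_ifs with hij
    · simp [hij]
    · simp [hp i j hij]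
  simp only [hd, Fin.sum_univ_four] at key h0
  simp at key
  have h4 : c 0 ^ 2 + c 1 ^ 2 + c 2 ^ 2 + c 3 ^ 2 = 0 := by
    have : (c 0 + c 1 + c 2 + c 3) ^ 2 = 0 := by rw [h0]; norm_num
    linarith
  have hz : ∀ i, c i ^ 2 = 0 := by
    intro i
    have := sq_nonneg (c 0)
    have := sq_nonneg (c 1)
    have := sq_nonneg (c 2)
    have := sq_nonneg (c 3)
    fin_cases i <;> simp only [Fin.zero_eta, Fin.mk_one, Fin.reduceFinMk] <;> linarith
  exact funext fun i => pow_eq_zero_iff two_ne_zero |>.1 (hz i)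

theorem weights_unique {c d : Fin 4 → ℝ} (h0 : ∑ i, c i = ∑ i, d i)
    (h : ∑ i, c i • p i = ∑ i, d i • p i) : c = d := by
  have := weights_eq_zero hp (c := c - d) (by simp [h0]) (by simp [sub_smul, h])
  exact sub_eq_zero.1 this

theorem fold_eq_iff {x y : Plane} : fold p x = fold p y ↔ bary x = bary y :=
  ⟨fun h => weights_unique hp (by rw [sum_bary, sum_bary]) h, fun h => by simp [fold, h]⟩

/-- At a vertex the barycentric coordinates are 0 or 1 with a single 1, so the waves of `s` and `r`
are 0 or 1, which happens only at integers. -/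
theorem fold_eq_vertex_iff {x : Plane} :
    (∃ i, fold p x = p i) ↔ ∃ m n : ℤ, sCoord x = m ∧ rCoord x = n := by
  constructor
  · rintro ⟨i, hi⟩
    have hb : bary x = Pi.single i 1 :=
      weights_unique hp (by rw [sum_bary]; simp) (by rw [← fold, hi]; simp [Pi.single_apply])
    have h1 : bary x 1 + bary x 3 = wave (sCoord x) := by simp [bary]; ring
    have h2 : bary x 1 + bary x 2 = wave (rCoord x) := by simp [bary]; ring
    rw [hb] at h1 h2
    have k1 : wave (sCoord x) = 0 ∨ wave (sCoord x) = 1 := by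
      rw [← h1]; fin_cases i <;> simp
    have k2 : wave (rCoord x) = 0 ∨ wave (rCoord x) = 1 := by
      rw [← h2]; fin_cases i <;> simp
    obtain ⟨m, hm⟩ := wave_eq_zero_or_one_iff.1 k1
    obtain ⟨n, hn⟩ := wave_eq_zero_or_one_iff.1 k2
    exact ⟨m, n, hm, hn⟩
  · rintro ⟨m, n, hm, hn⟩
    have hx : x = AffineIsometryEquiv.constVAdd ℝ Plane (pt m n) 0 := by
      change x = pt m n + 0
      rw [add_zero, ← hm, ← hn, pt_coord]
    refine ⟨cellPerm m n 0, ?_⟩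
    rw [hx, (realizes_constVAdd m n).fold_eq, fold, bary_of_le (by simp) (by simp) (by simp)]
    simp [Fin.sum_univ_four]

end Regular

/-! ### The branched cover -/

/-- Closedness makes the torus Hausdorff. The lattice is the common zero set of two continuous
waves. -/
theorem isClosed_hexLattice : IsClosed (hexLattice : Set Plane) := by
  have h : (hexLattice : Set Plane) = {x | wave (sCoord x) = 0} ∩ {x | wave (rCoord x) = 0} := by
    have w0 : ∀ y, wave y = 0 ↔ ∃ n : ℤ, y = 2 * n := by
      intro y
      have h0 : wave 0 = 0 := by simp [wave]
      rw [eq_comm, ← h0, wave_eq_iff]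
      simp
    ext x
    simp only [SetLike.mem_coe, mem_hexLattice_iff, Set.mem_inter_iff, Set.mem_ofPred_eq, w0]
    exact ⟨fun ⟨m, n, h1, h2⟩ => ⟨⟨m, h1⟩, n, h2⟩, fun ⟨⟨m, h1⟩, n, h2⟩ => ⟨m, n, h1, h2⟩⟩
  rw [h]
  exact (isClosed_eq (continuous_wave.comp sCoord.continuous) continuous_const).inter
    (isClosed_eq (continuous_wave.comp rCoord.continuous) continuous_const)

instance : T2Space HexTorus :=
  have := isClosed_hexLattice
  inferInstance

theorem toTorus_surjective : Function.Surjective toTorus := QuotientAddGroup.mk_surjective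

theorem continuous_toTorus : Continuous toTorus := QuotientAddGroup.continuous_mk

theorem toTorus_eq_iff {x y : Plane} : toTorus x = toTorus y ↔ y - x ∈ hexLattice := by
  rw [toTorus, toTorus, QuotientAddGroup.eq, neg_add_eq_sub]

theorem halfTurn_toTorus (x : Plane) : halfTurn (toTorus x) = toTorus (-x) := rfl

theorem continuous_pt : Continuous fun q : ℝ × ℝ => pt q.1 q.2 := by
  unfold pt
  refine (PiLp.continuous_toLp 2 _).comp (continuous_pi fun i => ?_)
  fin_cases i <;> simp <;> fun_prop

instance : CompactSpace HexTorus := by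
  have hc : IsCompact ((fun q : ℝ × ℝ => toTorus (pt q.1 q.2)) ''
      (Set.Icc (-1) 1 ×ˢ Set.Icc (-1) 1)) :=
    (isCompact_Icc.prod isCompact_Icc).image (continuous_toTorus.comp continuous_pt)
  suffices h : (fun q : ℝ × ℝ => toTorus (pt q.1 q.2)) '' (Set.Icc (-1) 1 ×ˢ Set.Icc (-1) 1) =
      Set.univ by rw [h] at hc; exact ⟨hc⟩
  refine Set.eq_univ_of_forall fun z => ?_
  obtain ⟨x, rfl⟩ := toTorus_surjective z
  obtain ⟨m, hm⟩ := exists_reduced (sCoord x)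
  obtain ⟨n, hn⟩ := exists_reduced (rCoord x)
  refine ⟨(sCoord x + 2 * m, rCoord x + 2 * n), ⟨abs_le.1 hm, abs_le.1 hn⟩, ?_⟩
  rw [toTorus_eq_iff, mem_hexLattice_iff]
  exact ⟨-m, -n, by simp, by simp⟩

/-- The branched cover of the surface by the torus. -/
def cover (p : Fin 4 → Space) : C(HexTorus, Surface p) where
  toFun := Quotient.lift (fun x => (⟨fold p x, fold_mem_surface p x⟩ : Surface p)) (by
    intro x y h
    have h' : y - x ∈ hexLattice := by
      rw [← neg_add_eq_sub]
      exact QuotientAddGroup.leftRel_apply.1 h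
    simp only [Subtype.mk.injEq, fold]
    rw [bary_eq_bary_iff.2 (Or.inl h')])
  continuous_toFun := ((continuous_fold p).subtype_mk _).quotient_lift _

@[simp] theorem cover_toTorus (p : Fin 4 → Space) (x : Plane) :
    (cover p (toTorus x) : Space) = fold p x := rfl

theorem cover_surjective (p : Fin 4 → Space) : Function.Surjective (cover p) := fun y => by
  obtain ⟨x, hx⟩ := exists_fold_eq y.2
  exact ⟨toTorus x, Subtype.ext hx⟩

/-- A continuous surjection from a compact space to a Hausdorff space is closed. -/
theorem isQuotientMap_cover (p : Fin 4 → Space) : IsQuotientMap (cover p) :=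
  (cover p).continuous.isClosedMap.isQuotientMap (cover p).continuous (cover_surjective p)

/-- `x₀ - |x₁|/√3` and `x₀ + |x₁|/√3` are the smaller and the larger of the two oblique coordinates,
in which the rhombus is the open unit square. -/
theorem mem_rhombus_iff {x : Plane} :
    x ∈ rhombus ↔ (0 < sCoord x ∧ sCoord x < 1) ∧ 0 < rCoord x ∧ rCoord x < 1 := by
  have h3 : (0 : ℝ) < √3 := by positivity
  rw [rhombus, Set.mem_ofPred_eq, sCoord_apply, rCoord_apply]
  rcases le_total 0 (x 1) with h | h
  · rw [abs_of_nonneg h]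
    have : 0 ≤ x 1 / √3 := by positivity
    constructor
    · rintro ⟨h1, h2⟩
      exact ⟨⟨by linarith, by linarith⟩, by linarith, by linarith⟩
    · rintro ⟨⟨h1, h2⟩, h3, h4⟩
      exact ⟨by linarith, by linarith⟩
  · rw [abs_of_nonpos h, neg_div]
    have : x 1 / √3 ≤ 0 := div_nonpos_of_nonpos_of_nonneg h h3.le
    constructor
    · rintro ⟨h1, h2⟩
      exact ⟨⟨by linarith, by linarith⟩, by linarith, by linarith⟩
    · rintro ⟨⟨h1, h2⟩, h3, h4⟩
      exact ⟨by linarith, by linarith⟩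

theorem chart_eq_fold (p : Fin 4 → Space) (e : Equiv.Perm (Fin 4)) {x : Plane}
    (hx : x ∈ rhombus) : chart p e x = fold (p ∘ e) x := by
  obtain ⟨⟨h1, h2⟩, h3, h4⟩ := mem_rhombus_iff.1 hx
  have h5 := sqrt_three_ne
  have h6 : (0 : ℝ) < √3 := by positivity
  have e1 := sCoord_apply x
  have e2 := rCoord_apply x
  unfold chart fold
  rcases le_or_gt 0 (x 1) with h | h
  · have : 0 ≤ x 1 / √3 := by positivity
    rw [bary_of_le h1.le (by linarith) h4.le, abs_of_nonneg h, if_pos h]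
    simp only [Fin.sum_univ_four, e1, e2]
    simp
    congr 3 <;> ring
  · have : x 1 / √3 < 0 := div_neg_of_neg_of_pos h h6
    rw [bary_of_ge h3.le (by linarith) h2.le, abs_of_neg h, if_neg (by linarith)]
    simp only [Fin.sum_univ_four, e1, e2]
    simp
    congr 3 <;> ring

theorem Realizes.fold_eq_chart {e : Equiv.Perm (Fin 4)} {A : Plane ≃ᵃⁱ[ℝ] Plane}
    (h : Realizes e A) (p : Fin 4 → Space) {x : Plane} (hx : x ∈ rhombus) :
    fold p (A x) = chart p e x := by
  rw [h.fold_eq, chart_eq_fold p e hx]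

section Regular

variable {p : Fin 4 → Space} (hp : ∀ i j, i ≠ j → dist (p i) (p j) = 1)

include hp

theorem cover_mem_vertexSet_iff {x : Plane} :
    cover p (toTorus x) ∈ vertexSet p ↔ ∃ m n : ℤ, sCoord x = m ∧ rCoord x = n := by
  rw [← fold_eq_vertex_iff hp]
  rfl

theorem cover_eq_iff (z w : HexTorus) : cover p z = cover p w ↔ w = z ∨ w = halfTurn z := by
  obtain ⟨x, rfl⟩ := toTorus_surjective z
  obtain ⟨y, rfl⟩ := toTorus_surjective w
  rw [Subtype.ext_iff, cover_toTorus, cover_toTorus, fold_eq_iff hp, bary_eq_bary_iff,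
    halfTurn_toTorus, eq_comm, toTorus_eq_iff, eq_comm, toTorus_eq_iff, sub_neg_eq_add]

theorem halfTurn_eq_iff (z : HexTorus) : halfTurn z = z ↔ cover p z ∈ vertexSet p := by
  obtain ⟨x, rfl⟩ := toTorus_surjective z
  rw [halfTurn_toTorus, toTorus_eq_iff, cover_mem_vertexSet_iff hp, mem_hexLattice_iff]
  simp only [map_sub, map_neg]
  constructor
  · rintro ⟨m, n, hm, hn⟩
    exact ⟨m, n, by linarith, by linarith⟩
  · rintro ⟨m, n, hm, hn⟩
    exact ⟨m, n, by linarith, by linarith⟩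

theorem cover_preimage (z : HexTorus) : cover p ⁻¹' {cover p z} = {z, halfTurn z} := by
  ext w
  rw [Set.mem_preimage, Set.mem_singleton_iff, eq_comm, cover_eq_iff hp]
  rfl

/-- The fibres are the orbits of the finite group `{1, -1}`, here `ℤˣ`, on the torus. Such a
quotient is a covering over the points with trivial stabilizer, and `halfTurn_eq_iff` places the
other points over the vertices. -/
theorem isCoveringMapOn_cover : IsCoveringMapOn (cover p) (vertexSet p)ᶜ := by
  have horb : ∀ {z w : HexTorus}, cover p z = cover p w ↔ z ∈ MulAction.orbit ℤˣ w := by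
    intro z w
    rw [eq_comm, cover_eq_iff hp]
    constructor
    · rintro (rfl | rfl)
      · exact ⟨1, one_smul _ _⟩
      · exact ⟨-1, by simp [halfTurn, Units.smul_def]⟩
    · rintro ⟨u, rfl⟩
      rcases Int.units_eq_one_or u with rfl | rfl
      · exact Or.inl (one_smul _ _)
      · exact Or.inr (by simp [halfTurn, Units.smul_def])
  have : ContinuousConstSMul ℤˣ HexTorus :=
    ⟨fun u => by simpa [Units.smul_def] using continuous_const_smul (T := HexTorus) (u : ℤ)⟩
  refine ((isQuotientMap_cover p).isCoveringMapOn_of_properlyDiscontinuousSMul horb).mono ?_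
  intro y hy
  obtain ⟨z, rfl⟩ := cover_surjective p y
  refine ⟨z, ?_, rfl⟩
  rw [Set.mem_ofPred_eq, Subgroup.eq_bot_iff_forall]
  intro u hu
  rcases Int.units_eq_one_or u with rfl | rfl
  · rfl
  · refine absurd ((halfTurn_eq_iff hp z).1 ?_) hy
    simpa [halfTurn, Units.smul_def] using hu

theorem isTwofoldBranchedCover_cover : IsTwofoldBranchedCover p (cover p) where
  covering := isCoveringMapOn_cover hp
  two_sheets y hy := by
    obtain ⟨z, rfl⟩ := cover_surjective p y
    rw [cover_preimage hp, Set.ncard_pair]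
    exact fun h => hy ((halfTurn_eq_iff hp z).1 h.symm)
  branched y hy := by
    obtain ⟨z, rfl⟩ := cover_surjective p y
    rw [cover_preimage hp, (halfTurn_eq_iff hp z).2 hy]
    simp
  identified := cover_eq_iff hp
  isometric e := by
    obtain ⟨A, hA⟩ := exists_realizes e
    exact ⟨A, fun x hx => hA.fold_eq_chart p hx⟩
  face s t hs ht hst := by
    have hx : (s • !₂[1, 0] + t • !₂[1 / 2, √3 / 2] : Plane) = pt s (s + t) :=
      plane_ext (by simp [pt]; ring) (by simp [pt]; ring)
    rw [cover_toTorus, hx, fold, bary_of_le (by simpa) (by simpa) (by simpa)]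
    simp [Fin.sum_univ_four, sub_sub]

end Regular

/-! ### Charts and smoothness -/

theorem isOpen_rhombus : IsOpen rhombus := by
  have h : rhombus = (sCoord ⁻¹' Set.Ioo 0 1) ∩ (rCoord ⁻¹' Set.Ioo 0 1) := by
    ext x
    rw [mem_rhombus_iff]
    rfl
  rw [h]
  exact (isOpen_Ioo.preimage sCoord.continuous).inter (isOpen_Ioo.preimage rCoord.continuous)

/-- The isometric copies of the open rhombus cover the plane without the lattice of vertices. After
a translation the point lies in the half-open unit square of oblique coordinates. -/
theorem exists_realizes_mem_rhombus {x : Plane}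
    (hx : ¬ ∃ m n : ℤ, sCoord x = m ∧ rCoord x = n) :
    ∃ e A, Realizes e A ∧ ∃ y ∈ rhombus, A y = x := by
  obtain ⟨m, n, y, rfl, h1, h2, h3, h4⟩ := exists_cell x
  suffices h : ∃ e A, Realizes e A ∧ ∃ z ∈ rhombus, A z = y by
    obtain ⟨e, A, hA, z, hz, rfl⟩ := h
    exact ⟨_, _, (realizes_constVAdd m n).mul hA, z, hz, rfl⟩
  rcases h1.lt_or_eq with h1 | h1
  · rcases h3.lt_or_eq with h3 | h3
    · exact ⟨_, _, Realizes.one, y, mem_rhombus_iff.2 ⟨⟨h1, h2⟩, h3, h4⟩, rfl⟩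
    -- A point on a side of the rhombus is moved to the short diagonal `s = r`, the common edge of
    -- the two triangles, which is interior to the rhombus.
    · refine ⟨_, _, realizes_reflH.mul realizes_reflD, pt (sCoord y) (sCoord y),
        mem_rhombus_iff.2 (by simp [h1, h2]), coord_ext ?_ ?_⟩
      · simp [AffineIsometryEquiv.coe_mul]
      · simp [AffineIsometryEquiv.coe_mul, h3]
  · rcases h3.lt_or_eq with h3 | h3
    · refine ⟨_, _, realizes_reflD, pt (rCoord y) (rCoord y),
        mem_rhombus_iff.2 (by simp [h3, h4]), coord_ext ?_ ?_⟩
      · simp [h1]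
      · simp
    · exact absurd ⟨m, n, by simp [← h1], by simp [← h3]⟩ hx

theorem contDiff_affineIsometryEquiv (A : Plane ≃ᵃⁱ[ℝ] Plane) : ContDiff ℝ ∞ A := by
  have h : (A : Plane → Plane) = fun x => A.linearIsometryEquiv x + A 0 := by
    funext x
    have := A.map_vadd 0 x
    simpa using this
  rw [h]
  exact A.linearIsometryEquiv.toContinuousLinearEquiv.contDiff.add contDiff_const

theorem Realizes.pull_eq {e : Equiv.Perm (Fin 4)} {A : Plane ≃ᵃⁱ[ℝ] Plane} (h : Realizes e A)
    {p : Fin 4 → Space} (u : Surface p → ℝ) {x : Plane} (hx : x ∈ rhombus) :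
    pull p e u x = u (cover p (toTorus (A x))) := by
  unfold pull
  rw [dif_pos hx]
  congr 1
  exact Subtype.ext (h.fold_eq_chart p hx).symm

/-- At a point with integer coordinates some barycentric coordinate equals 1, which is impossible
inside the open rhombus. -/
theorem Realizes.not_mem_lattice {e : Equiv.Perm (Fin 4)} {A : Plane ≃ᵃⁱ[ℝ] Plane}
    (h : Realizes e A) {x : Plane} (hx : x ∈ rhombus) :
    ¬ ∃ m n : ℤ, sCoord (A x) = m ∧ rCoord (A x) = n := by
  rintro ⟨m, n, hm, hn⟩
  have hb : ∃ i, bary (A x) i = 1 := by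
    have hx : A x = pt m n + 0 := by rw [add_zero, ← hm, ← hn, pt_coord]
    refine ⟨cellPerm m n 0, ?_⟩
    rw [hx, bary_pt_add, bary_of_le (by simp) (by simp) (by simp)]
    simp
  obtain ⟨i, hi⟩ := hb
  have hi' : bary x (e.symm i) = 1 := by rw [← h, Equiv.apply_symm_apply, hi]
  obtain ⟨⟨h1, h2⟩, h3, h4⟩ := mem_rhombus_iff.1 hx
  generalize e.symm i = j at hi'
  rcases le_total (sCoord x) (rCoord x) with hle | hle
  · rw [bary_of_le h1.le hle h4.le] at hi'
    fin_cases j <;> simp at hi' <;> linarith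
  · rw [bary_of_ge h3.le hle h2.le] at hi'
    fin_cases j <;> simp at hi' <;> linarith

section Regular

variable {p : Fin 4 → Space} (hp : ∀ i j, i ≠ j → dist (p i) (p j) = 1)

include hp

/-- A chart reading of `f` is its lift composed with an isometry, and the images of the rhombus fill
exactly the complement of the vertices. -/
theorem contDiffOn_pull_iff (f : Surface p → ℝ) :
    (∀ e, ContDiffOn ℝ ∞ (pull p e f) rhombus) ↔
      ContDiffOn ℝ ∞ (fun x => f (cover p (toTorus x)))
        {x | cover p (toTorus x) ∉ vertexSet p} := by
  constructor
  · intro h x hx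
    rw [Set.mem_ofPred_eq, cover_mem_vertexSet_iff hp] at hx
    obtain ⟨e, A, hA, y, hy, rfl⟩ := exists_realizes_mem_rhombus hx
    have h1 : ContDiffAt ℝ ∞ (pull p e f) y := (h e).contDiffAt (isOpen_rhombus.mem_nhds hy)
    have h2 : ContDiffAt ℝ ∞ (pull p e f ∘ A.symm) (A y) :=
      ContDiffAt.comp _ (by simpa using h1) (contDiff_affineIsometryEquiv A.symm).contDiffAt
    refine (h2.congr_of_eventuallyEq ?_).contDiffWithinAt
    have hn : A.symm ⁻¹' rhombus ∈ 𝓝 (A y) :=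
      (isOpen_rhombus.preimage A.symm.continuous).mem_nhds (by simpa using hy)
    filter_upwards [hn] with z hz
    rw [Function.comp_apply, hA.pull_eq f hz, A.apply_symm_apply]
  · intro h e
    obtain ⟨A, hA⟩ := exists_realizes e
    refine ContDiffOn.congr (f := (fun x => f (cover p (toTorus x))) ∘ A)
      (h.comp (contDiff_affineIsometryEquiv A).contDiffOn fun x hx => ?_)
      fun x hx => hA.pull_eq f hx
    rw [Set.mem_ofPred_eq, cover_mem_vertexSet_iff hp]
    exact hA.not_mem_lattice hx

theorem exists_descent {w : HexTorus → ℝ} (hc : Continuous w) (hw : ∀ z, w (halfTurn z) = w z) :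
    ∃ v : C(Surface p, ℝ), ∀ z, v (cover p z) = w z := by
  have h : Function.FactorsThrough (⟨w, hc⟩ : C(HexTorus, ℝ)) (cover p) := fun z z' h => by
    rcases (cover_eq_iff hp z z').1 h with rfl | rfl
    · rfl
    · exact (hw z).symm
  exact ⟨(isQuotientMap_cover p).lift ⟨w, hc⟩ h, fun z =>
    DFunLike.congr_fun ((isQuotientMap_cover p).lift_comp ⟨w, hc⟩ h) z⟩

/-- The other two vertices are equidistant from `p i` and `p j`, hence on the mirror, while `p i`
and `p j` are the midpoint plus and minus a normal vector. -/
theorem reflection_vertex {i j : Fin 4} (hij : i ≠ j) (k : Fin 4) :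
    have : Nonempty (AffineSubspace.perpBisector (p i) (p j)) :=
      AffineSubspace.perpBisector_nonempty.to_subtype
    EuclideanGeometry.reflection (AffineSubspace.perpBisector (p i) (p j)) (p k) =
      p (Equiv.swap i j k) := by
  intro _
  have hm := AffineSubspace.midpoint_mem_perpBisector (p i) (p j)
  have hv : p j - midpoint ℝ (p i) (p j) ∈ (AffineSubspace.perpBisector (p i) (p j)).directionᗮ := by
    rw [AffineSubspace.direction_perpBisector, Submodule.orthogonal_orthogonal]
    refine Submodule.mem_span_singleton.2 ⟨1 / 2, ?_⟩
    simp only [midpoint_eq_smul_add, vsub_eq_sub, invOf_eq_inv]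
    module
  rcases eq_or_ne k i with rfl | hki
  · have h := EuclideanGeometry.reflection_orthogonal_vadd hm (Submodule.neg_mem _ hv)
    have h1 : -(p j - midpoint ℝ (p k) (p j)) +ᵥ midpoint ℝ (p k) (p j) = p k := by
      simp only [midpoint_eq_smul_add, vadd_eq_add, invOf_eq_inv]
      module
    rw [h1] at h
    rw [h, Equiv.swap_apply_left, neg_neg, vadd_eq_add, sub_add_cancel]
  · rcases eq_or_ne k j with rfl | hkj
    · have h := EuclideanGeometry.reflection_orthogonal_vadd hm hv
      have h1 : (p k - midpoint ℝ (p i) (p k)) +ᵥ midpoint ℝ (p i) (p k) = p k := by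
        rw [vadd_eq_add, sub_add_cancel]
      rw [h1] at h
      rw [h, Equiv.swap_apply_right]
      simp only [midpoint_eq_smul_add, vadd_eq_add, invOf_eq_inv]
      module
    · rw [Equiv.swap_apply_of_ne_of_ne hki hkj, EuclideanGeometry.reflection_eq_self_iff,
        AffineSubspace.mem_perpBisector_iff_dist_eq, hp k i hki, hp k j hkj]

/-- The reflection is affine, so its action on barycentric combinations is determined by the
vertices. -/
theorem reflection_fold {i j : Fin 4} (hij : i ≠ j) {A : Plane ≃ᵃⁱ[ℝ] Plane}
    (hA : Realizes (Equiv.swap i j) A) (x : Plane) :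
    have : Nonempty (AffineSubspace.perpBisector (p i) (p j)) :=
      AffineSubspace.perpBisector_nonempty.to_subtype
    EuclideanGeometry.reflection (AffineSubspace.perpBisector (p i) (p j)) (fold p x) =
      fold p (A x) := by
  intro _
  have h := Finset.univ.map_affineCombination p (bary x) (sum_bary x)
    (EuclideanGeometry.reflection (AffineSubspace.perpBisector (p i) (p j))).toAffineEquiv.toAffineMap
  rw [Finset.affineCombination_eq_linear_combination _ _ _ (sum_bary x),
    Finset.affineCombination_eq_linear_combination _ _ _ (sum_bary x)] at h
  rw [hA.fold_eq]
  refine h.trans (Finset.sum_congr rfl fun k _ => ?_)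
  congr 1
  exact reflection_vertex hp hij k

/-- The symmetry type of a function, read on the plane. -/
theorem mem_symmetryType_iff {ε : ℝ} {v : C(Surface p, ℝ)} :
    v ∈ symmetryType p ε ↔ ∀ i j, i ≠ j → ∀ A, Realizes (Equiv.swap i j) A → ∀ x,
      lift (cover p) v (A x) = ε * lift (cover p) v x := by
  constructor
  · intro h i j hij A hA x
    exact h i j hij (cover p (toTorus x)) (cover p (toTorus (A x)))
      (reflection_fold hp hij hA x).symm
  · intro h i j hij x y hxy
    obtain ⟨z, rfl⟩ := cover_surjective p x
    obtain ⟨z, rfl⟩ := toTorus_surjective z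
    obtain ⟨A, hA⟩ := exists_realizes (Equiv.swap i j)
    have hy : y = cover p (toTorus (A z)) :=
      Subtype.ext (hxy.trans (reflection_fold hp hij hA z))
    rw [hy]
    exact h i j hij A hA z

end Regular

theorem lift_apply {p : Fin 4 → Space} (π : C(HexTorus, Surface p)) (v : C(Surface p, ℝ))
    (x : Plane) : lift π v x = v (π (toTorus x)) := rfl

theorem lift_cover_injective (p : Fin 4 → Space) : Function.Injective (lift (cover p)) := by
  intro v w h
  ext y
  obtain ⟨z, rfl⟩ := cover_surjective p y
  obtain ⟨x, rfl⟩ := toTorus_surjective z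
  exact congrFun h x

theorem cover_congr {p : Fin 4 → Space} {x y : Plane} (h : bary x = bary y) :
    cover p (toTorus x) = cover p (toTorus y) :=
  Subtype.ext (by simp [fold, h])

/-! ### Weak divergence equations -/

/-- The weak form, on the open set `Ω`, of the equation `div G = H`. -/
def WeakDiv (Ω : Set Plane) (G : Plane → Plane) (H : Plane → ℝ) : Prop :=
  ∀ ψ, IsTest Ω ψ → ∫ x, (fderiv ℝ ψ x (G x) + H x * ψ x) = 0

/-- Square integrability on compact sets. -/
def SqLoc {E : Type*} [NormedAddCommGroup E] (G : Plane → E) : Prop :=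
  ∀ K : Set Plane, IsCompact K → MemLp G 2 (volume.restrict K)

theorem IsTest.mono {Ω Ω' : Set Plane} (h : Ω ⊆ Ω') {ψ : Plane → ℝ} (hψ : IsTest Ω ψ) :
    IsTest Ω' ψ := ⟨hψ.1, hψ.2.1, hψ.2.2.trans h⟩

theorem IsTest.self {Ω : Set Plane} {ψ : Plane → ℝ} (hψ : IsTest Ω ψ) :
    IsTest (tsupport ψ) ψ := ⟨hψ.1, hψ.2.1, subset_rfl⟩

theorem WeakDiv.mono {Ω Ω' : Set Plane} (h : Ω ⊆ Ω') {G : Plane → Plane} {H : Plane → ℝ}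
    (hw : WeakDiv Ω' G H) : WeakDiv Ω G H := fun ψ hψ => hw ψ (hψ.mono h)

theorem fderiv_eq_zero_of_notMem {Ω : Set Plane} {ψ : Plane → ℝ} (hψ : IsTest Ω ψ) {x : Plane}
    (hx : x ∉ Ω) : fderiv ℝ ψ x = 0 :=
  image_eq_zero_of_notMem_tsupport fun h => hx (hψ.2.2 (tsupport_fderiv_subset ℝ h))

theorem eq_zero_of_notMem {Ω : Set Plane} {ψ : Plane → ℝ} (hψ : IsTest Ω ψ) {x : Plane}
    (hx : x ∉ Ω) : ψ x = 0 :=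
  image_eq_zero_of_notMem_tsupport fun h => hx (hψ.2.2 h)

theorem inner_gradient_eq (ψ : Plane → ℝ) (x v : Plane) :
    inner ℝ v (gradient ψ x) = fderiv ℝ ψ x v := by
  rw [real_inner_comm, inner_gradient_left]

theorem integral_weak_eq {Ω : Set Plane} {ψ : Plane → ℝ} (hψ : IsTest Ω ψ)
    (G : Plane → Plane) (H : Plane → ℝ) :
    ∫ x in Ω, (fderiv ℝ ψ x (G x) + H x * ψ x) = ∫ x, (fderiv ℝ ψ x (G x) + H x * ψ x) :=
  setIntegral_eq_integral_of_forall_compl_eq_zero fun x hx => by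
    simp [fderiv_eq_zero_of_notMem hψ hx, eq_zero_of_notMem hψ hx]

theorem integrableOn_fderiv {Ω : Set Plane} {ψ : Plane → ℝ} (hψ : IsTest Ω ψ)
    {G : Plane → Plane} (hG : MemLp G 2 (volume.restrict Ω)) :
    IntegrableOn (fun x => fderiv ℝ ψ x (G x)) Ω := by
  simpa only [inner_gradient_eq, IntegrableOn] using integrable_inner_of_memLp hG hψ.gradient_memLp

theorem integrableOn_mul {Ω : Set Plane} {ψ : Plane → ℝ} (hψ : IsTest Ω ψ)
    {H : Plane → ℝ} (hH : MemLp H 2 (volume.restrict Ω)) :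
    IntegrableOn (fun x => H x * ψ x) Ω := hH.integrable_mul hψ.memLp

theorem integrable_weak {Ω : Set Plane} {ψ : Plane → ℝ} (hψ : IsTest Ω ψ)
    {G : Plane → Plane} {H : Plane → ℝ} (hG : MemLp G 2 (volume.restrict Ω))
    (hH : MemLp H 2 (volume.restrict Ω)) :
    Integrable (fun x => fderiv ℝ ψ x (G x) + H x * ψ x) := by
  refine (integrableOn_iff_integrable_of_support_subset fun x hx => ?_).1
    ((integrableOn_fderiv hψ hG).add (integrableOn_mul hψ hH))
  by_contra h
  exact hx (by simp [fderiv_eq_zero_of_notMem hψ h, eq_zero_of_notMem hψ h])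

theorem integrable_weak_of_sqLoc {Ω : Set Plane} {ψ : Plane → ℝ} (hψ : IsTest Ω ψ)
    {G : Plane → Plane} {H : Plane → ℝ} (hG : SqLoc G) (hH : SqLoc H) :
    Integrable (fun x => fderiv ℝ ψ x (G x) + H x * ψ x) :=
  integrable_weak hψ.self (hG _ hψ.2.1) (hH _ hψ.2.1)

theorem WeakDiv.congr {Ω : Set Plane} {G G' : Plane → Plane} {H H' : Plane → ℝ}
    (h : WeakDiv Ω G H) (hG : G =ᵐ[volume.restrict Ω] G') (hH : H =ᵐ[volume.restrict Ω] H') :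
    WeakDiv Ω G' H' := by
  intro ψ hψ
  rw [← h ψ hψ, ← integral_weak_eq hψ, ← integral_weak_eq hψ]
  refine integral_congr_ae ?_
  filter_upwards [hG, hH] with x h1 h2
  rw [h1, h2]

/-- The right hand side of a weak divergence equation is unique. -/
theorem WeakDiv.ae_eq {Ω : Set Plane} (ho : IsOpen Ω) {G : Plane → Plane} {H H' : Plane → ℝ}
    (h : WeakDiv Ω G H) (h' : WeakDiv Ω G H') (hG : MemLp G 2 (volume.restrict Ω))
    (hH : MemLp H 2 (volume.restrict Ω)) (hH' : MemLp H' 2 (volume.restrict Ω)) :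
    H =ᵐ[volume.restrict Ω] H' := by
  have key : ∀ᵐ x ∂volume, x ∈ Ω → H x - H' x = 0 := by
    refine ho.ae_eq_zero_of_integral_contDiff_smul_eq_zero
      (locallyIntegrableOn_of_locallyIntegrable_restrict
        ((hH.sub hH').locallyIntegrable (by norm_num))) fun ψ h1 h2 h3 => ?_
    have hψ : IsTest Ω ψ := ⟨h1, h2, h3⟩
    have e := integral_sub (integrable_weak hψ hG hH) (integrable_weak hψ hG hH')
    rw [h ψ hψ, h' ψ hψ, sub_zero] at e
    rw [← e]
    refine integral_congr_ae (Filter.Eventually.of_forall fun x => ?_)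
    simp only [smul_eq_mul]
    ring
  rw [Filter.EventuallyEq, ae_restrict_iff' ho.measurableSet]
  filter_upwards [key] with x hx hx'
  exact sub_eq_zero.1 (hx hx')

/-! ### Transport by isometries -/

theorem affineIsometryEquiv_apply (A : Plane ≃ᵃⁱ[ℝ] Plane) (x : Plane) :
    A x = A.linearIsometryEquiv x + A 0 := by
  have := A.map_vadd 0 x
  simpa using this

theorem measurePreserving_affineIsometryEquiv (A : Plane ≃ᵃⁱ[ℝ] Plane) :
    MeasurePreserving A volume volume := by
  have h : (A : Plane → Plane) = (fun x => x + A 0) ∘ A.linearIsometryEquiv := by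
    funext x
    exact affineIsometryEquiv_apply A x
  rw [h]
  exact (measurePreserving_add_right volume (A 0)).comp A.linearIsometryEquiv.measurePreserving

theorem measurableEmbedding_affineIsometryEquiv (A : Plane ≃ᵃⁱ[ℝ] Plane) :
    MeasurableEmbedding A := A.toHomeomorph.measurableEmbedding

theorem fderiv_comp_affineIsometryEquiv {ψ : Plane → ℝ} (hψ : Differentiable ℝ ψ)
    (A : Plane ≃ᵃⁱ[ℝ] Plane) (x v : Plane) :
    fderiv ℝ (ψ ∘ A) x v = fderiv ℝ ψ (A x) (A.linearIsometryEquiv v) := by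
  have h1 : HasFDerivAt A (A.linearIsometryEquiv.toContinuousLinearEquiv : Plane →L[ℝ] Plane) x := by
    have h2 : (A : Plane → Plane) = fun x => A.linearIsometryEquiv x + A 0 :=
      funext (affineIsometryEquiv_apply A)
    rw [h2]
    exact (A.linearIsometryEquiv.toContinuousLinearEquiv : Plane →L[ℝ] Plane).hasFDerivAt.add_const _
  rw [((hψ (A x)).hasFDerivAt.comp x h1).fderiv]
  rfl

theorem tsupport_comp_affineIsometryEquiv (ψ : Plane → ℝ) (A : Plane ≃ᵃⁱ[ℝ] Plane) :
    tsupport (ψ ∘ A) = A ⁻¹' tsupport ψ := by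
  unfold tsupport
  rw [Function.support_comp_eq_preimage]
  exact (A.toHomeomorph.preimage_closure _).symm

theorem IsTest.comp {Ω : Set Plane} {ψ : Plane → ℝ} (hψ : IsTest Ω ψ) (A : Plane ≃ᵃⁱ[ℝ] Plane) :
    IsTest (A ⁻¹' Ω) (ψ ∘ A) := by
  refine ⟨hψ.1.comp (contDiff_affineIsometryEquiv A), ?_, ?_⟩
  · rw [HasCompactSupport, tsupport_comp_affineIsometryEquiv]
    exact A.toHomeomorph.isCompact_preimage.2 hψ.2.1
  · rw [tsupport_comp_affineIsometryEquiv]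
    exact Set.preimage_mono hψ.2.2

/-- Isometries preserve Lebesgue measure, and the chain rule moves the linear part of `A` from the
derivative of the test function to the field. -/
theorem WeakDiv.transport {Ω : Set Plane} {G : Plane → Plane} {H : Plane → ℝ}
    (A : Plane ≃ᵃⁱ[ℝ] Plane) (h : WeakDiv (A ⁻¹' Ω) G H) :
    WeakDiv Ω (fun x => A.linearIsometryEquiv (G (A.symm x))) (fun x => H (A.symm x)) := by
  intro ψ hψ
  rw [← h _ (hψ.comp A), ← (measurePreserving_affineIsometryEquiv A).integral_comp
    (measurableEmbedding_affineIsometryEquiv A)]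
  refine integral_congr_ae (Filter.Eventually.of_forall fun x => ?_)
  simp [fderiv_comp_affineIsometryEquiv (hψ.1.differentiable (by simp))]

/-! ### Gluing -/

/-- A test function is split by a smooth partition of unity, finite because its support is compact.
The equation is linear in the test function. -/
theorem WeakDiv.glue {ι : Type*} {Ω : ι → Set Plane} (ho : ∀ i, IsOpen (Ω i)) {G : Plane → Plane}
    {H : Plane → ℝ} (hG : SqLoc G) (hH : SqLoc H) (h : ∀ i, WeakDiv (Ω i) G H) :
    WeakDiv (⋃ i, Ω i) G H := by
  intro ψ hψ
  obtain ⟨t, ht⟩ := IsCompact.elim_finite_subcover hψ.2.1 Ω ho hψ.2.2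
  obtain ⟨ρ, hρ⟩ := SmoothPartitionOfUnity.exists_isSubordinate (modelWithCornersSelf ℝ Plane)
    (isClosed_tsupport ψ) (fun i : t => Ω i) (fun i => ho i) (by simpa [Set.iUnion_subtype] using ht)
  have htest : ∀ i : t, IsTest (Ω i) (fun x => ρ i x * ψ x) := fun i =>
    ⟨(ρ i).contMDiff.contDiff.mul hψ.1, hψ.2.1.mul_left,
      (tsupport_mul_subset_left).trans (hρ i)⟩
  have hsum : ψ = fun x => ∑ i : t, ρ i x * ψ x := by
    funext x
    rw [← Finset.sum_mul]
    by_cases hx : x ∈ tsupport ψ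
    · have := ρ.sum_eq_one hx
      rw [finsum_eq_sum_of_fintype] at this
      rw [this, one_mul]
    · rw [image_eq_zero_of_notMem_tsupport hx, mul_zero]
  have hint : ∀ x, fderiv ℝ ψ x (G x) + H x * ψ x =
      ∑ i : t, (fderiv ℝ (fun x => ρ i x * ψ x) x (G x) + H x * (ρ i x * ψ x)) := by
    intro x
    have hd : fderiv ℝ ψ x = ∑ i : t, fderiv ℝ (fun x => ρ i x * ψ x) x := by
      conv_lhs => rw [hsum]
      exact fderiv_fun_sum fun i _ => ((htest i).1.differentiable (by simp)) x
    have hv : ψ x = ∑ i : t, ρ i x * ψ x := congrFun hsum x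
    rw [Finset.sum_add_distrib, ← Finset.mul_sum, ← hv, hd, _root_.sum_apply]
  simp only [hint]
  rw [integral_finsetSum _ fun i _ => integrable_weak_of_sqLoc (htest i) hG hH]
  exact Finset.sum_eq_zero fun i _ => h i _ (htest i)

/-! ### Points are removable -/

/-- A family of cutoff functions that are `1` near a point and supported in small balls. -/
theorem exists_cutoff (m : Plane) : ∃ C : ℝ, 0 ≤ C ∧ ∀ ε : ℝ, 0 < ε → ∃ β : Plane → ℝ,
    ContDiff ℝ ∞ β ∧ (∀ x, |β x| ≤ 1) ∧ (∀ x, ‖fderiv ℝ β x‖ ≤ C / ε) ∧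
      (∀ x, dist x m < ε → β x = 1) ∧ tsupport β ⊆ Metric.closedBall m (2 * ε) := by
  let b : ContDiffBump (0 : Plane) := ⟨1, 2, one_pos, one_lt_two⟩
  have hb : ContDiff ℝ ∞ b := b.contDiff
  obtain ⟨C, hC⟩ := (b.hasCompactSupport.fderiv (𝕜 := ℝ)).exists_bound_of_continuous
    (hb.continuous_fderiv (by simp))
  refine ⟨C, (norm_nonneg _).trans (hC 0), fun ε hε => ⟨fun x => b (ε⁻¹ • (x - m)), ?_, ?_, ?_, ?_,
    ?_⟩⟩
  · exact hb.comp ((contDiff_id.sub contDiff_const).const_smul _)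
  · intro x
    rw [abs_of_nonneg b.nonneg]
    exact b.le_one
  · intro x
    have h1 : HasFDerivAt (fun x : Plane => ε⁻¹ • (x - m)) (ε⁻¹ • ContinuousLinearMap.id ℝ Plane) x :=
      ((hasFDerivAt_id x).sub_const m).const_smul ε⁻¹
    have h2 := ((hb.differentiable (by simp) (ε⁻¹ • (x - m))).hasFDerivAt.comp x h1).fderiv
    rw [Function.comp_def] at h2
    rw [h2, ContinuousLinearMap.comp_smul, ContinuousLinearMap.comp_id, norm_smul, norm_inv,
      Real.norm_of_nonneg hε.le, div_eq_inv_mul]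
    exact mul_le_mul_of_nonneg_left (hC _) (by positivity)
  · intro x hx
    refine b.one_of_mem_closedBall ?_
    rw [mem_closedBall_zero_iff, norm_smul, norm_inv, Real.norm_of_nonneg hε.le, ← dist_eq_norm,
      inv_mul_le_iff₀ hε]
    change dist x m ≤ ε * 1
    linarith
  · refine closure_minimal (fun x hx => ?_) Metric.isClosed_closedBall
    have h : ε⁻¹ • (x - m) ∈ Metric.ball (0 : Plane) b.rOut := by
      rw [← b.support_eq]
      exact hx
    rw [mem_ball_zero_iff, norm_smul, norm_inv, Real.norm_of_nonneg hε.le, ← dist_eq_norm,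
      inv_mul_lt_iff₀ hε] at h
    rw [Metric.mem_closedBall]
    have : b.rOut = 2 := rfl
    rw [this] at h
    linarith

theorem volume_closedBall_le (m : Plane) {ε : ℝ} (hε : 0 ≤ ε) :
    (volume : Measure Plane).real (Metric.closedBall m (2 * ε)) =
      ε ^ 2 * (volume : Measure Plane).real (Metric.closedBall 0 2) := by
  rw [mul_comm, Measure.real, Measure.addHaar_closedBall_mul volume m hε zero_le_two,
    ENNReal.toReal_mul, ENNReal.toReal_ofReal (by positivity), Measure.real]
  simp

theorem SqLoc.integrableOn_sq {E : Type*} [NormedAddCommGroup E] {G : Plane → E} (hG : SqLoc G)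
    {K : Set Plane} (hK : IsCompact K) : IntegrableOn (fun x => ‖G x‖ ^ 2) K :=
  (hG K hK).integrable_norm_pow two_ne_zero

/-- Absolute continuity of the integral: the area of the balls tends to zero. -/
theorem tendsto_integral_closedBall (m : Plane) {Q : Plane → ℝ}
    (hQ : IntegrableOn Q (Metric.closedBall m 2)) :
    Filter.Tendsto (fun ε => ∫ x in Metric.closedBall m (2 * ε), Q x) (𝓝[>] (0 : ℝ)) (𝓝 0) := by
  have h1 : Filter.Tendsto (fun ε : ℝ => ∫ x in Metric.closedBall m (2 * ε), Q x
      ∂(volume.restrict (Metric.closedBall m 2))) (𝓝[>] (0 : ℝ)) (𝓝 0) := by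
    refine hQ.tendsto_setIntegral_nhds_zero ?_
    have h2 : Filter.Tendsto (fun ε : ℝ => ENNReal.ofReal
        (ε ^ 2 * (volume : Measure Plane).real (Metric.closedBall 0 2))) (𝓝[>] (0 : ℝ)) (𝓝 0) := by
      have h3 : Continuous fun ε : ℝ => ENNReal.ofReal
          (ε ^ 2 * (volume : Measure Plane).real (Metric.closedBall 0 2)) :=
        ENNReal.continuous_ofReal.comp (by fun_prop)
      have h4 := h3.tendsto 0
      simp only [ne_eq, OfNat.ofNat_ne_zero, not_false_eq_true, zero_pow, zero_mul,
        ENNReal.ofReal_zero] at h4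
      exact h4.mono_left nhdsWithin_le_nhds
    refine tendsto_of_tendsto_of_tendsto_of_le_of_le' tendsto_const_nhds h2
      (Filter.Eventually.of_forall fun _ => zero_le) ?_
    filter_upwards [self_mem_nhdsWithin] with ε hε
    rw [← volume_closedBall_le m (le_of_lt hε), Measure.real, ENNReal.ofReal_toReal
      (isCompact_closedBall m _).measure_lt_top.ne]
    exact Measure.restrict_apply_le _ _
  refine h1.congr' ?_
  filter_upwards [Ioo_mem_nhdsGT (show (0 : ℝ) < 1 by norm_num)] with ε hε
  rw [Measure.restrict_restrict Metric.isClosed_closedBall.measurableSet,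
    Set.inter_eq_left.2 (Metric.closedBall_subset_closedBall (by linarith [hε.2]))]

/-- Young's inequality with a free parameter `δ`. It replaces the Cauchy–Schwarz inequality in the
removability argument. -/
theorem young_bound {a b c D ε δ : ℝ} (hD : 0 ≤ D)
    (hδ : 0 < δ) (h : c ≤ D / ε * (a + b)) :
    c ≤ D * ((a ^ 2 + b ^ 2) / δ + δ / ε ^ 2) := by
  refine h.trans ?_
  rw [div_mul_eq_mul_div, mul_div_assoc]
  refine mul_le_mul_of_nonneg_left ?_ hD
  have h1 : (a + b) / ε = (a + b) * (1 / ε) := by ring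
  have h2 : δ / ε ^ 2 = δ * (1 / ε) ^ 2 := by rw [one_div, inv_pow]; ring
  rw [h1, h2]
  generalize 1 / ε = y
  rw [div_add' _ _ _ hδ.ne', le_div_iff₀ hδ]
  nlinarith [sq_nonneg (a - δ * y / 2), sq_nonneg (b - δ * y / 2), sq_nonneg (δ * y)]

/-- With `β` a cutoff at scale `ε`, only `β ψ` can contribute to the defect `W`. Its gradient is
`O(1/ε)` on a ball of area `O(ε²)`, hence bounded in `L²`, while the `L²` norms of `G` and `H` on
that ball tend to zero. Dimension two is exactly what makes the powers of `ε` cancel. -/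
theorem WeakDiv.of_punctured {Ω : Set Plane} (m : Plane) {G : Plane → Plane} {H : Plane → ℝ}
    (hG : SqLoc G) (hH : SqLoc H) (h : WeakDiv (Ω \ {m}) G H) : WeakDiv Ω G H := by
  intro ψ hψ
  obtain ⟨C, hC, hcut⟩ := exists_cutoff m
  obtain ⟨C₀, hC₀⟩ := hψ.2.1.exists_bound_of_continuous hψ.1.continuous
  obtain ⟨C₁, hC₁⟩ := (hψ.2.1.fderiv (𝕜 := ℝ)).exists_bound_of_continuous
    (hψ.1.continuous_fderiv (by simp))
  have hC₀' : 0 ≤ C₀ := (norm_nonneg _).trans (hC₀ 0)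
  have hC₁' : 0 ≤ C₁ := (norm_nonneg _).trans (hC₁ 0)
  set D : ℝ := C₁ + C₀ * C + C₀ with hD
  have hD' : 0 ≤ D := by positivity
  set V : ℝ := (volume : Measure Plane).real (Metric.closedBall 0 2) with hV
  have hV' : 0 ≤ V := measureReal_nonneg
  set Q : Plane → ℝ := fun x => ‖G x‖ ^ 2 + ‖H x‖ ^ 2 with hQdef
  have hQ : ∀ K, IsCompact K → IntegrableOn Q K := fun K hK =>
    (hG.integrableOn_sq hK).add (hH.integrableOn_sq hK)
  set W : ℝ := ∫ x, (fderiv ℝ ψ x (G x) + H x * ψ x) with hW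
  -- cutting off inside a small ball
  have key : ∀ ε : ℝ, 0 < ε → ε ≤ 1 → ∀ δ : ℝ, 0 < δ →
      |W| ≤ D * ((∫ x in Metric.closedBall m (2 * ε), Q x) / δ + δ * V) := by
    intro ε hε hε1 δ hδ
    obtain ⟨β, hβ, hβ1, hβ2, hβ3, hβ4⟩ := hcut ε hε
    have hβd : Differentiable ℝ β := hβ.differentiable (by simp)
    have hψd : Differentiable ℝ ψ := hψ.1.differentiable (by simp)
    set B := Metric.closedBall m (2 * ε) with hB
    have t1 : IsTest (Ω \ {m}) (fun x => (1 - β x) * ψ x) := by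
      refine ⟨(contDiff_const.sub hβ).mul hψ.1, hψ.2.1.mul_left, fun x hx => ⟨?_, ?_⟩⟩
      · exact hψ.2.2 (tsupport_mul_subset_right hx)
      · rintro rfl
        refine (notMem_tsupport_iff_eventuallyEq.2 ?_) hx
        filter_upwards [Metric.ball_mem_nhds x hε] with y hy
        rw [hβ3 y hy]
        simp
    have t2 : IsTest Ω (fun x => β x * ψ x) :=
      ⟨hβ.mul hψ.1, hψ.2.1.mul_left, tsupport_mul_subset_right.trans hψ.2.2⟩
    have t3 : IsTest B (fun x => β x * ψ x) :=
      ⟨t2.1, t2.2.1, tsupport_mul_subset_left.trans hβ4⟩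
    -- The part `(1 - β) ψ` vanishes near `m`, so it is an admissible test function and contributes
    -- nothing.
    have e1 : W = ∫ x in B, (fderiv ℝ (fun x => β x * ψ x) x (G x) + H x * (β x * ψ x)) := by
      rw [integral_weak_eq t3, ← zero_add (∫ x, _), ← h _ t1, ← integral_add
        (integrable_weak_of_sqLoc t1 hG hH) (integrable_weak_of_sqLoc t2 hG hH), hW]
      refine integral_congr_ae (Filter.Eventually.of_forall fun x => ?_)
      have e2 : fderiv ℝ ψ x = fderiv ℝ (fun x => (1 - β x) * ψ x) x +
          fderiv ℝ (fun x => β x * ψ x) x := by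
        rw [← fderiv_fun_add (t1.1.differentiable (by simp) x) (t2.1.differentiable (by simp) x)]
        congr 1
        funext y
        ring
      simp only [e2, _root_.add_apply]
      ring
    have e3 : ∀ x, ‖fderiv ℝ (fun x => β x * ψ x) x (G x) + H x * (β x * ψ x)‖ ≤
        D * (Q x / δ + δ / ε ^ 2) := by
      intro x
      have k1 : ‖fderiv ℝ (fun x => β x * ψ x) x‖ ≤ (C₁ + C₀ * C) / ε := by
        rw [fderiv_fun_mul (hβd x) (hψd x)]
        refine (norm_add_le _ _).trans ?_
        rw [norm_smul, norm_smul]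
        have k2 : ‖β x‖ * ‖fderiv ℝ ψ x‖ ≤ 1 * C₁ :=
          mul_le_mul (hβ1 x) (hC₁ x) (norm_nonneg _) zero_le_one
        have k3 : ‖ψ x‖ * ‖fderiv ℝ β x‖ ≤ C₀ * (C / ε) :=
          mul_le_mul (hC₀ x) (hβ2 x) (norm_nonneg _) hC₀'
        have k4 : C₁ ≤ C₁ / ε := by rw [le_div_iff₀ hε]; nlinarith
        rw [add_div, mul_div_assoc]
        linarith
      have k5 : ‖H x * (β x * ψ x)‖ ≤ C₀ / ε * ‖H x‖ := by
        rw [norm_mul, norm_mul, mul_comm]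
        refine mul_le_mul_of_nonneg_right ?_ (norm_nonneg _)
        have k2 : ‖β x‖ * ‖ψ x‖ ≤ 1 * C₀ := mul_le_mul (hβ1 x) (hC₀ x) (norm_nonneg _) zero_le_one
        have k4 : C₀ ≤ C₀ / ε := by rw [le_div_iff₀ hε]; nlinarith
        linarith
      have k6 := ContinuousLinearMap.le_of_opNorm_le _ k1 (G x)
      refine young_bound hD' hδ
        ((norm_add_le _ _).trans ((add_le_add k6 k5).trans ?_))
      have k7 : 0 ≤ C₀ / ε * ‖G x‖ := by positivity
      have k8 : 0 ≤ (C₁ + C₀ * C) / ε * ‖H x‖ := by positivity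
      have k9 : D / ε = (C₁ + C₀ * C) / ε + C₀ / ε := by rw [hD, add_div]
      rw [k9]
      nlinarith
    have e4 : IntegrableOn (fun x => D * (Q x / δ + δ / ε ^ 2)) B :=
      (((hQ _ (isCompact_closedBall m _)).div_const δ).add
        (integrableOn_const (isCompact_closedBall m _).measure_lt_top.ne)).const_mul D
    rw [e1, ← Real.norm_eq_abs]
    refine (norm_integral_le_of_norm_le e4 (Filter.Eventually.of_forall e3)).trans (le_of_eq ?_)
    rw [integral_const_mul, integral_add ((hQ _ (isCompact_closedBall m _)).div_const δ)
      (integrableOn_const (isCompact_closedBall m _).measure_lt_top.ne), integral_div,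
      setIntegral_const, hB, volume_closedBall_le m hε.le, smul_eq_mul]
    have := hε.ne'
    congr 2
    field_simp
    rfl
  -- The order of limits matters: `ε → 0` with `δ` fixed, and only then `δ → 0`.
  have key2 : ∀ δ : ℝ, 0 < δ → |W| ≤ D * (δ * V) := by
    intro δ hδ
    have h1 := tendsto_integral_closedBall m (hQ _ (isCompact_closedBall m 2))
    have h2 : Filter.Tendsto (fun ε : ℝ =>
        D * ((∫ x in Metric.closedBall m (2 * ε), Q x) / δ + δ * V)) (𝓝[>] (0 : ℝ))
        (𝓝 (D * (0 / δ + δ * V))) := ((h1.div_const δ).add_const _).const_mul D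
    rw [zero_div, zero_add] at h2
    refine ge_of_tendsto h2 ?_
    filter_upwards [Ioo_mem_nhdsGT (show (0 : ℝ) < 1 by norm_num)] with ε hε
    exact key ε hε.1 hε.2.le δ hδ
  have h3 : Filter.Tendsto (fun δ : ℝ => D * (δ * V)) (𝓝[>] (0 : ℝ)) (𝓝 (D * (0 * V))) :=
    (((continuous_id.mul continuous_const).const_mul D).tendsto 0).mono_left nhdsWithin_le_nhds
  rw [zero_mul, mul_zero] at h3
  have h4 : |W| ≤ 0 := by
    refine ge_of_tendsto h3 ?_
    filter_upwards [self_mem_nhdsWithin] with δ hδ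
    exact key2 δ hδ
  exact abs_eq_zero.1 (le_antisymm h4 (abs_nonneg _))

theorem WeakDiv.of_finite_punctured {Ω : Set Plane} {F : Set Plane} (hF : F.Finite)
    {G : Plane → Plane} {H : Plane → ℝ} (hG : SqLoc G) (hH : SqLoc H)
    (h : WeakDiv (Ω \ F) G H) : WeakDiv Ω G H := by
  induction F, hF using Set.Finite.induction_on with
  | empty => simpa using h
  | @insert m F _ _ ih =>
    refine ih (WeakDiv.of_punctured m hG hH ?_)
    rwa [Set.sdiff_sdiff, Set.union_singleton]

/-! ### Cells -/

/-- The translate of the open rhombus by a vertex of the lattice. -/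
def cell (m n : ℤ) : Set Plane :=
  (AffineIsometryEquiv.constVAdd ℝ Plane (pt m n)).symm ⁻¹' rhombus

theorem mem_cell_iff {m n : ℤ} {x : Plane} :
    x ∈ cell m n ↔ (m < sCoord x ∧ sCoord x < m + 1) ∧ n < rCoord x ∧ rCoord x < n + 1 := by
  have h : (AffineIsometryEquiv.constVAdd ℝ Plane (pt m n)).symm x = -pt m n + x := rfl
  rw [cell, Set.mem_preimage, h, mem_rhombus_iff]
  simp only [map_add, map_neg, sCoord_pt, rCoord_pt]
  constructor <;> rintro ⟨⟨h1, h2⟩, h3, h4⟩ <;>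
    exact ⟨⟨by linarith, by linarith⟩, by linarith, by linarith⟩

theorem floor_of_mem_cell {m n : ℤ} {x : Plane} (h : x ∈ cell m n) :
    ⌊sCoord x⌋ = m ∧ ⌊rCoord x⌋ = n := by
  obtain ⟨⟨h1, h2⟩, h3, h4⟩ := mem_cell_iff.1 h
  exact ⟨Int.floor_eq_iff.2 ⟨h1.le, h2⟩, Int.floor_eq_iff.2 ⟨h3.le, h4⟩⟩

theorem volume_level_eq_zero {f : Plane →L[ℝ] ℝ} {v : Plane} (hv : f v = 1) (c : ℝ) :
    (volume : Measure Plane) {x | f x = c} = 0 := by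
  have h : {x | f x = c} = (fun x => x + (-(c • v))) ⁻¹' (LinearMap.ker (f : Plane →ₗ[ℝ] ℝ)) := by
    ext x
    simp [hv, add_neg_eq_zero]
  rw [h, measure_preimage_add_right]
  refine Measure.addHaar_submodule _ _ fun htop => ?_
  have : v ∈ LinearMap.ker (f : Plane →ₗ[ℝ] ℝ) := by rw [htop]; trivial
  rw [LinearMap.mem_ker] at this
  exact one_ne_zero (hv.symm.trans this)

theorem ae_mem_cell : ∀ᵐ x : Plane, x ∈ cell ⌊sCoord x⌋ ⌊rCoord x⌋ := by
  have h1 : ∀ᵐ x : Plane, ∀ m : ℤ, sCoord x ≠ m :=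
    ae_all_iff.2 fun m => by
      simpa [ae_iff] using volume_level_eq_zero (f := sCoord) (v := pt 1 1) (by simp) m
  have h2 : ∀ᵐ x : Plane, ∀ m : ℤ, rCoord x ≠ m :=
    ae_all_iff.2 fun m => by
      simpa [ae_iff] using volume_level_eq_zero (f := rCoord) (v := pt 1 1) (by simp) m
  filter_upwards [h1, h2] with x k1 k2
  exact mem_cell_iff.2 ⟨⟨lt_of_le_of_ne (Int.floor_le _) (k1 _).symm, Int.lt_floor_add_one _⟩,
    lt_of_le_of_ne (Int.floor_le _) (k2 _).symm, Int.lt_floor_add_one _⟩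

theorem memLp_comp_iff {E : Type*} [NormedAddCommGroup E] (A : Plane ≃ᵃⁱ[ℝ] Plane) {F : Plane → E}
    {Ω : Set Plane} : MemLp (F ∘ A) 2 (volume.restrict (A ⁻¹' Ω)) ↔
      MemLp F 2 (volume.restrict Ω) := by
  rw [← (measurableEmbedding_affineIsometryEquiv A).memLp_map_measure_iff,
    ((measurePreserving_affineIsometryEquiv A).restrict_preimage_emb
      (measurableEmbedding_affineIsometryEquiv A) Ω).map_eq]

/-- A compact set is covered, up to a null set of edges, by finitely many open cells. -/
theorem sqLoc_of_cells {E : Type*} [NormedAddCommGroup E] {F : Plane → E}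
    (h : ∀ m n : ℤ, MemLp F 2 (volume.restrict (cell m n))) : SqLoc F := by
  intro K hK
  obtain ⟨a, ha⟩ := (hK.image sCoord.continuous).isBounded.exists_norm_le
  obtain ⟨b, hb⟩ := (hK.image rCoord.continuous).isBounded.exists_norm_le
  set S : Finset (ℤ × ℤ) := Finset.Icc ⌊-a⌋ ⌊a⌋ ×ˢ Finset.Icc ⌊-b⌋ ⌊b⌋ with hS
  have hsub : K ≤ᵐ[volume] ⋃ q ∈ S, cell q.1 q.2 := by
    filter_upwards [ae_mem_cell] with x hx hxK
    have h1 := abs_le.1 (ha _ ⟨x, hxK, rfl⟩)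
    have h2 := abs_le.1 (hb _ ⟨x, hxK, rfl⟩)
    refine Set.mem_iUnion₂.2 ⟨(⌊sCoord x⌋, ⌊rCoord x⌋), ?_, hx⟩
    simp only [hS, Finset.mem_product, Finset.mem_Icc]
    exact ⟨⟨Int.floor_mono h1.1, Int.floor_mono h1.2⟩, Int.floor_mono h2.1, Int.floor_mono h2.2⟩
  have hU : MemLp F 2 (volume.restrict (⋃ q ∈ S, cell q.1 q.2)) := by
    have hm : AEStronglyMeasurable F (volume.restrict (⋃ q ∈ S, cell q.1 q.2)) :=
      (aestronglyMeasurable_iUnion_iff.2 fun q : ℤ × ℤ => (h q.1 q.2).1).mono_measure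
        (Measure.restrict_mono (Set.iUnion₂_subset fun q _ => Set.subset_iUnion
          (fun q : ℤ × ℤ => cell q.1 q.2) q) le_rfl)
    rw [memLp_two_iff_integrable_sq_norm hm]
    exact integrableOn_finset_iUnion.2 fun q _ => (h q.1 q.2).integrable_norm_pow two_ne_zero
  exact hU.mono_measure (Measure.restrict_mono_ae hsub)

theorem cellPerm_add_two_mul (a b m n : ℤ) : cellPerm (a + 2 * m) (b + 2 * n) = cellPerm a b := by
  simp [cellPerm, Int.even_add]

/-! ### The equations of a solution -/

/-- Pairing the vector identity with constant vectors `v` puts the weak gradient into the same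
divergence form as the eigenvalue equation, so both can be transported, glued and extended by the
same lemmas. -/
theorem hasWeakGradient_iff {Ω : Set Plane} {f : Plane → ℝ} {g : Plane → Plane}
    (hf : MemLp f 2 (volume.restrict Ω)) (hg : MemLp g 2 (volume.restrict Ω)) :
    HasWeakGradient Ω f g ↔ ∀ v, WeakDiv Ω (fun x => f x • v) (fun x => inner ℝ v (g x)) := by
  have key : ∀ φ, IsTest Ω φ → ∀ v,
      ∫ x, (fderiv ℝ φ x (f x • v) + inner ℝ v (g x) * φ x) =
        inner ℝ v ((∫ x in Ω, f x • gradient φ x) + ∫ x in Ω, φ x • g x) := by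
    intro φ hφ v
    have i1 := integrable_smul_of_memLp hf hφ.gradient_memLp
    have i2 := integrable_smul_of_memLp hφ.memLp hg
    have i3 := integral_inner (𝕜 := ℝ) (i1.add i2) v
    simp only [Pi.add_apply] at i3
    rw [← integral_add i1 i2, ← i3, ← integral_weak_eq hφ]
    refine integral_congr_ae (Filter.Eventually.of_forall fun x => ?_)
    simp only [inner_add_right, inner_smul_right, inner_gradient_eq, map_smul,
      smul_eq_mul]
    ring
  constructor
  · intro h v φ hφ
    rw [key φ hφ, h φ hφ, neg_add_cancel, inner_zero_right]
  · intro h φ hφ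
    rw [eq_neg_iff_add_eq_zero]
    exact ext_inner_left ℝ fun v => by rw [← key φ hφ, h v φ hφ, inner_zero_right]

theorem weak_equation_iff {Ω : Set Plane} {f : Plane → ℝ} {g : Plane → Plane} {lam : ℝ}
    (hf : MemLp f 2 (volume.restrict Ω)) (hg : MemLp g 2 (volume.restrict Ω)) :
    (∀ φ, IsTest Ω φ → ∫ x in Ω, inner ℝ (g x) (gradient φ x) = lam * ∫ x in Ω, f x * φ x) ↔
      WeakDiv Ω g (fun x => -(lam * f x)) := by
  refine forall₂_congr fun φ hφ => ?_
  have i1 := integrable_inner_of_memLp hg hφ.gradient_memLp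
  have i2 : Integrable (fun x => f x * φ x) (volume.restrict Ω) := hf.integrable_mul hφ.memLp
  rw [← integral_const_mul, ← sub_eq_zero, ← integral_sub i1 (i2.const_mul lam),
    ← integral_weak_eq hφ]
  refine Eq.congr_left (integral_congr_ae (Filter.Eventually.of_forall fun x => ?_))
  simp only [inner_gradient_eq]
  ring

theorem isLaplaceSolution_iff {p : Fin 4 → Space} {lam : ℝ} {u : Surface p → ℝ} :
    IsLaplaceSolution p lam u ↔ ∀ e, ∃ g : Plane → Plane,
      MemLp (pull p e u) 2 (volume.restrict rhombus) ∧ MemLp g 2 (volume.restrict rhombus) ∧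
      (∀ v, WeakDiv rhombus (fun x => pull p e u x • v) (fun x => inner ℝ v (g x))) ∧
      WeakDiv rhombus g (fun x => -(lam * pull p e u x)) := by
  refine forall_congr' fun e => exists_congr fun g => and_congr_right fun h1 =>
    and_congr_right fun h2 => ?_
  rw [hasWeakGradient_iff h1 h2, weak_equation_iff h1 h2]

/-- The lift to the plane of an arbitrary function on the surface. -/
def liftFun {p : Fin 4 → Space} (u : Surface p → ℝ) (x : Plane) : ℝ := u (cover p (toTorus x))

theorem liftFun_add_lattice {p : Fin 4 → Space} (u : Surface p → ℝ) {l : Plane}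
    (hl : l ∈ hexLattice) (x : Plane) : liftFun u (x + l) = liftFun u x := by
  rw [liftFun, cover_congr (bary_add_lattice hl), liftFun]

theorem liftFun_neg {p : Fin 4 → Space} (u : Surface p → ℝ) (x : Plane) :
    liftFun u (-x) = liftFun u x := by
  rw [liftFun, cover_congr (bary_neg x), liftFun]

/-- The image of the open rhombus under an isometry. -/
def tile (A : Plane ≃ᵃⁱ[ℝ] Plane) : Set Plane := A.symm ⁻¹' rhombus

theorem isOpen_tile (A : Plane ≃ᵃⁱ[ℝ] Plane) : IsOpen (tile A) :=
  isOpen_rhombus.preimage A.symm.continuous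

theorem preimage_tile (A : Plane ≃ᵃⁱ[ℝ] Plane) : A ⁻¹' tile A = rhombus := by
  ext x
  simp [tile]

theorem Realizes.pull_symm_eq {e : Equiv.Perm (Fin 4)} {A : Plane ≃ᵃⁱ[ℝ] Plane}
    (h : Realizes e A) {p : Fin 4 → Space} (u : Surface p → ℝ) {x : Plane} (hx : x ∈ tile A) :
    pull p e u (A.symm x) = liftFun u x := by
  rw [h.pull_eq u hx, A.apply_symm_apply, liftFun]

theorem Realizes.memLp_iff {e : Equiv.Perm (Fin 4)} {A : Plane ≃ᵃⁱ[ℝ] Plane}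
    (h : Realizes e A) {p : Fin 4 → Space} (u : Surface p → ℝ) :
    MemLp (pull p e u) 2 (volume.restrict rhombus) ↔
      MemLp (liftFun u) 2 (volume.restrict (tile A)) := by
  rw [← memLp_comp_iff A (F := liftFun u), preimage_tile]
  refine memLp_congr_ae ?_
  filter_upwards [ae_restrict_mem isOpen_rhombus.measurableSet] with x hx
  exact h.pull_eq u hx

theorem ae_restrict_of_cells {Ω : Set Plane} {P : Plane → Prop} (ho : IsOpen Ω)
    (h : ∀ m n : ℤ, ∀ᵐ x ∂(volume.restrict (Ω ∩ cell m n)), P x) :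
    ∀ᵐ x ∂(volume.restrict Ω), P x := by
  have hc : ∀ m n, MeasurableSet (Ω ∩ cell m n) := fun m n =>
    (ho.inter (isOpen_tile _)).measurableSet
  have h' : ∀ᵐ x : Plane, ∀ m n : ℤ, x ∈ Ω ∩ cell m n → P x :=
    ae_all_iff.2 fun m => ae_all_iff.2 fun n => (ae_restrict_iff' (hc m n)).1 (h m n)
  rw [ae_restrict_iff' ho.measurableSet]
  filter_upwards [h', ae_mem_cell] with x h1 h2 hx
  exact h1 _ _ ⟨hx, h2⟩

/-- A solution on the surface lifts to a periodic solution on the whole plane. -/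
theorem IsLaplaceSolution.exists_gradient {p : Fin 4 → Space} {lam : ℝ} {u : Surface p → ℝ}
    (hu : IsLaplaceSolution p lam u) : ∃ g : Plane → Plane, SqLoc (liftFun u) ∧ SqLoc g ∧
      (∀ l ∈ hexLattice, ∀ x, g (x + l) = g x) ∧
      (∀ v, WeakDiv Set.univ (fun x => liftFun u x • v) (fun x => inner ℝ v (g x))) ∧
      WeakDiv Set.univ g (fun x => -(lam * liftFun u x)) := by
  choose γ hγ1 hγ2 hγ3 hγ4 using isLaplaceSolution_iff.1 hu
  -- The global gradient is read off cell by cell from the translated charts. Its values on the cell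
  -- boundaries, a null set, are irrelevant.
  set g : Plane → Plane := fun x => γ (cellPerm ⌊sCoord x⌋ ⌊rCoord x⌋)
    (x - pt ⌊sCoord x⌋ ⌊rCoord x⌋) with hg
  -- the gradient in the tile belonging to an isometry
  set G : Equiv.Perm (Fin 4) → (Plane ≃ᵃⁱ[ℝ] Plane) → Plane → Plane :=
    fun e A x => A.linearIsometryEquiv (γ e (A.symm x)) with hG
  have hcell : ∀ (m n : ℤ) (x : Plane), x ∈ cell m n →
      g x = G (cellPerm m n) (AffineIsometryEquiv.constVAdd ℝ Plane (pt m n)) x := by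
    intro m n x hx
    obtain ⟨h1, h2⟩ := floor_of_mem_cell hx
    simp only [hg, hG, h1, h2]
    change γ (cellPerm m n) (x - pt m n) = γ (cellPerm m n) (-pt m n + x)
    rw [neg_add_eq_sub]
  have mG : ∀ e A, MemLp (G e A) 2 (volume.restrict (tile A)) := by
    intro e A
    have h1 : MemLp (fun x => γ e (A.symm x)) 2 (volume.restrict (tile A)) :=
      (memLp_comp_iff A.symm).2 (hγ2 e)
    exact A.linearIsometryEquiv.toContinuousLinearEquiv.toContinuousLinearMap.comp_memLp' h1
  have mU : ∀ e A, Realizes e A → MemLp (liftFun u) 2 (volume.restrict (tile A)) :=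
    fun e A h => (h.memLp_iff u).1 (hγ1 e)
  have sU : SqLoc (liftFun u) := sqLoc_of_cells fun m n => mU _ _ (realizes_constVAdd m n)
  have sg : SqLoc g := sqLoc_of_cells fun m n => by
    refine (memLp_congr_ae ?_).2 (mG (cellPerm m n)
      (AffineIsometryEquiv.constVAdd ℝ Plane (pt m n)))
    filter_upwards [ae_restrict_mem (isOpen_tile _).measurableSet] with x hx
    exact hcell m n x hx
  have w1 : ∀ e A, Realizes e A → ∀ v, WeakDiv (tile A) (fun x => liftFun u x • v)
      (fun x => inner ℝ v (G e A x)) := by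
    intro e A h v
    have h1 := WeakDiv.transport (Ω := tile A) A (by
      rw [preimage_tile]; exact hγ3 e (A.linearIsometryEquiv.symm v))
    refine h1.congr ?_ (Filter.Eventually.of_forall fun x => ?_)
    · filter_upwards [ae_restrict_mem (isOpen_tile _).measurableSet] with x hx
      rw [h.pull_symm_eq u hx, map_smul, LinearIsometryEquiv.apply_symm_apply]
    · change inner ℝ (A.linearIsometryEquiv.symm v) _ = inner ℝ v (A.linearIsometryEquiv _)
      rw [← A.linearIsometryEquiv.inner_map_map, LinearIsometryEquiv.apply_symm_apply]
  have w2 : ∀ e A, Realizes e A → WeakDiv (tile A) (G e A) (fun x => -(lam * liftFun u x)) := by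
    intro e A h
    have h1 := WeakDiv.transport (Ω := tile A) A (by rw [preimage_tile]; exact hγ4 e)
    refine h1.congr (Filter.EventuallyEq.refl _ _) ?_
    filter_upwards [ae_restrict_mem (isOpen_tile _).measurableSet] with x hx
    rw [h.pull_symm_eq u hx]
  -- On the overlap of a tile with a cell both fields are weak gradients of the same lift, so
  -- uniqueness applies to their two components.
  have hgG : ∀ e A, Realizes e A → g =ᵐ[volume.restrict (tile A)] G e A := by
    intro e A h
    refine ae_restrict_of_cells (isOpen_tile A) fun m n => ?_
    set B := AffineIsometryEquiv.constVAdd ℝ Plane (pt (m : ℝ) n) with hB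
    have hB' : Realizes (cellPerm m n) B := realizes_constVAdd m n
    have ho : IsOpen (tile A ∩ cell m n) := (isOpen_tile A).inter (isOpen_tile B)
    have mono1 : volume.restrict (tile A ∩ cell m n) ≤ volume.restrict (tile A) :=
      Measure.restrict_mono Set.inter_subset_left le_rfl
    have mono2 : volume.restrict (tile A ∩ cell m n) ≤ volume.restrict (tile B) :=
      Measure.restrict_mono Set.inter_subset_right le_rfl
    have key : ∀ v : Plane, ∀ᵐ x ∂(volume.restrict (tile A ∩ cell m n)),
        inner ℝ v (G e A x) = inner ℝ v (G (cellPerm m n) B x) := fun v =>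
      ((w1 e A h v).mono Set.inter_subset_left).ae_eq ho
        ((w1 _ B hB' v).mono Set.inter_subset_right)
        (((ContinuousLinearMap.toSpanSingleton ℝ v).comp_memLp' (mU e A h)).mono_measure mono1)
        (((mG e A).const_inner v).mono_measure mono1)
        (((mG _ B).const_inner v).mono_measure mono2)
    filter_upwards [key (EuclideanSpace.single 0 1), key (EuclideanSpace.single 1 1),
      ae_restrict_mem ho.measurableSet] with x k1 k2 hx
    rw [hcell m n x hx.2]
    refine plane_ext ?_ ?_
    · simpa [EuclideanSpace.inner_single_left] using k1.symm
    · simpa [EuclideanSpace.inner_single_left] using k2.symm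
  -- from the tiles to the whole plane
  have hglobal : ∀ (F : Plane → Plane) (H : Plane → ℝ), SqLoc F → SqLoc H →
      (∀ e A, Realizes e A → WeakDiv (tile A) F H) → WeakDiv Set.univ F H := by
    intro F H hF hH h ψ hψ
    have hglue := WeakDiv.glue
      (Ω := fun q : {q : Equiv.Perm (Fin 4) × (Plane ≃ᵃⁱ[ℝ] Plane) // Realizes q.1 q.2} =>
        tile q.1.2) (fun q => isOpen_tile _) hF hH fun q => h _ _ q.2
    obtain ⟨a, ha⟩ := (hψ.2.1.isCompact.image sCoord.continuous).isBounded.exists_norm_le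
    obtain ⟨b, hb⟩ := (hψ.2.1.isCompact.image rCoord.continuous).isBounded.exists_norm_le
    -- A compact support meets only finitely many of the points that the tiles leave uncovered, and
    -- these are removed one by one.
    set T : Set Plane := (fun q : ℤ × ℤ => pt q.1 q.2) ''
      (Set.Icc ⌊-a⌋ ⌊a⌋ ×ˢ Set.Icc ⌊-b⌋ ⌊b⌋) with hT
    have hTf : T.Finite := ((Set.finite_Icc _ _).prod (Set.finite_Icc _ _)).image _
    refine WeakDiv.of_finite_punctured hTf hF hH (hglue.mono ?_) ψ hψ.self
    rintro x ⟨hx, hxT⟩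
    by_cases hv : ∃ m n : ℤ, sCoord x = m ∧ rCoord x = n
    · obtain ⟨m, n, hm, hn⟩ := hv
      refine absurd ⟨(m, n), ?_, ?_⟩ hxT
      · have h1 := abs_le.1 (ha _ ⟨x, hx, rfl⟩)
        have h2 := abs_le.1 (hb _ ⟨x, hx, rfl⟩)
        rw [hm] at h1
        rw [hn] at h2
        have k1 := Int.floor_mono h1.1
        have k2 := Int.floor_mono h1.2
        have k3 := Int.floor_mono h2.1
        have k4 := Int.floor_mono h2.2
        rw [Int.floor_intCast] at k1 k2 k3 k4
        exact ⟨⟨k1, k2⟩, k3, k4⟩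
      · simp only
        rw [← hm, ← hn, pt_coord]
    · obtain ⟨e, A, hA, y, hy, rfl⟩ := exists_realizes_mem_rhombus hv
      exact Set.mem_iUnion.2 ⟨⟨(e, A), hA⟩, by simpa [tile] using hy⟩
  refine ⟨g, sU, sg, ?_, fun v => ?_, ?_⟩
  · intro l hl x
    obtain ⟨m, n, hm, hn⟩ := mem_hexLattice_iff.1 hl
    have h1 : ⌊sCoord (x + l)⌋ = ⌊sCoord x⌋ + 2 * m := by
      rw [map_add, hm, ← Int.floor_add_intCast]
      push_cast
      rfl
    have h2 : ⌊rCoord (x + l)⌋ = ⌊rCoord x⌋ + 2 * n := by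
      rw [map_add, hn, ← Int.floor_add_intCast]
      push_cast
      rfl
    simp only [hg, h1, h2, cellPerm_add_two_mul]
    congr 1
    refine coord_ext ?_ ?_
    · simp only [map_sub, map_add, sCoord_pt, hm]
      push_cast
      ring
    · simp only [map_sub, map_add, rCoord_pt, hn]
      push_cast
      ring
  · refine hglobal _ _ (fun K hK => ?_) (fun K hK => (sg K hK).const_inner v) fun e A h => ?_
    · exact (ContinuousLinearMap.toSpanSingleton ℝ v).comp_memLp' (sU K hK)
    · refine (w1 e A h v).congr (Filter.EventuallyEq.refl _ _) ?_
      filter_upwards [hgG e A h] with x hx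
      rw [hx]
  · refine hglobal _ _ sg (fun K hK => ((sU K hK).const_mul lam).neg) fun e A h => ?_
    exact (w2 e A h).congr (hgG e A h).symm (Filter.EventuallyEq.refl _ _)

/-! ### Fourier series with finitely many coefficients -/

section Fourier

/-- The circle with its Haar probability measure. -/
local instance unitCircleMeasureSpace : MeasureSpace UnitAddCircle := ⟨AddCircle.haarAddCircle⟩

/-- The half-open unit cube. -/
def unitCube (d : Type*) : Set (d → ℝ) := {y | ∀ i, y i ∈ Set.Ioc (0 : ℝ) (0 + 1)}

theorem measurableSet_unitCube (d : Type*) [Fintype d] : MeasurableSet (unitCube d) :=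
  MeasurableSet.univ_pi' fun _ => measurableSet_Ioc

open UnitAddTorus in
/-- A square integrable function on the cube with finitely many non-zero Fourier coefficients is
a trigonometric polynomial. -/
theorem ae_eq_sum_of_fourier_eq_zero {d : Type*} [Fintype d] {f : (d → ℝ) → ℂ}
    (hf : MemLp f 2 (volume.restrict (unitCube d))) (S : Finset (d → ℤ))
    (h : ∀ n, n ∉ S →
      ∫ y in unitCube d, mFourier (-n) (fun i => (y i : UnitAddCircle)) • f y = 0) :
    ∃ a : (d → ℤ) → ℂ, f =ᵐ[volume.restrict (unitCube d)]
      fun y => ∑ n ∈ S, a n * mFourier n (fun i => (y i : UnitAddCircle)) := by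
  set b : d → ℝ := fun _ => 0
  have hQ : MeasurableSet {y : d → ℝ | ∀ i, y i ∈ Set.Ioc (b i) (b i + 1)} :=
    measurableSet_unitCube d
  have hmp := measurePreserving_equivPiIoc b
  have hval : MeasurePreserving
      (Subtype.val : {y : d → ℝ // ∀ i, y i ∈ Set.Ioc (b i) (b i + 1)} → (d → ℝ))
      (Measure.comap Subtype.val volume) (volume.restrict (unitCube d)) :=
    ⟨measurable_subtype_coe, map_comap_subtype_coe hQ volume⟩
  set F : UnitAddTorus d → ℂ := fun t => f (measurableEquivPiIoc b t).1 with hF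
  have hFL : MemLp F 2 volume := hf.comp_measurePreserving (hval.comp hmp)
  have hFc : ∀ y ∈ unitCube d, F (fun i => (y i : UnitAddCircle)) = f y := by
    intro y hy
    have := (measurableEquivPiIoc b).apply_symm_apply ⟨y, hy⟩
    rw [coe_symm_measurableEquivPiIoc_apply] at this
    simp only [hF]
    rw [this]
  have hco : ∀ n, n ∉ S → mFourierCoeff (hFL.toLp F) n = 0 := by
    intro n hn
    have e1 : mFourierCoeff (hFL.toLp F) n = mFourierCoeff F n :=
      integral_congr_ae (hFL.coeFn_toLp.mono fun t ht => by simp only [ht])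
    rw [e1, mFourierCoeff_eq_integral F n b, ← h n hn]
    refine setIntegral_congr_fun hQ fun y hy => ?_
    rw [hFc y hy]
  -- The Fourier series converges to `F` in `L²`, and here it is a finite sum.
  have hs := hasSum_mFourier_series_L2 (hFL.toLp F)
  have hs' := hasSum_sum_of_ne_finset_zero (s := S) (L := .unconditional _)
    (f := fun i ↦ mFourierCoeff (hFL.toLp F) i • mFourierLp 2 i)
    (fun n hn => by rw [hco n hn, zero_smul])
  have he := hs.unique hs'
  refine ⟨mFourierCoeff (hFL.toLp F), ?_⟩
  have hae : ∀ᵐ t : UnitAddTorus d, F t =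
      ∑ n ∈ S, mFourierCoeff (hFL.toLp F) n * mFourier n t := by
    have e2 : ∀ᵐ t : UnitAddTorus d,
        (∑ n ∈ S, mFourierCoeff (hFL.toLp F) n • mFourierLp 2 n : Lp ℂ 2 volume) t =
        ∑ n ∈ S, mFourierCoeff (hFL.toLp F) n * mFourier n t := by
      have e3 : ∀ᵐ t : UnitAddTorus d, ∀ n ∈ S,
          (mFourierCoeff (hFL.toLp F) n • mFourierLp 2 n : Lp ℂ 2 volume) t =
            mFourierCoeff (hFL.toLp F) n * mFourier n t := by
        refine (Finset.eventually_all S).2 fun n _ => ?_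
        filter_upwards [Lp.coeFn_smul (mFourierCoeff (hFL.toLp F) n) (mFourierLp 2 n),
          coeFn_mFourierLp 2 n] with t h1 h2
        rw [h1, Pi.smul_apply, h2, smul_eq_mul]
      filter_upwards [Lp.coeFn_finsetSum S
        (fun n => (mFourierCoeff (hFL.toLp F) n • mFourierLp 2 n : Lp ℂ 2 volume)), e3]
        with t h1 h2
      rw [h1, Finset.sum_apply]
      exact Finset.sum_congr rfl h2
    rw [← he] at e2
    filter_upwards [hFL.coeFn_toLp, e2] with t h1 h2
    rw [← h1, h2]
  have hsy := (hmp.symm).quasiMeasurePreserving.ae hae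
  have := (ae_restrict_iff_subtype (μ := volume) hQ (p := fun y => f y =
      ∑ n ∈ S, mFourierCoeff (hFL.toLp F) n * mFourier n (fun i => (y i : UnitAddCircle)))).2
      (hsy.mono fun y hy => by
        rw [coe_symm_measurableEquivPiIoc_apply] at hy
        rw [← hy]
        exact (hFc y.1 y.2).symm)
  exact this

end Fourier

/-! ### Testing periodic equations with periodic functions -/

/-- A smooth bump on the line whose translates by even integers sum to one. -/
def bump (t : ℝ) : ℝ := Real.smoothTransition (t / 2 + 1) - Real.smoothTransition (t / 2)

theorem contDiff_bump : ContDiff ℝ ∞ bump := by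
  unfold bump
  exact (Real.smoothTransition.contDiff.comp (by fun_prop)).sub
    (Real.smoothTransition.contDiff.comp (by fun_prop))

theorem bump_eq_zero {t : ℝ} (h : 2 < |t|) : bump t = 0 := by
  unfold bump
  rcases lt_abs.1 h with h | h
  · rw [Real.smoothTransition.one_of_one_le (by linarith),
      Real.smoothTransition.one_of_one_le (by linarith), sub_self]
  · rw [Real.smoothTransition.zero_of_nonpos (by linarith),
      Real.smoothTransition.zero_of_nonpos (by linarith), sub_self]

/-- The sum telescopes to the difference of the smooth transition at `t/2 + 1 ≥ 1` and at `t/2 - 2 ≤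
0`. -/
theorem sum_bump {t : ℝ} (h0 : 0 < t) (h4 : t < 4) :
    ∑ a ∈ Finset.range 3, bump (t - 2 * a) = 1 := by
  simp only [Finset.sum_range_succ, Finset.range_zero, Finset.sum_empty, bump]
  have e1 : (t - 2 * ((1 : ℕ) : ℝ)) / 2 + 1 = t / 2 := by push_cast; ring
  have e2 : (t - 2 * ((2 : ℕ) : ℝ)) / 2 + 1 = (t - 2 * ((1 : ℕ) : ℝ)) / 2 := by push_cast; ring
  have e3 : (t - 2 * ((0 : ℕ) : ℝ)) / 2 = t / 2 := by push_cast; ring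
  rw [e1, e2, e3, Real.smoothTransition.one_of_one_le (by linarith),
    Real.smoothTransition.zero_of_nonpos (x := (t - 2 * ((2 : ℕ) : ℝ)) / 2)
      (by push_cast; linarith)]
  ring

/-- The half-open fundamental parallelogram of the torus. -/
def parallelogram : Set Plane := {x | sCoord x ∈ Set.Ioc 0 2 ∧ rCoord x ∈ Set.Ioc 0 2}

theorem measurableSet_parallelogram : MeasurableSet parallelogram :=
  (sCoord.continuous.measurable measurableSet_Ioc).inter
    (rCoord.continuous.measurable measurableSet_Ioc)

theorem pt_two_mem (a b : ℤ) : pt (2 * a) (2 * b) ∈ hexLattice :=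
  mem_hexLattice_iff.2 ⟨a, b, by simp, by simp⟩

theorem sum_indicator_Ioc {t : ℝ} (h : |t| ≤ 2) :
    ∑ a ∈ Finset.range 3, (if t + 2 * a ∈ Set.Ioc (0 : ℝ) 2 then (1 : ℝ) else 0) = 1 := by
  have := abs_le.1 h
  simp only [Finset.sum_range_succ, Finset.range_zero, Finset.sum_empty, Set.mem_Ioc]
  push_cast
  split_ifs <;> first | (exfalso; grind) | norm_num

/-- Unfolding over the lattice. Exactly one of the shifts by 0, 2, 4 moves a number of `[-2, 2]`
into `(0, 2]`, so nine translates suffice. -/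
theorem integral_eq_sum_parallelogram {F : Plane → ℝ} (hF : Integrable F)
    (h0 : ∀ x, F x ≠ 0 → |sCoord x| ≤ 2 ∧ |rCoord x| ≤ 2) :
    ∫ x, F x = ∫ x in parallelogram, ∑ q ∈ Finset.range 3 ×ˢ Finset.range 3,
      F (x - pt (2 * q.1) (2 * q.2)) := by
  have h1 : ∀ x, F x = ∑ q ∈ Finset.range 3 ×ˢ Finset.range 3,
      parallelogram.indicator (fun y => F (y - pt (2 * q.1) (2 * q.2)))
        (x + pt (2 * q.1) (2 * q.2)) := by
    intro x
    by_cases hx : F x = 0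
    · rw [hx, Finset.sum_eq_zero]
      intro q _
      simp [Set.indicator, hx]
    · obtain ⟨hs, hr⟩ := h0 x hx
      have e := congrArg₂ (· * ·) (sum_indicator_Ioc hs) (sum_indicator_Ioc hr)
      simp only [mul_one] at e
      rw [Finset.sum_mul_sum, ← Finset.sum_product'] at e
      rw [← mul_one (F x), ← e, Finset.mul_sum]
      refine Finset.sum_congr rfl fun q _ => ?_
      simp only [Set.indicator, parallelogram, Set.mem_ofPred_eq, map_add, sCoord_pt, rCoord_pt,
        add_sub_cancel_right]
      split_ifs <;> simp_all
  have h2 : ∀ q : ℕ × ℕ, Integrable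
      (parallelogram.indicator fun y => F (y - pt (2 * q.1) (2 * q.2))) := fun q =>
    (hF.comp_sub_right _).indicator measurableSet_parallelogram
  rw [integral_congr_ae (Filter.Eventually.of_forall h1),
    integral_finsetSum _ fun q _ => (h2 q).comp_add_right _,
    integral_finsetSum _ fun q _ => (hF.comp_sub_right _).integrableOn]
  refine Finset.sum_congr rfl fun q _ => ?_
  rw [integral_add_right_eq_self (fun x => parallelogram.indicator
    (fun y => F (y - pt (2 * q.1) (2 * q.2))) x), integral_indicator measurableSet_parallelogram]

/-- Periodic weak equations may be tested with periodic functions. -/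
theorem WeakDiv.integral_parallelogram_eq_zero {G : Plane → Plane} {H : Plane → ℝ}
    (h : WeakDiv Set.univ G H) (hG : SqLoc G) (hH : SqLoc H)
    (hGp : ∀ l ∈ hexLattice, ∀ x, G (x + l) = G x) (hHp : ∀ l ∈ hexLattice, ∀ x, H (x + l) = H x)
    {c : Plane → ℝ} (hc : ContDiff ℝ ∞ c) (hcp : ∀ l ∈ hexLattice, ∀ x, c (x + l) = c x) :
    ∫ x in parallelogram, (fderiv ℝ c x (G x) + H x * c x) = 0 := by
  -- The periodic function is localized so that the lattice translates of `ψ` add up to `c` again.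
  set ψ : Plane → ℝ := fun x => bump (sCoord x) * bump (rCoord x) * c x with hψ
  have hψd : ContDiff ℝ ∞ ψ :=
    ((contDiff_bump.comp sCoord.contDiff).mul (contDiff_bump.comp rCoord.contDiff)).mul hc
  set K : Set Plane := {x | |sCoord x| ≤ 2 ∧ |rCoord x| ≤ 2} with hK
  have hKc : IsCompact K := by
    have : K = (fun q : ℝ × ℝ => pt q.1 q.2) '' (Set.Icc (-2) 2 ×ˢ Set.Icc (-2) 2) := by
      ext x
      constructor
      · rintro ⟨h1, h2⟩
        exact ⟨(sCoord x, rCoord x), ⟨abs_le.1 h1, abs_le.1 h2⟩, pt_coord x⟩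
      · rintro ⟨q, ⟨h1, h2⟩, rfl⟩
        exact ⟨by simpa [abs_le] using h1, by simpa [abs_le] using h2⟩
    rw [this]
    exact (isCompact_Icc.prod isCompact_Icc).image continuous_pt
  have hsupp : tsupport ψ ⊆ K := by
    refine closure_minimal (fun x hx => ?_) hKc.isClosed
    constructor <;> by_contra hcon <;>
      exact hx (by simp [hψ, bump_eq_zero (not_le.1 hcon)])
  have hψt : IsTest Set.univ ψ :=
    ⟨hψd, hKc.of_isClosed_subset (isClosed_tsupport ψ) hsupp, Set.subset_univ _⟩
  have hint := integrable_weak_of_sqLoc hψt hG hH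
  have hz : ∀ x, fderiv ℝ ψ x (G x) + H x * ψ x ≠ 0 → |sCoord x| ≤ 2 ∧ |rCoord x| ≤ 2 := by
    intro x hx
    by_contra hcon
    have hn : x ∉ tsupport ψ := fun h => hcon (hsupp h)
    refine hx ?_
    rw [fderiv_eq_zero_of_notMem hψt.self hn, eq_zero_of_notMem hψt.self hn]
    simp
  rw [← h ψ hψt, integral_eq_sum_parallelogram hint hz]
  refine setIntegral_congr_fun measurableSet_parallelogram fun x hx => ?_
  have hl : ∀ q : ℕ × ℕ, -pt (2 * q.1) (2 * q.2) ∈ hexLattice := fun q =>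
    neg_mem (by exact_mod_cast pt_two_mem q.1 q.2)
  have e1 : ∀ q : ℕ × ℕ, ∀ y : Plane, ψ (y - pt (2 * q.1) (2 * q.2)) =
      bump (sCoord y - 2 * q.1) * bump (rCoord y - 2 * q.2) * c y := by
    intro q y
    simp only [hψ, map_sub, sCoord_pt, rCoord_pt]
    rw [sub_eq_add_neg y, hcp _ (hl q)]
  have hsum : (fun y => ∑ q ∈ Finset.range 3 ×ˢ Finset.range 3,
      ψ (y - pt (2 * q.1) (2 * q.2))) =ᶠ[𝓝 x] c := by
    -- The bumps sum to one on the open interval `(0, 4)`, which contains `(0, 2]`; the identity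
    -- thus holds near `x` and may be differentiated.
    have ho : {y : Plane | (0 < sCoord y ∧ sCoord y < 4) ∧ (0 < rCoord y ∧ rCoord y < 4)} ∈ 𝓝 x := by
      refine IsOpen.mem_nhds ?_ ?_
      · exact ((isOpen_lt continuous_const sCoord.continuous).inter
          (isOpen_lt sCoord.continuous continuous_const)).inter
          ((isOpen_lt continuous_const rCoord.continuous).inter
          (isOpen_lt rCoord.continuous continuous_const))
      · obtain ⟨⟨h1, h2⟩, h3, h4⟩ := hx
        exact ⟨⟨h1, by linarith⟩, h3, by linarith⟩
    filter_upwards [ho] with y hy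
    have e := congrArg₂ (· * ·) (sum_bump hy.1.1 hy.1.2) (sum_bump hy.2.1 hy.2.2)
    simp only [mul_one] at e
    rw [Finset.sum_mul_sum, ← Finset.sum_product'] at e
    simp only [e1]
    rw [← Finset.sum_mul, e, one_mul]
  have hd : ∀ q : ℕ × ℕ, DifferentiableAt ℝ (fun y => ψ (y - pt (2 * q.1) (2 * q.2))) x := by
    intro q
    exact ((hψd.comp (contDiff_id.sub contDiff_const)).differentiable (by simp)) x
  have e2 : fderiv ℝ c x = ∑ q ∈ Finset.range 3 ×ˢ Finset.range 3,
      fderiv ℝ ψ (x - pt (2 * q.1) (2 * q.2)) := by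
    rw [← hsum.fderiv_eq, fderiv_fun_sum fun q _ => hd q]
    exact Finset.sum_congr rfl fun q _ => fderiv_comp_sub _
  have e3 : c x = ∑ q ∈ Finset.range 3 ×ˢ Finset.range 3,
      ψ (x - pt (2 * q.1) (2 * q.2)) := hsum.eq_of_nhds.symm
  have e4 : ∀ q : ℕ × ℕ, G (x - pt (2 * q.1) (2 * q.2)) = G x := fun q => by
    rw [sub_eq_add_neg, hGp _ (hl q)]
  have e5 : ∀ q : ℕ × ℕ, H (x - pt (2 * q.1) (2 * q.2)) = H x := fun q => by
    rw [sub_eq_add_neg, hHp _ (hl q)]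
  simp only [e4, e5, Finset.sum_add_distrib, ← Finset.mul_sum]
  rw [e2, ← e3, sum_apply]

/-! ### Plane waves and the dual lattice -/

/-- The plane wave with frequency `w` and phase `θ`. -/
def phaseWave (w : Plane) (θ : ℝ) (x : Plane) : ℝ :=
  Real.cos (2 * Real.pi * inner ℝ x w + θ)

theorem phaseWave_zero (w : Plane) : phaseWave w 0 = cosWave w := by
  funext x
  simp [phaseWave, cosWave]

theorem contDiff_phaseWave (w : Plane) (θ : ℝ) : ContDiff ℝ ∞ (phaseWave w θ) := by
  have h : ContDiff ℝ ∞ fun x : Plane => (inner ℝ x w : ℝ) := contDiff_id.inner ℝ contDiff_const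
  exact Real.contDiff_cos.comp ((contDiff_const.mul h).add contDiff_const)

/-- Differentiation advances the phase by a quarter period, so sines need no separate treatment. -/
theorem hasFDerivAt_phaseWave (w : Plane) (θ : ℝ) (x : Plane) :
    HasFDerivAt (phaseWave w θ)
      ((2 * Real.pi * phaseWave w (θ + Real.pi / 2) x) • innerSL ℝ w) x := by
  have h1 : HasFDerivAt (fun y : Plane => 2 * Real.pi * inner ℝ y w + θ)
      ((2 * Real.pi) • innerSL ℝ w) x := by
    have := ((innerSL ℝ w).hasFDerivAt (x := x)).const_mul (2 * Real.pi) |>.add_const θ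
    simpa [real_inner_comm] using this
  have h2 := h1.cos
  refine h2.congr_fderiv ?_
  rw [smul_smul, phaseWave, ← add_assoc, Real.cos_add_pi_div_two]
  congr 1
  ring

theorem fderiv_phaseWave (w : Plane) (θ : ℝ) (x v : Plane) :
    fderiv ℝ (phaseWave w θ) x v =
      2 * Real.pi * phaseWave w (θ + Real.pi / 2) x * inner ℝ w v := by
  rw [(hasFDerivAt_phaseWave w θ x).fderiv]
  simp

theorem phaseWave_add_pi (w : Plane) (θ : ℝ) (x : Plane) :
    phaseWave w (θ + Real.pi / 2 + Real.pi / 2) x = -phaseWave w θ x := by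
  rw [phaseWave, add_assoc θ, add_halves, ← add_assoc, Real.cos_add_pi, phaseWave]

theorem phaseWave_add_lattice {w : Plane} (hw : w ∈ dualLattice) (θ : ℝ) {l : Plane}
    (hl : l ∈ hexLattice) (x : Plane) : phaseWave w θ (x + l) = phaseWave w θ x := by
  obtain ⟨n, hn⟩ := hw l hl
  rw [phaseWave, inner_add_left, hn, phaseWave,
    ← Real.cos_add_int_mul_two_pi (2 * Real.pi * inner ℝ x w + θ) n]
  congr 1
  ring

theorem exists_isCompact_parallelogram : ∃ K : Set Plane, IsCompact K ∧ parallelogram ⊆ K := by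
  refine ⟨(fun q : ℝ × ℝ => pt q.1 q.2) '' (Set.Icc 0 2 ×ˢ Set.Icc 0 2),
    (isCompact_Icc.prod isCompact_Icc).image continuous_pt, fun x hx => ?_⟩
  exact ⟨(sCoord x, rCoord x), ⟨Set.Ioc_subset_Icc_self hx.1, Set.Ioc_subset_Icc_self hx.2⟩,
    pt_coord x⟩

theorem SqLoc.memLp_parallelogram {E : Type*} [NormedAddCommGroup E] {G : Plane → E}
    (h : SqLoc G) : MemLp G 2 (volume.restrict parallelogram) := by
  obtain ⟨K, hK, hP⟩ := exists_isCompact_parallelogram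
  exact (h K hK).mono_measure (Measure.restrict_mono hP le_rfl)

theorem SqLoc.of_continuous {E : Type*} [NormedAddCommGroup E] {G : Plane → E}
    (h : Continuous G) : SqLoc G := by
  intro K hK
  obtain ⟨C, hC⟩ := hK.exists_bound_of_continuousOn h.continuousOn
  have : IsFiniteMeasure (volume.restrict K) := ⟨by simpa using hK.measure_lt_top⟩
  exact MemLp.of_bound h.aestronglyMeasurable.restrict C
    (ae_restrict_of_forall_mem hK.measurableSet hC)

theorem SqLoc.integrableOn_mul {f c : Plane → ℝ} (hf : SqLoc f) (hc : Continuous c) :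
    IntegrableOn (fun x => f x * c x) parallelogram :=
  hf.memLp_parallelogram.integrable_mul (SqLoc.of_continuous hc).memLp_parallelogram

theorem SqLoc.inner {G : Plane → Plane} (h : SqLoc G) (w : Plane) :
    SqLoc fun x => inner ℝ w (G x) := fun K hK => (h K hK).const_inner w

/-- The gradient equation in direction `w`, tested with the phase-shifted wave, and the eigenvalue
equation, tested with the wave itself, both contain the integral of `⟪w, g⟫` against the shifted
wave. Eliminating it leaves the coefficient multiplied by `4π²|w|² - lam`. -/
theorem wave_coefficient_eq_zero {U : Plane → ℝ} {g : Plane → Plane} {lam : ℝ} (hU : SqLoc U)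
    (hg : SqLoc g) (hUp : ∀ l ∈ hexLattice, ∀ x, U (x + l) = U x)
    (hgp : ∀ l ∈ hexLattice, ∀ x, g (x + l) = g x)
    (h1 : ∀ v, WeakDiv Set.univ (fun x => U x • v) (fun x => inner ℝ v (g x)))
    (h2 : WeakDiv Set.univ g (fun x => -(lam * U x))) {w : Plane} (hw : w ∈ dualLattice)
    (hlam : 4 * Real.pi ^ 2 * ‖w‖ ^ 2 ≠ lam) (θ : ℝ) :
    ∫ x in parallelogram, U x * phaseWave w θ x = 0 := by
  have hUw : SqLoc fun x => U x • w := fun K hK => by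
    simpa using! (ContinuousLinearMap.toSpanSingleton ℝ w).comp_memLp' (hU K hK)
  have hlU : SqLoc fun x => -(lam * U x) := fun K hK => ((hU K hK).const_mul lam).neg
  have e1 := (h1 w).integral_parallelogram_eq_zero hUw (hg.inner w)
    (fun l hl x => by simp only [hUp l hl]) (fun l hl x => by simp only [hgp l hl])
    (contDiff_phaseWave w (θ + Real.pi / 2)) (fun l hl x => phaseWave_add_lattice hw _ hl x)
  have e2 := h2.integral_parallelogram_eq_zero hg hlU hgp
    (fun l hl x => by simp only [hUp l hl])
    (contDiff_phaseWave w θ) (fun l hl x => phaseWave_add_lattice hw _ hl x)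
  have i1 := hU.integrableOn_mul (contDiff_phaseWave w θ).continuous
  have i2 := (hg.inner w).integrableOn_mul (contDiff_phaseWave w (θ + Real.pi / 2)).continuous
  simp only [fderiv_phaseWave, phaseWave_add_pi, inner_smul_right, real_inner_self_eq_norm_sq]
    at e1 e2
  have e3 : ∀ x, 2 * Real.pi * -phaseWave w θ x * (U x * ‖w‖ ^ 2) +
      inner ℝ w (g x) * phaseWave w (θ + Real.pi / 2) x =
      -(2 * Real.pi * ‖w‖ ^ 2) * (U x * phaseWave w θ x) +
      inner ℝ w (g x) * phaseWave w (θ + Real.pi / 2) x := fun x => by ring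
  have e4 : ∀ x, 2 * Real.pi * phaseWave w (θ + Real.pi / 2) x * inner ℝ w (g x) +
      -(lam * U x) * phaseWave w θ x =
      (2 * Real.pi) * (inner ℝ w (g x) * phaseWave w (θ + Real.pi / 2) x) +
      (-lam) * (U x * phaseWave w θ x) := fun x => by ring
  simp only [e3] at e1
  simp only [e4] at e2
  rw [integral_add (i1.const_mul _) i2, integral_const_mul] at e1
  rw [integral_add (i2.const_mul _) (i1.const_mul _), integral_const_mul, integral_const_mul] at e2
  have e5 : (4 * Real.pi ^ 2 * ‖w‖ ^ 2 - lam) * ∫ x in parallelogram, U x * phaseWave w θ x = 0 := by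
    linear_combination e2 - 2 * Real.pi * e1
  exact (mul_eq_zero.1 e5).resolve_left (sub_ne_zero.2 hlam)

theorem dualVec_zero (k j : ℤ) : dualVec k j 0 = k / 2 := by
  simp [dualVec, div_eq_mul_inv]

theorem dualVec_one (k j : ℤ) : dualVec k j 1 = √3 * (k / 6 + j / 3) := by
  simp [dualVec]
  ring

theorem inner_dualVec (x : Plane) (k j : ℤ) :
    inner ℝ x (dualVec k j) = ((k + j) * rCoord x - j * sCoord x) / 2 := by
  rw [EuclideanSpace.inner_eq_star_dotProduct]
  simp only [dotProduct, Fin.sum_univ_two, Pi.star_apply, star_trivial]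
  rw [dualVec_zero, dualVec_one, apply_zero_eq, apply_one_eq]
  linear_combination ((rCoord x - sCoord x) * (k + 2 * j) / 12) * sqrt_three_sq

theorem norm_sq_dualVec (k j : ℤ) :
    ‖dualVec k j‖ ^ 2 = ((k : ℝ) ^ 2 + k * j + (j : ℝ) ^ 2) / 3 := by
  rw [EuclideanSpace.norm_sq_eq, Fin.sum_univ_two, dualVec_zero, dualVec_one, Real.norm_eq_abs,
    Real.norm_eq_abs, sq_abs, sq_abs]
  linear_combination (((k : ℝ) / 6 + j / 3) ^ 2) * sqrt_three_sq

theorem eigenvalue_eq (k j : ℤ) : 4 * Real.pi ^ 2 * ‖dualVec k j‖ ^ 2 = eigenvalue k j := by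
  rw [norm_sq_dualVec, eigenvalue]
  ring

theorem dualVec_mem_dualLattice (k j : ℤ) : dualVec k j ∈ dualLattice := by
  intro l hl
  obtain ⟨m, n, hm, hn⟩ := mem_hexLattice_iff.1 hl
  refine ⟨(k + j) * n - j * m, ?_⟩
  rw [inner_dualVec, hm, hn]
  push_cast
  ring

/-- Pairing `k u + j v` with the lattice vectors `pt 2 0` and `pt 0 2` gives `-j` and `k + j`, from
which `k` and `j` are read off. -/
theorem mem_dualLattice_iff {w : Plane} : w ∈ dualLattice ↔ ∃ k j : ℤ, w = dualVec k j := by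
  refine ⟨fun h => ?_, ?_⟩
  · obtain ⟨m, hm⟩ := h (pt 2 0) (by simpa using pt_two_mem 1 0)
    obtain ⟨n, hn⟩ := h (pt 0 2) (by simpa using pt_two_mem 0 1)
    rw [EuclideanSpace.inner_eq_star_dotProduct] at hm hn
    simp only [dotProduct, Fin.sum_univ_two, Pi.star_apply, star_trivial] at hm hn
    rw [apply_zero_eq (pt _ _), apply_one_eq (pt _ _)] at hm hn
    simp only [sCoord_pt, rCoord_pt] at hm hn
    refine ⟨n + m, -m, plane_ext ?_ ?_⟩
    · rw [dualVec_zero]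
      push_cast
      linarith
    · rw [dualVec_one]
      push_cast
      linear_combination (√3 / 6) * hn - (√3 / 6) * hm - (w 1 / 3) * sqrt_three_sq
  · rintro ⟨k, j, rfl⟩
    exact dualVec_mem_dualLattice k j

theorem planeCos_apply (k j : ℤ) (x : Plane) :
    planeCos k j x = Real.cos (Real.pi * ((k + j) * rCoord x - j * sCoord x)) := by
  rw [planeCos, cosWave, inner_dualVec]
  congr 1
  ring

/-- The quadratic form is positive definite: `k²` and `j²` are at most twice its value, and `4π²/3 ≥
1`. -/
theorem finite_eigenvalue_eq (lam : ℝ) :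
    {q : ℤ × ℤ | lam = eigenvalue q.1 q.2}.Finite := by
  refine (Set.finite_Icc (-⌈2 * lam⌉, -⌈2 * lam⌉) (⌈2 * lam⌉, ⌈2 * lam⌉)).subset ?_
  rintro ⟨k, j⟩ h
  have hpi : (1 : ℝ) ≤ 4 * Real.pi ^ 2 / 3 := by nlinarith [Real.pi_gt_three]
  have h0 : (0 : ℝ) ≤ (j : ℝ) ^ 2 + (k : ℝ) ^ 2 + j * k := by
    nlinarith [sq_nonneg ((j : ℝ) + k), sq_nonneg (j : ℝ), sq_nonneg (k : ℝ)]
  have h1 : (j : ℝ) ^ 2 + (k : ℝ) ^ 2 + j * k ≤ lam := by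
    have h' : lam = 4 * Real.pi ^ 2 / 3 * ((j : ℝ) ^ 2 + (k : ℝ) ^ 2 + (j : ℝ) * (k : ℝ)) := h
    nlinarith
  have hk : ((k ^ 2 : ℤ) : ℝ) ≤ 2 * lam := by
    push_cast
    nlinarith [sq_nonneg (2 * (j : ℝ) + k)]
  have hj : ((j ^ 2 : ℤ) : ℝ) ≤ 2 * lam := by
    push_cast
    nlinarith [sq_nonneg (2 * (k : ℝ) + j)]
  have hk' : k ^ 2 ≤ ⌈2 * lam⌉ := by exact_mod_cast hk.trans (Int.le_ceil _)
  have hj' : j ^ 2 ≤ ⌈2 * lam⌉ := by exact_mod_cast hj.trans (Int.le_ceil _)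
  have key : ∀ n M : ℤ, n ^ 2 ≤ M → -M ≤ n ∧ n ≤ M := fun n M hn =>
    ⟨by linarith [Int.le_self_sq (-n), neg_sq n], (Int.le_self_sq n).trans hn⟩
  exact ⟨⟨(key k _ hk').1, (key j _ hj').1⟩, (key k _ hk').2, (key j _ hj').2⟩

/-! ### Fourier expansion on the hexagonal torus -/

/-- Coordinates on the plane in which the lattice of the torus becomes `ℤ²`. -/
def unitCoord : (Fin 2 → ℝ) ≃L[ℝ] Plane :=
  LinearEquiv.toContinuousLinearEquiv
    { toFun := fun y => pt (2 * y 0) (2 * y 1)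
      invFun := fun x => ![sCoord x / 2, rCoord x / 2]
      map_add' := fun y z => coord_ext (by simp [mul_add]) (by simp [mul_add])
      map_smul' := fun c y => coord_ext (by simp [mul_left_comm]) (by simp [mul_left_comm])
      left_inv := fun y => by
        funext i
        fin_cases i <;> simp
      right_inv := fun x => coord_ext (by simp; ring) (by simp; ring) }

theorem unitCoord_apply (y : Fin 2 → ℝ) : unitCoord y = pt (2 * y 0) (2 * y 1) := rfl

theorem unitCoord_preimage_parallelogram : unitCoord ⁻¹' parallelogram = unitCube (Fin 2) := by
  ext y
  simp only [Set.mem_preimage, parallelogram, unitCube, Set.mem_ofPred_eq, unitCoord_apply, sCoord_pt,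
    rCoord_pt, Fin.forall_fin_two, Set.mem_Ioc, zero_add]
  constructor
  · rintro ⟨⟨h1, h2⟩, h3, h4⟩
    exact ⟨⟨by linarith, by linarith⟩, by linarith, by linarith⟩
  · rintro ⟨⟨h1, h2⟩, h3, h4⟩
    exact ⟨⟨by linarith, by linarith⟩, by linarith, by linarith⟩

theorem measurableEmbedding_unitCoord : MeasurableEmbedding unitCoord :=
  unitCoord.toHomeomorph.measurableEmbedding

theorem map_unitCoord_restrict :
    (volume.restrict (unitCube (Fin 2))).map unitCoord =
      (volume.map unitCoord).restrict parallelogram := by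
  rw [← unitCoord_preimage_parallelogram,
    measurableEmbedding_unitCoord.restrict_map]

/-- Uniqueness of Haar measure. The constant is never needed, since only vanishing integrals,
integrability and null sets are transferred. -/
theorem exists_map_unitCoord_eq_smul : ∃ c : NNReal,
    (volume : Measure (Fin 2 → ℝ)).map unitCoord = c • (volume : Measure Plane) :=
  ⟨_, Measure.isAddLeftInvariant_eq_smul _ _⟩

theorem absolutelyContinuous_map_unitCoord :
    (volume : Measure Plane) ≪ (volume : Measure (Fin 2 → ℝ)).map unitCoord :=
  Measure.absolutelyContinuous_isAddHaarMeasure _ _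

/-- The frequency in the plane that belongs to a frequency of the unit torus. -/
def frequency (n : Fin 2 → ℤ) : Plane := dualVec (n 0 + n 1) (-n 0)

theorem phaseWave_unitCoord (n : Fin 2 → ℤ) (θ : ℝ) (y : Fin 2 → ℝ) :
    phaseWave (frequency n) θ (unitCoord y) =
      Real.cos (2 * Real.pi * (n 0 * y 0 + n 1 * y 1) + θ) := by
  rw [phaseWave, frequency, inner_dualVec, unitCoord_apply, sCoord_pt, rCoord_pt]
  congr 1
  push_cast
  ring

/-- Euler's formula; the minus sign appears because the phase shift by `π/2` turns the cosine into
minus the sine. -/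
theorem mFourier_unitCoord (n : Fin 2 → ℤ) (y : Fin 2 → ℝ) :
    UnitAddTorus.mFourier n (fun i => (y i : UnitAddCircle)) =
      (phaseWave (frequency n) 0 (unitCoord y) : ℂ) -
        phaseWave (frequency n) (Real.pi / 2) (unitCoord y) * Complex.I := by
  rw [phaseWave_unitCoord, phaseWave_unitCoord, add_zero, Real.cos_add_pi_div_two]
  simp only [UnitAddTorus.mFourier, ContinuousMap.coe_mk, Fin.prod_univ_two, fourier_coe_apply]
  rw [← Complex.exp_add]
  push_cast
  rw [neg_mul, sub_neg_eq_add, ← Complex.exp_mul_I]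
  congr 1
  ring

/-- Sums of waves on the fundamental parallelogram. -/
theorem exists_wave_sum {U : Plane → ℝ} (hU : SqLoc U) (S : Finset (Fin 2 → ℤ))
    (h : ∀ n, n ∉ S → ∀ θ, ∫ x in parallelogram, U x * phaseWave (frequency n) θ x = 0) :
    ∃ a b : (Fin 2 → ℤ) → ℝ, U =ᵐ[volume.restrict parallelogram]
      fun x => ∑ n ∈ S, (a n * cosWave (frequency n) x +
        b n * phaseWave (frequency n) (Real.pi / 2) x) := by
  obtain ⟨c, hc⟩ := exists_map_unitCoord_eq_smul
  have hμ : (volume.restrict (unitCube (Fin 2))).map unitCoord =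
      c • volume.restrict parallelogram := by
    rw [map_unitCoord_restrict, hc, Measure.restrict_smul]
  have hf : MemLp (fun y => (U (unitCoord y) : ℂ)) 2 (volume.restrict (unitCube (Fin 2))) := by
    have h1 : MemLp U 2 ((volume.restrict (unitCube (Fin 2))).map unitCoord) := by
      rw [hμ]
      exact hU.memLp_parallelogram.smul_measure ENNReal.coe_ne_top
    exact (measurableEmbedding_unitCoord.memLp_map_measure_iff.1 h1).ofReal
  have hint : ∀ n, n ∉ S → ∀ θ, ∫ y in unitCube (Fin 2),
      U (unitCoord y) * phaseWave (frequency n) θ (unitCoord y) = 0 := by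
    intro n hn θ
    have := measurableEmbedding_unitCoord.integral_map
      (μ := volume.restrict (unitCube (Fin 2))) fun x => U x * phaseWave (frequency n) θ x
    rw [← this, hμ, integral_smul_nnreal_measure, h n hn, smul_zero]
  have hco : ∀ n θ, IntegrableOn (fun y => U (unitCoord y) *
      phaseWave (frequency n) θ (unitCoord y)) (unitCube (Fin 2)) := by
    intro n θ
    have h1 : Integrable (fun x => U x * phaseWave (frequency n) θ x)
        ((volume.restrict (unitCube (Fin 2))).map unitCoord) := by
      rw [hμ]
      exact (hU.integrableOn_mul (contDiff_phaseWave _ _).continuous).smul_measure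
        ENNReal.coe_ne_top
    exact measurableEmbedding_unitCoord.integrable_map_iff.1 h1
  have hneg : ∀ n θ x, phaseWave (frequency (-n)) θ x = phaseWave (frequency n) (-θ) x := by
    intro n θ x
    simp only [phaseWave, frequency, inner_dualVec, Pi.neg_apply]
    rw [← Real.cos_neg]
    congr 1
    push_cast
    ring
  obtain ⟨a, ha⟩ := ae_eq_sum_of_fourier_eq_zero hf S fun n hn => by
    have e : ∀ y : Fin 2 → ℝ, UnitAddTorus.mFourier (-n) (fun i => (y i : UnitAddCircle)) •
        (U (unitCoord y) : ℂ) =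
        ((U (unitCoord y) * phaseWave (frequency n) (-0) (unitCoord y) : ℝ) : ℂ) -
        ((U (unitCoord y) * phaseWave (frequency n) (-(Real.pi / 2)) (unitCoord y) : ℝ) : ℂ) *
          Complex.I := by
      intro y
      rw [mFourier_unitCoord, hneg, hneg, smul_eq_mul]
      push_cast
      ring
    simp only [e]
    rw [integral_sub (hco _ _).ofReal ((hco _ _).ofReal.mul_const _), integral_mul_const,
      integral_complex_ofReal, integral_complex_ofReal, hint n hn, hint n hn]
    simp
  -- Real parts of the complex expansion: the minus sign in front of `i` makes the imaginary part of
  -- `a n` enter with a plus sign.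
  refine ⟨fun n => (a n).re, fun n => (a n).im, ?_⟩
  have h2 : ∀ᵐ x ∂((volume.restrict (unitCube (Fin 2))).map unitCoord),
      U x = ∑ n ∈ S, ((a n).re * cosWave (frequency n) x +
        (a n).im * phaseWave (frequency n) (Real.pi / 2) x) := by
    rw [measurableEmbedding_unitCoord.ae_map_iff]
    filter_upwards [ha] with y hy
    have h3 := congrArg Complex.re hy
    rw [Complex.ofReal_re, Complex.re_sum] at h3
    rw [h3]
    refine Finset.sum_congr rfl fun n _ => ?_
    rw [mFourier_unitCoord, phaseWave_zero]
    simp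
  rw [map_unitCoord_restrict] at h2
  exact (absolutelyContinuous_map_unitCoord.restrict _).ae_le h2

theorem ae_of_ae_parallelogram {P : Plane → Prop}
    (hP : ∀ l ∈ hexLattice, ∀ x, P (x + l) → P x)
    (h : ∀ᵐ x ∂(volume.restrict parallelogram), P x) : ∀ᵐ x, P x := by
  rw [ae_restrict_iff' measurableSet_parallelogram] at h
  have h1 : ∀ᵐ x : Plane, ∀ m n : ℤ, x + pt (2 * m) (2 * n) ∈ parallelogram →
      P (x + pt (2 * m) (2 * n)) := by
    rw [ae_all_iff]
    intro m
    rw [ae_all_iff]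
    intro n
    exact (measurePreserving_add_right volume (pt (2 * m) (2 * n))).quasiMeasurePreserving.ae h
  filter_upwards [h1] with x hx
  have key : ∀ t : ℝ, ∃ m : ℤ, t + 2 * m ∈ Set.Ioc (0 : ℝ) 2 := fun t => by
    refine ⟨1 - ⌈t / 2⌉, ?_, ?_⟩ <;> push_cast <;>
      linarith [Int.le_ceil (t / 2), Int.ceil_lt_add_one (t / 2)]
  obtain ⟨m, hm⟩ := key (sCoord x)
  obtain ⟨n, hn⟩ := key (rCoord x)
  exact hP _ (pt_two_mem m n) x (hx m n ⟨by simpa using hm, by simpa using hn⟩)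

theorem finite_frequency (lam : ℝ) :
    {n : Fin 2 → ℤ | lam = eigenvalue (n 0 + n 1) (-n 0)}.Finite := by
  refine ((finite_eigenvalue_eq lam).preimage
    (f := fun n : Fin 2 → ℤ => (n 0 + n 1, -n 0)) fun n _ m _ hnm => ?_)
  simp only [Prod.mk.injEq] at hnm
  funext i
  fin_cases i
  · simp; omega
  · simp; omega

/-! ### Solutions are trigonometric polynomials -/

/-- The trigonometric polynomials of a given frequency. -/
def waveSpan (lam : ℝ) : Submodule ℝ (Plane → ℝ) :=
  Submodule.span ℝ {f | ∃ k j : ℤ, lam = eigenvalue k j ∧ f = planeCos k j}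

/-- A solution is almost everywhere equal to a trigonometric polynomial. -/
theorem IsLaplaceSolution.exists_waveSpan {p : Fin 4 → Space} {lam : ℝ} {u : Surface p → ℝ}
    (hu : IsLaplaceSolution p lam u) : ∃ P ∈ waveSpan lam, liftFun u =ᵐ[volume] P := by
  obtain ⟨g, hU, hg, hgp, h1, h2⟩ := hu.exists_gradient
  have hUp : ∀ l ∈ hexLattice, ∀ x, liftFun u (x + l) = liftFun u x :=
    fun l hl x => liftFun_add_lattice u hl x
  set S := (finite_frequency lam).toFinset with hS
  obtain ⟨a, b, hab⟩ := exists_wave_sum hU S fun n hn θ =>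
    wave_coefficient_eq_zero hU hg hUp hgp h1 h2 (dualVec_mem_dualLattice _ _)
      (by
        rw [eigenvalue_eq]
        intro h
        exact hn (by simpa [hS] using h.symm)) θ
  have hall : ∀ᵐ x, liftFun u x = ∑ n ∈ S, (a n * cosWave (frequency n) x +
      b n * phaseWave (frequency n) (Real.pi / 2) x) := by
    refine ae_of_ae_parallelogram (fun l hl x hx => ?_) hab
    rw [hUp l hl] at hx
    rw [hx]
    refine Finset.sum_congr rfl fun n _ => ?_
    have hd : frequency n ∈ dualLattice := dualVec_mem_dualLattice _ _
    rw [← phaseWave_zero, phaseWave_add_lattice hd _ hl, phaseWave_add_lattice hd _ hl]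
  -- The lift is even, so averaging the expansions at `x` and `-x` cancels the sine terms.
  have hneg := (Measure.measurePreserving_neg (volume : Measure Plane)).quasiMeasurePreserving.ae hall
  refine ⟨∑ n ∈ S, a n • cosWave (frequency n), Submodule.sum_mem _ fun n hn =>
    Submodule.smul_mem _ _ (Submodule.subset_span ⟨_, _, by simpa [hS] using hn, rfl⟩), ?_⟩
  filter_upwards [hall, hneg] with x hx hx'
  rw [liftFun_neg] at hx'
  have e : liftFun u x = (liftFun u x + liftFun u x) / 2 := by ring
  rw [e]
  nth_rw 1 [hx]
  rw [hx', Finset.sum_apply, ← Finset.sum_add_distrib, Finset.sum_div]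
  refine Finset.sum_congr rfl fun n _ => ?_
  simp only [Pi.smul_apply, smul_eq_mul, cosWave, phaseWave, inner_neg_left, mul_neg, Real.cos_neg,
    Real.cos_add_pi_div_two, Real.sin_neg]
  ring

/-- The translated charts cover almost all of the plane, and every chart is an isometric piece of
it. -/
theorem aeEqSurface_iff {p : Fin 4 → Space} {u w : Surface p → ℝ} :
    AEEqSurface p u w ↔ liftFun u =ᵐ[volume] liftFun w := by
  constructor
  · intro h
    have key : ∀ᵐ x ∂((volume : Measure Plane).restrict Set.univ), liftFun u x = liftFun w x := by
      refine ae_restrict_of_cells isOpen_univ fun m n => ?_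
      rw [Set.univ_inter]
      set A := AffineIsometryEquiv.constVAdd ℝ Plane (pt (m : ℝ) n) with hA
      have hR : Realizes (cellPerm m n) A := realizes_constVAdd m n
      have := ((measurePreserving_affineIsometryEquiv A.symm).restrict_preimage
        isOpen_rhombus.measurableSet).quasiMeasurePreserving.ae (h (cellPerm m n))
      filter_upwards [this, ae_restrict_mem (isOpen_tile A).measurableSet] with x hx hm
      rwa [hR.pull_symm_eq u hm, hR.pull_symm_eq w hm] at hx
    rw [Measure.restrict_univ] at key
    exact key
  · intro h e
    obtain ⟨A, hA⟩ := exists_realizes e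
    have := (measurePreserving_affineIsometryEquiv A).quasiMeasurePreserving.ae h
    filter_upwards [ae_restrict_of_ae this, ae_restrict_mem isOpen_rhombus.measurableSet]
      with x hx hm
    rw [hA.pull_eq u hm, hA.pull_eq w hm]
    exact hx

/-! ### Classical solutions are weak solutions -/

theorem integral_mul_fderiv_add_eq_zero {f ψ : Plane → ℝ} (hf : ContDiff ℝ 1 f)
    (hψ : IsTest Set.univ ψ) (v : Plane) :
    Integrable (fun x => fderiv ℝ ψ x v * f x + fderiv ℝ f x v * ψ x) ∧
      ∫ x, (fderiv ℝ ψ x v * f x + fderiv ℝ f x v * ψ x) = 0 := by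
  have hψ' : Continuous fun x => fderiv ℝ ψ x v :=
    (hψ.1.continuous_fderiv (by simp)).clm_apply continuous_const
  have hf' : Continuous fun x => fderiv ℝ f x v :=
    (hf.continuous_fderiv one_ne_zero).clm_apply continuous_const
  have hs : HasCompactSupport fun x => fderiv ℝ ψ x v :=
    (hψ.2.1.fderiv (𝕜 := ℝ)).comp_left (g := fun L : Plane →L[ℝ] ℝ => L v) (by simp)
  have i1 : Integrable (fun x => f x * fderiv ℝ ψ x v) :=
    (hf.continuous.mul hψ').integrable_of_hasCompactSupport hs.mul_left
  have i2 : Integrable (fun x => fderiv ℝ f x v * ψ x) :=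
    (hf'.mul hψ.1.continuous).integrable_of_hasCompactSupport hψ.2.1.mul_left
  have i3 : Integrable (fun x => f x * ψ x) :=
    (hf.continuous.mul hψ.1.continuous).integrable_of_hasCompactSupport hψ.2.1.mul_left
  have h := integral_mul_fderiv_eq_neg_fderiv_mul_of_integrable i2 i1 i3
    (fun x _ => hf.differentiable (by simp) x)
    (fun x _ => hψ.1.differentiable (by simp) x)
  simp only [mul_comm (fderiv ℝ ψ _ v)]
  exact ⟨i1.add i2, by rw [integral_add i1 i2, h, neg_add_cancel]⟩

theorem weakDiv_smul_const {f : Plane → ℝ} (hf : ContDiff ℝ 1 f) (v : Plane) :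
    WeakDiv Set.univ (fun x => f x • v) (fun x => inner ℝ v (gradient f x)) := by
  intro ψ hψ
  rw [← (integral_mul_fderiv_add_eq_zero hf hψ v).2]
  simp only [map_smul, smul_eq_mul, inner_gradient_eq, mul_comm (f _)]

theorem gradient_eq_sum (f : Plane → ℝ) (x : Plane) :
    gradient f x = ∑ i, fderiv ℝ f x (EuclideanSpace.basisFun (Fin 2) ℝ i) •
      EuclideanSpace.basisFun (Fin 2) ℝ i := by
  rw [← (EuclideanSpace.basisFun (Fin 2) ℝ).sum_repr' (gradient f x)]
  simp only [inner_gradient_eq]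

theorem laplacian_eq_sum {f : Plane → ℝ} (hf : ContDiff ℝ 2 f) (x : Plane) :
    Laplacian.laplacian f x = ∑ i, fderiv ℝ
      (fun y => fderiv ℝ f y (EuclideanSpace.basisFun (Fin 2) ℝ i)) x
        (EuclideanSpace.basisFun (Fin 2) ℝ i) := by
  rw [InnerProductSpace.laplacian_eq_iteratedFDeriv_orthonormalBasis f
    (EuclideanSpace.basisFun (Fin 2) ℝ)]
  refine Finset.sum_congr rfl fun i _ => ?_
  have hd : DifferentiableAt ℝ (fderiv ℝ f) x :=
    (hf.fderiv_right (m := 1) (by norm_num)).differentiable (by simp) x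
  rw [iteratedFDeriv_two_apply, fderiv_clm_apply hd (differentiableAt_const _)]
  simp

/-- Integration by parts for each partial derivative, summed over an orthonormal basis. -/
theorem weakDiv_gradient {f : Plane → ℝ} (hf : ContDiff ℝ 2 f) :
    WeakDiv Set.univ (gradient f) (Laplacian.laplacian f) := by
  intro ψ hψ
  have hi : ∀ i, ContDiff ℝ 1 fun y => fderiv ℝ f y (EuclideanSpace.basisFun (Fin 2) ℝ i) :=
    fun i => (hf.fderiv_right (m := 1) (by norm_num)).clm_apply contDiff_const
  have key := fun i => integral_mul_fderiv_add_eq_zero (hi i) hψ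
    (EuclideanSpace.basisFun (Fin 2) ℝ i)
  have e : ∀ x, fderiv ℝ ψ x (gradient f x) + Laplacian.laplacian f x * ψ x =
      ∑ i, (fderiv ℝ ψ x (EuclideanSpace.basisFun (Fin 2) ℝ i) *
        fderiv ℝ f x (EuclideanSpace.basisFun (Fin 2) ℝ i) +
        fderiv ℝ (fun y => fderiv ℝ f y (EuclideanSpace.basisFun (Fin 2) ℝ i)) x
        (EuclideanSpace.basisFun (Fin 2) ℝ i) * ψ x) := by
    intro x
    rw [gradient_eq_sum, laplacian_eq_sum hf, map_sum, Finset.sum_add_distrib, Finset.sum_mul]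
    simp only [map_smul, smul_eq_mul, mul_comm (fderiv ℝ f x _)]
  simp only [e]
  rw [integral_finsetSum _ fun i _ => (key i).1]
  exact Finset.sum_eq_zero fun i _ => (key i).2

theorem exists_isCompact_rhombus : ∃ K : Set Plane, IsCompact K ∧ rhombus ⊆ K := by
  refine ⟨(fun q : ℝ × ℝ => pt q.1 q.2) '' (Set.Icc 0 1 ×ˢ Set.Icc 0 1),
    (isCompact_Icc.prod isCompact_Icc).image continuous_pt, fun x hx => ?_⟩
  obtain ⟨⟨h1, h2⟩, h3, h4⟩ := mem_rhombus_iff.1 hx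
  exact ⟨(sCoord x, rCoord x), ⟨⟨h1.le, h2.le⟩, h3.le, h4.le⟩, pt_coord x⟩

/-- A function whose lift is a classical solution is a solution on the surface. -/
theorem isLaplaceSolution_of_lift {p : Fin 4 → Space} {lam : ℝ} {u : Surface p → ℝ}
    (hu : ContDiff ℝ 2 (liftFun u))
    (h : ∀ x, -Laplacian.laplacian (liftFun u) x = lam * liftFun u x) :
    IsLaplaceSolution p lam u := by
  rw [isLaplaceSolution_iff]
  intro e
  obtain ⟨A, hA⟩ := exists_realizes e
  obtain ⟨K, hK, hsub⟩ := exists_isCompact_rhombus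
  have hc : Continuous fun x => A.symm.linearIsometryEquiv (gradient (liftFun u) (A x)) :=
    A.symm.linearIsometryEquiv.continuous.comp
      (((InnerProductSpace.toDual ℝ Plane).symm.continuous.comp
        (hu.continuous_fderiv (by norm_num))).comp A.continuous)
  have hpull : (fun x => liftFun u (A x)) =ᵐ[volume.restrict rhombus] pull p e u := by
    filter_upwards [ae_restrict_mem isOpen_rhombus.measurableSet] with x hx
    exact (hA.pull_eq u hx).symm
  have mono := Measure.restrict_mono (μ := (volume : Measure Plane)) hsub le_rfl
  refine ⟨fun x => A.symm.linearIsometryEquiv (gradient (liftFun u) (A x)), ?_, ?_, ?_, ?_⟩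
  · refine (memLp_congr_ae hpull).1 ?_
    exact (SqLoc.of_continuous (hu.continuous.comp A.continuous) K hK).mono_measure mono
  · exact (SqLoc.of_continuous hc K hK).mono_measure mono
  · intro v
    have h1 := WeakDiv.transport (Ω := rhombus) A.symm
      ((weakDiv_smul_const (hu.of_le (by norm_num)) (A.linearIsometryEquiv v)).mono
        (Set.subset_univ _))
    have hv : A.symm.linearIsometryEquiv (A.linearIsometryEquiv v) = v :=
      A.linearIsometryEquiv.symm_apply_apply v
    refine h1.congr ?_ (Filter.Eventually.of_forall fun x => ?_)
    · filter_upwards [hpull] with x hx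
      rw [map_smul, hv, ← hx, AffineIsometryEquiv.symm_symm]
    · simp only [AffineIsometryEquiv.symm_symm]
      rw [← A.symm.linearIsometryEquiv.inner_map_map, hv]
  · have h1 := WeakDiv.transport (Ω := rhombus) A.symm
      ((weakDiv_gradient hu).mono (Set.subset_univ _))
    refine h1.congr (Filter.EventuallyEq.refl _ _) ?_
    filter_upwards [hpull] with x hx
    rw [← hx, AffineIsometryEquiv.symm_symm, ← h, neg_neg]

theorem contDiff_planeCos (k j : ℤ) : ContDiff ℝ ∞ (planeCos k j) := by
  rw [planeCos, ← phaseWave_zero]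
  exact contDiff_phaseWave _ _

theorem fderiv_inner_phaseWave (w v : Plane) (θ : ℝ) (x : Plane) :
    fderiv ℝ (fun y => fderiv ℝ (phaseWave w θ) y v) x v =
      -(4 * Real.pi ^ 2) * inner ℝ w v ^ 2 * phaseWave w θ x := by
  have e : (fun y => fderiv ℝ (phaseWave w θ) y v) =
      fun y => (2 * Real.pi * inner ℝ w v) * phaseWave w (θ + Real.pi / 2) y := by
    funext y
    rw [fderiv_phaseWave]
    ring
  rw [e, fderiv_const_mul ((contDiff_phaseWave _ _).differentiable (by simp) x),
    smul_apply, fderiv_phaseWave, phaseWave_add_pi, smul_eq_mul]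
  ring

theorem laplacian_planeCos (k j : ℤ) (x : Plane) :
    Laplacian.laplacian (planeCos k j) x = -(eigenvalue k j * planeCos k j x) := by
  rw [laplacian_eq_sum ((contDiff_planeCos k j).of_le (WithTop.coe_le_coe.2 (le_top : (2 : ℕ∞) ≤ ⊤))), planeCos,
    ← phaseWave_zero]
  simp only [fderiv_inner_phaseWave]
  rw [← Finset.sum_mul, ← Finset.mul_sum, ← eigenvalue_eq,
    ← (EuclideanSpace.basisFun (Fin 2) ℝ).sum_sq_inner_left (dualVec k j)]
  ring

theorem planeCos_neg_apply (k j : ℤ) (x : Plane) : planeCos k j (-x) = planeCos k j x := by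
  rw [planeCos, cosWave, cosWave, inner_neg_left, mul_neg, Real.cos_neg]

theorem planeCos_add_lattice (k j : ℤ) {l : Plane} (hl : l ∈ hexLattice) (x : Plane) :
    planeCos k j (x + l) = planeCos k j x := by
  rw [planeCos, ← phaseWave_zero, phaseWave_add_lattice (dualVec_mem_dualLattice k j) _ hl]

/-- Trigonometric polynomials are classical solutions on the torus that are invariant under the
half-turn. -/
theorem waveSpan_properties {lam : ℝ} {P : Plane → ℝ} (hP : P ∈ waveSpan lam) :
    ContDiff ℝ ∞ P ∧ (∀ x, -Laplacian.laplacian P x = lam * P x) ∧ (∀ x, P (-x) = P x) ∧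
      ∀ l ∈ hexLattice, ∀ x, P (x + l) = P x := by
  have two : (2 : WithTop ℕ∞) ≤ ∞ := WithTop.coe_le_coe.2 (le_top : (2 : ℕ∞) ≤ ⊤)
  refine Submodule.span_induction ?_ ?_ ?_ ?_ hP
  · rintro _ ⟨k, j, rfl, rfl⟩
    exact ⟨contDiff_planeCos k j, fun x => by rw [laplacian_planeCos, neg_neg],
      planeCos_neg_apply k j, fun l hl => planeCos_add_lattice k j hl⟩
  · refine ⟨contDiff_const, fun x => ?_, fun x => rfl, fun l _ x => rfl⟩
    have : Laplacian.laplacian (0 : Plane → ℝ) = 0 := InnerProductSpace.laplacian_const (c := (0 : ℝ))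
    rw [this]
    simp
  · rintro f g _ _ ⟨f1, f2, f3, f4⟩ ⟨g1, g2, g3, g4⟩
    refine ⟨f1.add g1, fun x => ?_, fun x => by simp [f3, g3], fun l hl x => by
      simp [f4 l hl, g4 l hl]⟩
    rw [(f1.of_le two).contDiffAt.laplacian_add (g1.of_le two).contDiffAt, neg_add, f2, g2,
      Pi.add_apply, mul_add]
  · rintro c f _ ⟨f1, f2, f3, f4⟩
    refine ⟨f1.const_smul c, fun x => ?_, fun x => by simp [f3], fun l hl x => by
      simp [f4 l hl]⟩
    rw [InnerProductSpace.laplacian_smul c (f1.of_le two).contDiffAt, Pi.smul_apply, smul_eq_mul,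
      smul_eq_mul, ← mul_neg, f2]
    ring


/-! ### Eigenspaces in terms of cosines -/

theorem exists_lift_eq {p : Fin 4 → Space} (hp : ∀ i j, i ≠ j → dist (p i) (p j) = 1) {lam : ℝ}
    {P : Plane → ℝ} (hP : P ∈ waveSpan lam) : ∃ v : C(Surface p, ℝ), lift (cover p) v = P := by
  obtain ⟨h1, -, h3, h4⟩ := waveSpan_properties hP
  have hw : ∀ x y, toTorus x = toTorus y → P x = P y := fun x y h => by
    rw [← h4 _ (toTorus_eq_iff.1 h) x, add_sub_cancel]
  -- By periodicity the choice of a representative is immaterial; evenness then allows the descent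
  -- from the torus to the surface.
  set w : HexTorus → ℝ := fun z => P (Function.surjInv toTorus_surjective z) with hwd
  have hwt : ∀ x, w (toTorus x) = P x := fun x =>
    hw _ _ (Function.surjInv_eq toTorus_surjective _)
  have hc : Continuous w :=
    (isQuotientMap_quotient_mk' (s := QuotientAddGroup.leftRel hexLattice)).continuous_iff.2
      (h1.continuous.congr fun x => (hwt x).symm)
  obtain ⟨v, hv⟩ := exists_descent hp hc fun z => by
    obtain ⟨x, rfl⟩ := toTorus_surjective z
    rw [halfTurn_toTorus, hwt, hwt, h3]
  exact ⟨v, funext fun x => (hv _).trans (hwt x)⟩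

theorem mem_eigenspace_of_lift {p : Fin 4 → Space} {lam : ℝ} {v : C(Surface p, ℝ)}
    (h : lift (cover p) v ∈ waveSpan lam) : v ∈ eigenspace p lam := by
  obtain ⟨h1, h2, -, -⟩ := waveSpan_properties h
  exact isLaplaceSolution_of_lift (h1.of_le (WithTop.coe_le_coe.2 (le_top : (2 : ℕ∞) ≤ ⊤))) h2

/-- Two continuous functions on the plane that agree almost everywhere are equal. -/
theorem mem_eigenspace_iff {p : Fin 4 → Space} {lam : ℝ} {v : C(Surface p, ℝ)} :
    v ∈ eigenspace p lam ↔ lift (cover p) v ∈ waveSpan lam := by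
  refine ⟨fun h => ?_, mem_eigenspace_of_lift⟩
  obtain ⟨P, hP, hae⟩ := IsLaplaceSolution.exists_waveSpan h
  have hc : Continuous (liftFun v) :=
    v.continuous.comp ((cover p).continuous.comp continuous_toTorus)
  have : liftFun v = P := (hc.ae_eq_iff_eq volume (waveSpan_properties hP).1.continuous).1 hae
  have h' : lift (cover p) v = P := this
  rwa [h']

theorem map_eigenspace {p : Fin 4 → Space} (hp : ∀ i j, i ≠ j → dist (p i) (p j) = 1) (lam : ℝ) :
    (eigenspace p lam).map (lift (cover p)) = waveSpan lam := by
  ext P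
  constructor
  · rintro ⟨v, hv, rfl⟩
    exact mem_eigenspace_iff.1 hv
  · intro hP
    obtain ⟨v, rfl⟩ := exists_lift_eq hp hP
    exact ⟨v, mem_eigenspace_iff.2 hP, rfl⟩

/-- Regularity of solutions. -/
theorem IsLaplaceSolution.exists_continuous {p : Fin 4 → Space}
    (hp : ∀ i j, i ≠ j → dist (p i) (p j) = 1) {lam : ℝ} {u : Surface p → ℝ}
    (hu : IsLaplaceSolution p lam u) : ∃ v ∈ eigenspace p lam, AEEqSurface p u v ∧
      (∀ w : C(Surface p, ℝ), AEEqSurface p u w → w = v) ∧ Nonsingular (cover p) v ∧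
      (∀ z, v (cover p (halfTurn z)) = v (cover p z)) ∧
      (∀ x, -Laplacian.laplacian (lift (cover p) v) x = lam * lift (cover p) v x) := by
  obtain ⟨P, hP, hae⟩ := hu.exists_waveSpan
  obtain ⟨v, rfl⟩ := exists_lift_eq hp hP
  obtain ⟨h1, h2, -, -⟩ := waveSpan_properties hP
  refine ⟨v, mem_eigenspace_iff.2 hP, aeEqSurface_iff.2 hae, fun w hw => ?_, h1, fun z => ?_, h2⟩
  · have hc : Continuous (liftFun w) :=
      w.continuous.comp ((cover p).continuous.comp continuous_toTorus)
    have he : liftFun w =ᵐ[volume] lift (cover p) v := (aeEqSurface_iff.1 hw).symm.trans hae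
    exact lift_cover_injective p ((hc.ae_eq_iff_eq volume h1.continuous).1 he)
  · rw [(cover_eq_iff hp (halfTurn z) z).2 (Or.inr (neg_neg z).symm)]

theorem exists_mem_eigenspace {p : Fin 4 → Space} (hp : ∀ i j, i ≠ j → dist (p i) (p j) = 1)
    {lam : ℝ} {w : HexTorus → ℝ} (hw : ∀ z, w (halfTurn z) = w z)
    (hd : ContDiff ℝ 2 fun x => w (toTorus x))
    (h : ∀ x, -Laplacian.laplacian (fun x => w (toTorus x)) x = lam * w (toTorus x)) :
    ∃ v ∈ eigenspace p lam, ∀ z, v (cover p z) = w z := by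
  have hc : Continuous w :=
    (isQuotientMap_quotient_mk' (s := QuotientAddGroup.leftRel hexLattice)).continuous_iff.2
      hd.continuous
  obtain ⟨v, hv⟩ := exists_descent hp hc hw
  have e : liftFun v = fun x => w (toTorus x) := funext fun x => hv _
  exact ⟨v, isLaplaceSolution_of_lift (e ▸ hd) (by rw [e]; exact h), hv⟩

theorem planeCos_ne_zero (k j : ℤ) : planeCos k j ≠ 0 := fun h => by
  have := congrFun h 0
  simp [planeCos, cosWave] at this

theorem eigenspace_ne_bot_iff {p : Fin 4 → Space} (hp : ∀ i j, i ≠ j → dist (p i) (p j) = 1)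
    (lam : ℝ) : eigenspace p lam ≠ ⊥ ↔ ∃ k j : ℤ, lam = eigenvalue k j := by
  constructor
  · intro h
    by_contra hcon
    have hb : waveSpan lam = ⊥ := by
      rw [waveSpan, Submodule.span_eq_bot]
      rintro f ⟨k, j, hkj, -⟩
      exact (hcon ⟨k, j, hkj⟩).elim
    refine h ((Submodule.eq_bot_iff _).2 fun v hv => lift_cover_injective p ?_)
    rw [mem_eigenspace_iff, hb, Submodule.mem_bot] at hv
    rw [hv, map_zero]
  · rintro ⟨k, j, rfl⟩ h
    have hm : planeCos k j ∈ waveSpan (eigenvalue k j) := Submodule.subset_span ⟨k, j, rfl, rfl⟩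
    rw [← map_eigenspace hp, h, Submodule.map_bot, Submodule.mem_bot] at hm
    exact planeCos_ne_zero k j hm

/-! ### Linear independence of the cosines -/

/-- The characters of the plane with frequencies in the dual lattice. -/
def planeChar (q : ℤ × ℤ) : Multiplicative Plane →* ℂ where
  toFun x := Complex.exp (2 * Real.pi * (inner ℝ x.toAdd (dualVec q.1 q.2) : ℝ) * Complex.I)
  map_one' := by simp
  map_mul' x y := by
    rw [← Complex.exp_add, toAdd_mul, inner_add_left]
    congr 1
    push_cast
    ring

theorem planeChar_apply (q : ℤ × ℤ) (x : Plane) : planeChar q (Multiplicative.ofAdd x) =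
    Complex.exp (2 * Real.pi * (inner ℝ x (dualVec q.1 q.2) : ℝ) * Complex.I) := rfl

theorem dualVec_injective {k j k' j' : ℤ} (h : dualVec k j = dualVec k' j') :
    k = k' ∧ j = j' := by
  have h0 := congrArg (fun v : Plane => v 0) h
  have h1 := congrArg (fun v : Plane => v 1) h
  simp only [dualVec_zero, dualVec_one] at h0 h1
  have hk : (k : ℝ) = k' := by linarith
  have hj := mul_left_cancel₀ sqrt_three_ne h1
  exact ⟨by exact_mod_cast hk, by exact_mod_cast (by linarith : (j : ℝ) = j')⟩

theorem planeChar_injective : Function.Injective planeChar := by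
  intro q q' h
  set w := dualVec q.1 q.2 - dualVec q'.1 q'.2 with hw
  by_cases h0 : w = 0
  · obtain ⟨h1, h2⟩ := dualVec_injective (sub_eq_zero.1 h0)
    exact Prod.ext h1 h2
  · exfalso
    have hn : ‖w‖ ^ 2 ≠ 0 := by simpa using h0
    -- At this point the two phases differ by exactly half a period, so the values of the characters
    -- are opposite.
    set x : Plane := (1 / (2 * ‖w‖ ^ 2)) • w with hx
    have hx1 : inner ℝ x (dualVec q.1 q.2) = 1 / 2 + inner ℝ x (dualVec q'.1 q'.2) := by
      have : inner ℝ x w = 1 / 2 := by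
        rw [hx, real_inner_smul_left, real_inner_self_eq_norm_sq]
        field_simp
      rw [hw, inner_sub_right] at this
      linarith
    have h3 := DFunLike.congr_fun h (Multiplicative.ofAdd x)
    rw [planeChar_apply, planeChar_apply, hx1] at h3
    have e : (2 * Real.pi * ((1 / 2 + inner ℝ x (dualVec q'.1 q'.2) : ℝ) : ℂ) * Complex.I : ℂ) =
        Real.pi * Complex.I +
          2 * Real.pi * ((inner ℝ x (dualVec q'.1 q'.2) : ℝ) : ℂ) * Complex.I := by
      push_cast
      ring
    rw [e, Complex.exp_add, Complex.exp_pi_mul_I] at h3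
    have h4 : Complex.exp (2 * Real.pi * ((inner ℝ x (dualVec q'.1 q'.2) : ℝ) : ℂ) * Complex.I) = 0 := by
      linear_combination (-1 / 2 : ℂ) * h3
    exact Complex.exp_ne_zero _ h4

theorem linearIndependent_planeChar :
    LinearIndependent ℂ fun (q : ℤ × ℤ) (x : Multiplicative Plane) => planeChar q x :=
  (linearIndependent_monoidHom (Multiplicative Plane) ℂ).comp planeChar planeChar_injective

/-- The trigonometric polynomial with given coefficients. -/
def cosSum : (ℤ × ℤ →₀ ℝ) →ₗ[ℝ] (Plane → ℝ) :=
  Finsupp.linearCombination ℝ fun q => planeCos q.1 q.2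

theorem cosSum_single (k j : ℤ) (a : ℝ) : cosSum (Finsupp.single (k, j) a) = a • planeCos k j := by
  simp [cosSum]

/-- Twice a cosine is the sum of the characters of `q` and `-q`, so twice the sum has the
symmetrized coefficients `a q + a (-q)` with respect to the characters, which are independent by
Dedekind's theorem. -/
theorem coeff_of_cosSum_eq_zero {a : ℤ × ℤ →₀ ℝ} (h : cosSum a = 0) (q : ℤ × ℤ) :
    a q + a (-q) = 0 := by
  set b : (ℤ × ℤ →₀ ℝ) → (ℤ × ℤ →₀ ℂ) := fun a =>
    (a + a.mapDomain Neg.neg).mapRange (Complex.ofReal) Complex.ofReal_zero with hb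
  have hadd : ∀ a a', b (a + a') = b a + b a' := by
    intro a a'
    ext r
    simp [hb, Finsupp.mapDomain_add]
    ring
  have key : ∀ (a : ℤ × ℤ →₀ ℝ) (x : Plane),
      Finsupp.linearCombination ℂ (fun (q : ℤ × ℤ) (x : Multiplicative Plane) => planeChar q x)
        (b a) (Multiplicative.ofAdd x) = 2 * (cosSum a x : ℂ) := by
    intro a x
    induction a using Finsupp.induction_linear with
    | zero => simp [hb]
    | add a a' h1 h2 =>
      rw [hadd, map_add, Pi.add_apply, h1, h2, map_add, Pi.add_apply]
      push_cast
      ring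
    | single r c =>
      obtain ⟨k, j⟩ := r
      have hs : b (Finsupp.single (k, j) c) =
          Finsupp.single (k, j) (c : ℂ) + Finsupp.single (-(k, j)) (c : ℂ) := by
        simp only [hb, Finsupp.mapDomain_single]
        rw [Finsupp.mapRange_add (by simp), Finsupp.mapRange_single, Finsupp.mapRange_single]
      rw [hs, map_add, Finsupp.linearCombination_single, Finsupp.linearCombination_single,
        cosSum_single]
      simp only [Pi.add_apply, Pi.smul_apply, smul_eq_mul, planeChar_apply, planeCos, cosWave,
        Prod.neg_mk, Complex.ofReal_mul, Complex.ofReal_cos, Complex.cos]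
      have hn : dualVec (-k) (-j) = -dualVec k j := by
        simp [dualVec]
        abel
      rw [hn, inner_neg_right]
      push_cast
      ring_nf
  have hz : b a = 0 := by
    refine linearIndependent_iff.1 linearIndependent_planeChar _ (funext fun x => ?_)
    have := key a x.toAdd
    rw [h] at this
    simpa using this
  have h1 := DFunLike.congr_fun hz q
  simp only [hb, Finsupp.mapRange_apply, Finsupp.add_apply, Finsupp.coe_zero, Pi.zero_apply,
    Complex.ofReal_eq_zero] at h1
  rwa [← neg_neg q, Finsupp.mapDomain_apply neg_injective, neg_neg] at h1

/-- A criterion for linear independence. -/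
theorem linearIndependent_cosSum {ι : Type*} (g : ι → (ℤ × ℤ →₀ ℝ)) (idx : ι → ℤ × ℤ)
    (h0 : ∀ i i', i ≠ i' → g i (idx i') + g i (-idx i') = 0)
    (h1 : ∀ i, g i (idx i) + g i (-idx i) ≠ 0) :
    LinearIndependent ℝ fun i => cosSum (g i) := by
  rw [linearIndependent_iff']
  intro s c hc i hi
  have h2 : cosSum (∑ i ∈ s, c i • g i) = 0 := by
    -- The functionals `a ↦ a q + a (-q)` vanish on relations; at `q = idx i` they single out the
    -- `i`-th coefficient.
    rw [map_sum, ← hc]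
    simp
  have h3 := coeff_of_cosSum_eq_zero h2 (idx i)
  rw [Finsupp.finsetSum_apply, Finsupp.finsetSum_apply, ← Finset.sum_add_distrib] at h3
  rw [Finset.sum_eq_single_of_mem i hi fun i' _ hne => ?_] at h3
  · simp only [Finsupp.smul_apply, smul_eq_mul, ← mul_add] at h3
    exact (mul_eq_zero.1 h3).resolve_right (h1 i)
  · simp only [Finsupp.smul_apply, smul_eq_mul, ← mul_add, h0 i' i hne, mul_zero]

/-! ### Multiplicities -/

theorem planeCos_neg (k j : ℤ) : planeCos (-k) (-j) = planeCos k j := by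
  funext x
  rw [planeCos_apply, planeCos_apply, ← Real.cos_neg]
  congr 1
  push_cast
  ring

theorem eigenvalue_eq_iff (N : ℕ) (k j : ℤ) :
    4 * Real.pi ^ 2 / 3 * N = eigenvalue k j ↔ j ^ 2 + k ^ 2 + j * k = (N : ℤ) := by
  have hpi : (4 * Real.pi ^ 2 / 3 : ℝ) ≠ 0 := by positivity
  rw [eigenvalue, mul_right_inj' hpi, eq_comm]
  constructor <;> intro h <;> exact_mod_cast h

theorem finite_representations (N : ℕ) : (representations N).Finite :=
  (finite_eigenvalue_eq (4 * Real.pi ^ 2 / 3 * N)).subset fun q hq =>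
    (eigenvalue_eq_iff N q.1 q.2).2 hq.2.2

theorem linearIndependent_representations (N : ℕ) :
    LinearIndependent ℝ fun q : representations N => planeCos q.1.1 q.1.2 := by
  have e : (fun q : representations N => planeCos q.1.1 q.1.2) =
      fun q => cosSum (Finsupp.single q.1 1) :=
    funext fun q => ((cosSum_single q.1.1 q.1.2 1).trans (one_smul _ _)).symm
  rw [e]
  refine linearIndependent_cosSum _ (fun q => q.1) ?_ ?_
  · rintro ⟨⟨k, j⟩, h1, h2, _⟩ ⟨⟨k', j'⟩, h1', h2', _⟩ hne
    have hne' : ¬(k = k' ∧ j = j') := fun h => hne (Subtype.ext (Prod.ext h.1 h.2))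
    simp only at h1 h2 h1' h2'
    simp only [Finsupp.single_apply, Prod.neg_mk, Prod.mk.injEq]
    rw [if_neg (by omega), if_neg (by omega), add_zero]
  · intro i
    simp only [Finsupp.single_apply, if_true]
    positivity

theorem waveSpan_eq_span_representations (N : ℕ) : waveSpan (4 * Real.pi ^ 2 / 3 * N) =
    Submodule.span ℝ (Set.range fun q : representations N => planeCos q.1.1 q.1.2) := by
  refine congrArg (Submodule.span ℝ) (Set.ext fun f => ⟨?_, ?_⟩)
  · rintro ⟨k, j, h, rfl⟩
    rw [eigenvalue_eq_iff] at h
    by_cases hk : 0 ≤ k ∧ (k = 0 → 0 ≤ j)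
    · exact ⟨⟨(k, j), hk.1, hk.2, h⟩, rfl⟩
    · refine ⟨⟨(-k, -j), ?_, ?_, ?_⟩, planeCos_neg k j⟩
      · simp only
        omega
      · simp only
        omega
      · simp only
        linear_combination h
  · rintro ⟨⟨⟨k, j⟩, -, -, h⟩, rfl⟩
    exact ⟨k, j, (eigenvalue_eq_iff N k j).2 h, rfl⟩

theorem finrank_eigenspace {p : Fin 4 → Space} (hp : ∀ i j, i ≠ j → dist (p i) (p j) = 1)
    (N : ℕ) : FiniteDimensional ℝ (eigenspace p (4 * Real.pi ^ 2 / 3 * N)) ∧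
      Module.finrank ℝ (eigenspace p (4 * Real.pi ^ 2 / 3 * N)) = (representations N).ncard := by
  have : Fintype (representations N) := (finite_representations N).fintype
  set E := Submodule.equivMapOfInjective (lift (cover p)) (lift_cover_injective p)
    (eigenspace p (4 * Real.pi ^ 2 / 3 * N))
  have hm := (map_eigenspace hp (4 * Real.pi ^ 2 / 3 * N)).trans
    (waveSpan_eq_span_representations N)
  have hfin : FiniteDimensional ℝ
      ((eigenspace p (4 * Real.pi ^ 2 / 3 * N)).map (lift (cover p))) := by
    rw [hm]
    exact FiniteDimensional.span_of_finite ℝ (Set.finite_range _)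
  refine ⟨E.symm.finiteDimensional, ?_⟩
  rw [E.finrank_eq, hm, finrank_span_eq_card (linearIndependent_representations N),
    ← Nat.card_eq_fintype_card, Nat.card_coe_set_eq]

/-! ### Symmetry types -/

/-- Functions on the plane with the symmetries of the lifts of functions of a given type. -/
structure HasType (ε : ℝ) (f : Plane → ℝ) : Prop where
  comp_reflH : ∀ x, f (reflH x) = ε * f x
  comp_reflD : ∀ x, f (reflD x) = ε * f x
  comp_reflV : ∀ x, f (reflV x) = ε * f x

/-- The trivial character or the sign character. It tracks the factor `ε` through products of
transpositions. -/
theorem exists_sign_hom {ε : ℝ} (hε : ε = 1 ∨ ε = -1) :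
    ∃ χ : Equiv.Perm (Fin 4) →* ℝ, ∀ i j, i ≠ j → χ (Equiv.swap i j) = ε := by
  rcases hε with rfl | rfl
  · exact ⟨1, fun i j _ => rfl⟩
  · refine ⟨(Units.coeHom ℝ).comp ((Units.map (Int.castRingHom ℝ).toMonoidHom).comp
      Equiv.Perm.sign), fun i j h => ?_⟩
    simp [Equiv.Perm.sign_swap h]

/-- Adjacent transpositions generate all permutations, so the three reflections of the plane suffice
to test the symmetry under all six reflections of the tetrahedron. -/
theorem mem_symmetryType_iff_hasType {p : Fin 4 → Space}
    (hp : ∀ i j, i ≠ j → dist (p i) (p j) = 1) {ε : ℝ} (hε : ε = 1 ∨ ε = -1)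
    {v : C(Surface p, ℝ)} : v ∈ symmetryType p ε ↔ HasType ε (lift (cover p) v) := by
  rw [mem_symmetryType_iff hp]
  generalize hf : lift (cover p) v = f
  constructor
  · intro h
    have hH := h 2 3 (by decide) _ realizes_reflH
    have hD := h 1 2 (by decide) _ realizes_reflD
    rw [LinearIsometryEquiv.coe_toAffineIsometryEquiv] at hH hD
    exact ⟨hH, hD, h 0 1 (by decide) _ realizes_reflV⟩
  · intro h
    obtain ⟨χ, hχ⟩ := exists_sign_hom hε
    have key : ∀ e : Equiv.Perm (Fin 4), ∃ A, Realizes e A ∧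
        ∀ x, f (A x) = χ e * f x := by
      intro e
      have he : e ∈ Submonoid.closure
          (Set.range fun i : Fin 3 => Equiv.swap i.castSucc i.succ) := by
        rw [Equiv.Perm.mclosure_swap_castSucc_succ]
        trivial
      induction he using Submonoid.closure_induction with
      | mem e he =>
        obtain ⟨i, rfl⟩ := he
        fin_cases i
        · exact ⟨reflV, realizes_reflV, fun x => by
            rw [h.comp_reflV, hχ _ _ (by decide)]⟩
        · exact ⟨_, realizes_reflD, fun x => by
            rw [LinearIsometryEquiv.coe_toAffineIsometryEquiv, h.comp_reflD, hχ _ _ (by decide)]⟩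
        · exact ⟨_, realizes_reflH, fun x => by
            rw [LinearIsometryEquiv.coe_toAffineIsometryEquiv, h.comp_reflH, hχ _ _ (by decide)]⟩
      | one => exact ⟨1, Realizes.one, fun x => by simp⟩
      | mul e e' _ _ h1 h2 =>
        obtain ⟨A, hA, hA'⟩ := h1
        obtain ⟨B, hB, hB'⟩ := h2
        refine ⟨A * B, hA.mul hB, fun x => ?_⟩
        rw [AffineIsometryEquiv.coe_mul, Function.comp_apply, hA', hB', map_mul, mul_assoc]
    intro i j hij A hA x
    obtain ⟨B, hB, hB'⟩ := key (Equiv.swap i j)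
    rw [← hχ i j hij, ← hB', ← hf, lift_apply, lift_apply]
    -- Two isometries realizing the same permutation may differ, but they send a point to points
    -- with the same image on the surface.
    refine congrArg v (cover_congr (funext fun l => ?_))
    have h1 := hA x ((Equiv.swap i j).symm l)
    have h2 := hB x ((Equiv.swap i j).symm l)
    rw [Equiv.apply_symm_apply] at h1 h2
    rw [h1, h2]

theorem planeCos_reflH (k j : ℤ) (x : Plane) :
    planeCos k j (reflH x) = planeCos k (-(k + j)) x := by
  rw [planeCos_apply, planeCos_apply, sCoord_reflH, rCoord_reflH]
  congr 1
  push_cast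
  ring

theorem planeCos_reflD (k j : ℤ) (x : Plane) :
    planeCos k j (reflD x) = planeCos (k + j) (-j) x := by
  rw [planeCos_apply, planeCos_apply, sCoord_reflD, rCoord_reflD]
  congr 1
  push_cast
  ring

/-- The translation part of `reflV` shifts the phase by `kπ`, a multiple of `2π` for even `k`. -/
theorem planeCos_reflV {k : ℤ} (hk : Even k) (j : ℤ) (x : Plane) :
    planeCos k j (reflV x) = planeCos k (-(k + j)) x := by
  obtain ⟨m, rfl⟩ := hk
  rw [planeCos_apply, planeCos_apply, sCoord_reflV, rCoord_reflV, ← Real.cos_neg,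
    ← Real.cos_add_int_mul_two_pi _ m]
  congr 1
  push_cast
  ring

theorem planeCos_eq {k j k' j' : ℤ} (hk : k' = -k) (hj : j' = -j) :
    planeCos k j = planeCos k' j' := by
  rw [hk, hj, planeCos_neg]

/-- Each reflection exchanges the two groups of three waves, up to the sign of the frequency; `ε² =
1` turns the exchange into a factor `ε`. -/
theorem genericSum_hasType {ε : ℝ} (hε : ε * ε = 1) {k j : ℤ} (hk : Even k) (hj : Even j) :
    HasType ε (genericSum ε k j) := by
  have e1 : planeCos j (-(j + -(k + j))) = planeCos j k := by congr 1; ring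
  have e2 : planeCos (k + j) (-(k + j + -k)) = planeCos (k + j) (-j) := by congr 1; ring
  have e3 : planeCos (k + j) (-(k + j + -j)) = planeCos (k + j) (-k) := by congr 1; ring
  have e4 : planeCos k (-(k + -(k + j))) = planeCos k j := by congr 1; ring
  have e5 : planeCos j (-(j + k)) = planeCos j (-(k + j)) := by congr 1; ring
  have d1 : planeCos (k + j + -k) (- -k) = planeCos j k := by congr 1 <;> ring
  have d2 : planeCos (j + -(k + j)) (- -(k + j)) = planeCos k (-(k + j)) :=
    planeCos_eq (by ring) (by ring)
  have d3 : planeCos (j + k) (-k) = planeCos (k + j) (-k) := by congr 1; ring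
  have d4 : planeCos (k + j + -j) (- -j) = planeCos k j := by congr 1 <;> ring
  have d5 : planeCos (k + -(k + j)) (- -(k + j)) = planeCos j (-(k + j)) :=
    planeCos_eq (by ring) (by ring)
  refine ⟨fun x => ?_, fun x => ?_, fun x => ?_⟩
  · simp only [genericSum, Pi.add_apply, Pi.smul_apply, smul_eq_mul, planeCos_reflH, e1, e2, e3, e4,
      e5]
    linear_combination -(planeCos j k x + planeCos (k + j) (-j) x + planeCos k (-(k + j)) x) * hε
  · simp only [genericSum, Pi.add_apply, Pi.smul_apply, smul_eq_mul, planeCos_reflD, d1, d2, d3, d4,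
      d5]
    linear_combination -(planeCos j k x + planeCos (k + j) (-j) x + planeCos k (-(k + j)) x) * hε
  · simp only [genericSum, Pi.add_apply, Pi.smul_apply, smul_eq_mul, planeCos_reflV hk,
      planeCos_reflV hj, planeCos_reflV (hk.add hj), e1, e2, e3, e4, e5]
    linear_combination -(planeCos j k x + planeCos (k + j) (-j) x + planeCos k (-(k + j)) x) * hε

theorem eigenvalue_congr {k j k' j' : ℤ}
    (h : j ^ 2 + k ^ 2 + j * k = j' ^ 2 + k' ^ 2 + j' * k') : eigenvalue k j = eigenvalue k' j' := by
  unfold eigenvalue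
  congr 1
  exact_mod_cast h

theorem genericSum_mem_waveSpan (ε : ℝ) (k j : ℤ) :
    genericSum ε k j ∈ waveSpan (eigenvalue k j) := by
  have h : ∀ k' j', j ^ 2 + k ^ 2 + j * k = j' ^ 2 + k' ^ 2 + j' * k' →
      planeCos k' j' ∈ waveSpan (eigenvalue k j) := fun k' j' h =>
    Submodule.subset_span ⟨k', j', eigenvalue_congr h, rfl⟩
  unfold genericSum
  refine add_mem (add_mem (add_mem ?_ ?_) ?_) (Submodule.smul_mem _ _ (add_mem (add_mem ?_ ?_) ?_))
  all_goals
    apply h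
    ring

/-- The average over the translations by half the lattice. -/
def translationMean : (Plane → ℝ) →ₗ[ℝ] (Plane → ℝ) :=
  (1 / 4 : ℝ) • (LinearMap.id + LinearMap.funLeft ℝ ℝ (fun x => x + pt 1 1) +
    LinearMap.funLeft ℝ ℝ (fun x => x + pt 0 1) + LinearMap.funLeft ℝ ℝ (fun x => x + pt 1 2))

/-- The average over the reflections and rotations of a face, with signs. -/
def faceMean (ε : ℝ) : (Plane → ℝ) →ₗ[ℝ] (Plane → ℝ) :=
  (1 / 6 : ℝ) • (LinearMap.id + LinearMap.funLeft ℝ ℝ (fun x => reflH (reflD x)) +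
    LinearMap.funLeft ℝ ℝ (fun x => reflD (reflH x)) +
    ε • (LinearMap.funLeft ℝ ℝ reflH + LinearMap.funLeft ℝ ℝ reflD +
      LinearMap.funLeft ℝ ℝ (fun x => reflH (reflD (reflH x)))))

/-- The three non-trivial translations multiply the wave by `(-1)^k`, `(-1)^(k+j)` and `(-1)^j`. The
mean of these signs and 1 is 1 if `k` and `j` are even and 0 otherwise. -/
theorem translationMean_planeCos (k j : ℤ) :
    translationMean (planeCos k j) = if Even k ∧ Even j then planeCos k j else 0 := by
  funext x
  simp only [translationMean, LinearMap.smul_apply, LinearMap.add_apply, LinearMap.id_apply,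
    Pi.smul_apply, Pi.add_apply, LinearMap.funLeft_apply, smul_eq_mul]
  have e1 : planeCos k j (x + pt 1 1) = Real.cos (k * Real.pi) * planeCos k j x := by
    have : Real.pi * ((k + j) * rCoord (x + pt 1 1) - j * sCoord (x + pt 1 1)) =
        k * Real.pi + Real.pi * ((k + j) * rCoord x - j * sCoord x) := by
      simp
      ring
    rw [planeCos_apply, this, Real.cos_add, Real.sin_int_mul_pi, zero_mul, sub_zero,
      planeCos_apply]
  have e2 : planeCos k j (x + pt 0 1) = Real.cos ((k + j : ℤ) * Real.pi) * planeCos k j x := by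
    have : Real.pi * ((k + j) * rCoord (x + pt 0 1) - j * sCoord (x + pt 0 1)) =
        (k + j : ℤ) * Real.pi + Real.pi * ((k + j) * rCoord x - j * sCoord x) := by
      simp
      ring
    rw [planeCos_apply, this, Real.cos_add, Real.sin_int_mul_pi, zero_mul, sub_zero,
      planeCos_apply]
  have e3 : planeCos k j (x + pt 1 2) = Real.cos ((2 * k + j : ℤ) * Real.pi) * planeCos k j x := by
    have : Real.pi * ((k + j) * rCoord (x + pt 1 2) - j * sCoord (x + pt 1 2)) =
        (2 * k + j : ℤ) * Real.pi + Real.pi * ((k + j) * rCoord x - j * sCoord x) := by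
      simp
      ring
    rw [planeCos_apply, this, Real.cos_add, Real.sin_int_mul_pi, zero_mul, sub_zero,
      planeCos_apply]
  rw [e1, e2, e3, Real.cos_int_mul_pi, Real.cos_int_mul_pi, Real.cos_int_mul_pi]
  have two : Even (2 * k) := even_two_mul k
  rcases Int.even_or_odd k with hk | hk <;> rcases Int.even_or_odd j with hj | hj
  · rw [hk.neg_one_zpow, (hk.add hj).neg_one_zpow, (two.add hj).neg_one_zpow, if_pos ⟨hk, hj⟩]
    ring
  · rw [hk.neg_one_zpow, (hk.add_odd hj).neg_one_zpow, (two.add_odd hj).neg_one_zpow,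
      if_neg fun h => Int.not_even_iff_odd.2 hj h.2]
    simp
  · rw [hk.neg_one_zpow, (hk.add_even hj).neg_one_zpow, (two.add hj).neg_one_zpow,
      if_neg fun h => Int.not_even_iff_odd.2 hk h.1]
    simp
  · rw [hk.neg_one_zpow, (hk.add_odd hj).neg_one_zpow, (two.add_odd hj).neg_one_zpow,
      if_neg fun h => Int.not_even_iff_odd.2 hk h.1]
    simp

theorem faceMean_planeCos (ε : ℝ) (k j : ℤ) :
    faceMean ε (planeCos k j) = (1 / 6 : ℝ) • genericSum ε k j := by
  funext x
  have e1 : planeCos (k + -(k + j)) (- -(k + j)) = planeCos j (-(k + j)) :=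
    planeCos_eq (by ring) (by ring)
  have e2 : planeCos (k + j) (-(k + j + -j)) = planeCos (k + j) (-k) := by congr 1; ring
  have e3 : planeCos (k + -(k + j)) (-(k + -(k + j) + - -(k + j))) = planeCos j k :=
    planeCos_eq (by ring) (by ring)
  simp only [faceMean, genericSum, LinearMap.smul_apply, LinearMap.add_apply, LinearMap.id_apply,
    Pi.smul_apply, Pi.add_apply, LinearMap.funLeft_apply, smul_eq_mul, planeCos_reflH,
    planeCos_reflD, e1, e2, e3]
  ring

/-- The translation by `pt 1 1` is the product of two reflections and the half-turn, so the factors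
`ε` cancel for an even function. Conjugation by `reflD` gives a second translation, and the two
generate the third. -/
theorem HasType.translationMean_eq {ε : ℝ} (hε : ε * ε = 1) {f : Plane → ℝ} (h : HasType ε f)
    (hn : ∀ x, f (-x) = f x) : translationMean f = f := by
  have t1 : ∀ x, f (x + pt 1 1) = f x := by
    intro x
    have e : x + pt 1 1 = reflV (reflH (-x)) := coord_ext (by simp; ring) (by simp; ring)
    rw [e, h.comp_reflV, h.comp_reflH, hn, ← mul_assoc, hε, one_mul]
  have t2 : ∀ x, f (x + pt 0 1) = f x := by
    intro x
    have e : x + pt 0 1 = reflD (reflD x + pt 1 1) := coord_ext (by simp) (by simp)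
    rw [e, h.comp_reflD, t1, h.comp_reflD, ← mul_assoc, hε, one_mul]
  have t3 : ∀ x, f (x + pt 1 2) = f x := by
    intro x
    have e : x + pt 1 2 = x + pt 1 1 + pt 0 1 := coord_ext (by simp) (by simp; ring)
    rw [e, t2, t1]
  funext x
  simp only [translationMean, LinearMap.smul_apply, LinearMap.add_apply, LinearMap.id_apply,
    Pi.smul_apply, Pi.add_apply, LinearMap.funLeft_apply, smul_eq_mul, t1, t2, t3]
  ring

theorem HasType.faceMean_eq {ε : ℝ} (hε : ε * ε = 1) {f : Plane → ℝ} (h : HasType ε f) :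
    faceMean ε f = f := by
  funext x
  simp only [faceMean, LinearMap.smul_apply, LinearMap.add_apply, LinearMap.id_apply,
    Pi.smul_apply, Pi.add_apply, LinearMap.funLeft_apply, smul_eq_mul, h.comp_reflH, h.comp_reflD]
  linear_combination ((5 / 6 + ε * ε / 6) * f x) * hε

/-- The span of the symmetrized waves with even indices. -/
theorem map_eigenspace_inf {p : Fin 4 → Space} (hp : ∀ i j, i ≠ j → dist (p i) (p j) = 1)
    {ε : ℝ} (hε : ε = 1 ∨ ε = -1) (lam : ℝ) :
    (eigenspace p lam ⊓ symmetryType p ε).map (lift (cover p)) =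
      Submodule.span ℝ {f | ∃ k j : ℤ, Even k ∧ Even j ∧ lam = eigenvalue k j ∧
        f = genericSum ε k j} := by
  have hε2 : ε * ε = 1 := by rcases hε with rfl | rfl <;> norm_num
  apply le_antisymm
  · rintro _ ⟨v, ⟨hv, ht⟩, rfl⟩
    have hw := mem_eigenspace_iff.1 hv
    have hT := (mem_symmetryType_iff_hasType hp hε).1 ht
    have hn := (waveSpan_properties hw).2.2.1
    -- The two means fix every function of the given type, and they send each single wave either to
    -- zero or to a multiple of a symmetrized wave.
    have hle : waveSpan lam ≤ (Submodule.span ℝ {f | ∃ k j : ℤ, Even k ∧ Even j ∧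
        lam = eigenvalue k j ∧ f = genericSum ε k j}).comap (faceMean ε ∘ₗ translationMean) := by
      refine Submodule.span_le.2 ?_
      rintro _ ⟨k, j, h, rfl⟩
      rw [SetLike.mem_coe, Submodule.mem_comap, LinearMap.comp_apply, translationMean_planeCos]
      split_ifs with he
      · rw [faceMean_planeCos]
        exact Submodule.smul_mem _ _ (Submodule.subset_span ⟨k, j, he.1, he.2, h, rfl⟩)
      · rw [map_zero]
        exact zero_mem _
    have := hle hw
    rwa [Submodule.mem_comap, LinearMap.comp_apply, hT.translationMean_eq hε2 hn,
      hT.faceMean_eq hε2] at this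
  · refine Submodule.span_le.2 ?_
    rintro _ ⟨k, j, hk, hj, rfl, rfl⟩
    have hm := genericSum_mem_waveSpan ε k j
    obtain ⟨v, hv⟩ := exists_lift_eq hp hm
    refine ⟨v, ⟨mem_eigenspace_iff.2 (hv ▸ hm), (mem_symmetryType_iff_hasType hp hε).2 ?_⟩, hv⟩
    rw [hv]
    exact genericSum_hasType hε2 hk hj

/-! ### Reduction to a chamber -/

/-- `(k, j) ↦ (k + j, -k)` is a rotation of the dual lattice by 60 degrees. Up to the sign of the
frequency it permutes each group of three waves. -/
theorem genericSum_rotate (ε : ℝ) (k j : ℤ) :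
    genericSum ε (k + j) (-k) = genericSum ε k j := by
  have e1 : planeCos (k + j + -k) (-(k + j)) = planeCos j (-(k + j)) := by congr 1; ring
  have e2 : planeCos (-k) (-(k + j + -k)) = planeCos k j := planeCos_eq (by ring) (by ring)
  have e3 : planeCos (-k) (k + j) = planeCos k (-(k + j)) := planeCos_eq (by ring) (by ring)
  have e4 : planeCos (k + j + -k) (- -k) = planeCos j k := by congr 1 <;> ring
  have e5 : planeCos (k + j) (-(k + j + -k)) = planeCos (k + j) (-j) := by congr 1; ring
  funext x
  simp only [genericSum, e1, e2, e3, e4, e5, Pi.add_apply, Pi.smul_apply, smul_eq_mul]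
  ring

theorem genericSum_swap {ε : ℝ} (hε : ε * ε = 1) (k j : ℤ) :
    genericSum ε j k = ε • genericSum ε k j := by
  simp only [genericSum, add_comm j k, smul_add, smul_smul, hε, one_smul]
  abel

theorem genericSum_neg (ε : ℝ) (k j : ℤ) : genericSum ε (-k) (-j) = genericSum ε k j := by
  have e1 : planeCos (-k + -j) (- -k) = planeCos (k + j) (-k) := planeCos_eq (by ring) (by ring)
  have e2 : planeCos (-j) (-(-k + -j)) = planeCos j (-(k + j)) := planeCos_eq (by ring) (by ring)
  have e3 : planeCos (-k + -j) (- -j) = planeCos (k + j) (-j) := planeCos_eq (by ring) (by ring)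
  have e4 : planeCos (-k) (-(-k + -j)) = planeCos k (-(k + j)) := planeCos_eq (by ring) (by ring)
  simp only [genericSum, planeCos_neg, e1, e2, e3, e4]

/-- Negation and rotation lead to `k, j ≥ 0`, and the swap then orders the two entries at the cost
of a factor `ε`. All moves preserve the quadratic form and the parity conditions. -/
theorem exists_genericSum_chamber {ε : ℝ} (hε : ε * ε = 1) {k j : ℤ} (hk : Even k) (hj : Even j) :
    ∃ (k' j' : ℤ) (c : ℝ), 0 ≤ j' ∧ j' ≤ k' ∧ Even k' ∧ Even j' ∧
      j ^ 2 + k ^ 2 + j * k = j' ^ 2 + k' ^ 2 + j' * k' ∧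
      genericSum ε k j = c • genericSum ε k' j' := by
  have pos : ∀ k j : ℤ, Even k → Even j → 0 ≤ k → 0 ≤ j → ∃ (k' j' : ℤ) (c : ℝ), 0 ≤ j' ∧
      j' ≤ k' ∧ Even k' ∧ Even j' ∧ j ^ 2 + k ^ 2 + j * k = j' ^ 2 + k' ^ 2 + j' * k' ∧
      genericSum ε k j = c • genericSum ε k' j' := by
    intro k j hk hj h1 h2
    rcases le_total j k with h | h
    · exact ⟨k, j, 1, h2, h, hk, hj, rfl, (one_smul _ _).symm⟩
    · exact ⟨j, k, ε, h1, h, hj, hk, by ring, genericSum_swap hε j k⟩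
  have neg : ∀ k j : ℤ, Even k → Even j → k ≤ 0 → j ≤ 0 → ∃ (k' j' : ℤ) (c : ℝ), 0 ≤ j' ∧
      j' ≤ k' ∧ Even k' ∧ Even j' ∧ j ^ 2 + k ^ 2 + j * k = j' ^ 2 + k' ^ 2 + j' * k' ∧
      genericSum ε k j = c • genericSum ε k' j' := by
    intro k j hk hj h1 h2
    obtain ⟨k', j', c, a1, a2, a3, a4, a5, a6⟩ :=
      pos (-k) (-j) hk.neg hj.neg (by omega) (by omega)
    exact ⟨k', j', c, a1, a2, a3, a4, by rw [← a5]; ring, by rw [← a6, genericSum_neg]⟩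
  have mixed : ∀ k j : ℤ, Even k → Even j → 0 ≤ k → j ≤ 0 → ∃ (k' j' : ℤ) (c : ℝ), 0 ≤ j' ∧
      j' ≤ k' ∧ Even k' ∧ Even j' ∧ j ^ 2 + k ^ 2 + j * k = j' ^ 2 + k' ^ 2 + j' * k' ∧
      genericSum ε k j = c • genericSum ε k' j' := by
    intro k j hk hj h1 h2
    -- For entries of opposite sign, one step of the rotation, backwards or forwards according to
    -- the sign of `k + j`, makes the signs agree.
    rcases le_total 0 (k + j) with h | h
    · obtain ⟨k', j', c, a1, a2, a3, a4, a5, a6⟩ :=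
        pos (-j) (k + j) hj.neg (hk.add hj) (by omega) h
      have e := genericSum_rotate ε (-j) (k + j)
      rw [show -j + (k + j) = k by ring, neg_neg] at e
      exact ⟨k', j', c, a1, a2, a3, a4, by rw [← a5]; ring, by rw [← a6, e]⟩
    · obtain ⟨k', j', c, a1, a2, a3, a4, a5, a6⟩ :=
        neg (k + j) (-k) (hk.add hj) hk.neg h (by omega)
      exact ⟨k', j', c, a1, a2, a3, a4, by rw [← a5]; ring, by rw [← a6, genericSum_rotate]⟩
  rcases le_total 0 k with h1 | h1 <;> rcases le_total 0 j with h2 | h2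
  · exact pos k j hk hj h1 h2
  · exact mixed k j hk hj h1 h2
  · obtain ⟨k', j', c, a1, a2, a3, a4, a5, a6⟩ :=
      mixed (-k) (-j) hk.neg hj.neg (by omega) (by omega)
    exact ⟨k', j', c, a1, a2, a3, a4, by rw [← a5]; ring, by rw [← a6, genericSum_neg]⟩
  · exact neg k j hk hj h1 h2

/-! ### The bases -/

/-- The multiplicity of a wave in its symmetrization. -/
def orbitWeight (k j : ℤ) : ℝ := if j = 0 then (if k = 0 then 6 else 2) else if j = k then 2 else 1

theorem orbitWeight_pos (k j : ℤ) : 0 < orbitWeight k j := by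
  unfold orbitWeight
  split_ifs <;> norm_num

/-- On the chamber walls `j = 0` and `j = k` the six waves coincide in pairs, and at the origin all
of them are 1. -/
theorem genericSum_one_eq (k j : ℤ) : genericSum 1 k j = orbitWeight k j • uPlus k j := by
  unfold orbitWeight uPlus
  split_ifs with h1 h2 h3
  · subst h1 h2
    funext x
    simp [genericSum, planeCos_apply]
    norm_num
  · subst h1
    have e1 : planeCos 0 (-k) = planeCos 0 k := planeCos_eq (by ring) (by ring)
    funext x
    simp only [genericSum, e1, add_zero, neg_zero, Pi.add_apply, Pi.smul_apply, smul_eq_mul]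
    ring
  · subst h3
    funext x
    simp only [genericSum, two_mul, Pi.add_apply, Pi.smul_apply, smul_eq_mul]
    ring
  · rw [one_smul]

/-- On a wall the two groups of three waves are equal, so they cancel. -/
theorem uMinus_eq_zero {k j : ℤ} (h : j = 0 ∨ j = k) : uMinus k j = 0 := by
  rcases h with rfl | rfl
  · have e1 : planeCos 0 (-k) = planeCos 0 k := planeCos_eq (by ring) (by ring)
    funext x
    simp only [uMinus, genericSum, e1, add_zero, neg_zero, Pi.add_apply, Pi.smul_apply, smul_eq_mul,
      Pi.zero_apply]
    ring
  · funext x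
    simp only [uMinus, genericSum, Pi.add_apply, Pi.smul_apply, smul_eq_mul, Pi.zero_apply]
    ring

theorem map_eigenspace_plus {p : Fin 4 → Space} (hp : ∀ i j, i ≠ j → dist (p i) (p j) = 1)
    (lam : ℝ) : (eigenspace p lam ⊓ symmetryType p 1).map (lift (cover p)) =
      Submodule.span ℝ (Set.range fun q : plusIndex lam => uPlus q.1.1 q.1.2) := by
  rw [map_eigenspace_inf hp (Or.inl rfl)]
  apply le_antisymm
  · refine Submodule.span_le.2 ?_
    rintro _ ⟨k, j, hk, hj, rfl, rfl⟩
    obtain ⟨k', j', c, a1, a2, a3, a4, a5, a6⟩ :=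
      exists_genericSum_chamber (ε := 1) (by norm_num) hk hj
    rw [a6, genericSum_one_eq]
    exact Submodule.smul_mem _ _ (Submodule.smul_mem _ _ (Submodule.subset_span
      ⟨⟨(k', j'), a1, a2, a3, a4, eigenvalue_congr a5⟩, rfl⟩))
  · refine Submodule.span_le.2 ?_
    rintro _ ⟨⟨⟨k, j⟩, a1, a2, a3, a4, a5⟩, rfl⟩
    have e : uPlus k j = (orbitWeight k j)⁻¹ • genericSum 1 k j := by
      rw [genericSum_one_eq, smul_smul, inv_mul_cancel₀ (orbitWeight_pos k j).ne', one_smul]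
    change uPlus k j ∈ _
    rw [e]
    exact Submodule.smul_mem _ _ (Submodule.subset_span ⟨k, j, a3, a4, a5, rfl⟩)

theorem map_eigenspace_minus {p : Fin 4 → Space} (hp : ∀ i j, i ≠ j → dist (p i) (p j) = 1)
    (lam : ℝ) : (eigenspace p lam ⊓ symmetryType p (-1)).map (lift (cover p)) =
      Submodule.span ℝ (Set.range fun q : minusIndex lam => uMinus q.1.1 q.1.2) := by
  rw [map_eigenspace_inf hp (Or.inr rfl)]
  apply le_antisymm
  · refine Submodule.span_le.2 ?_
    rintro _ ⟨k, j, hk, hj, rfl, rfl⟩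
    obtain ⟨k', j', c, a1, a2, a3, a4, a5, a6⟩ :=
      exists_genericSum_chamber (ε := -1) (by norm_num) hk hj
    rw [a6]
    refine Submodule.smul_mem _ _ ?_
    by_cases h : j' = 0 ∨ j' = k'
    · have : genericSum (-1) k' j' = 0 := uMinus_eq_zero h
      rw [this]
      exact zero_mem _
    · exact Submodule.subset_span
        ⟨⟨(k', j'), by omega, by omega, a3, a4, eigenvalue_congr a5⟩, rfl⟩
  · refine Submodule.span_le.2 ?_
    rintro _ ⟨⟨⟨k, j⟩, a1, a2, a3, a4, a5⟩, rfl⟩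
    exact Submodule.subset_span ⟨k, j, a3, a4, a5, rfl⟩

/-- The coefficients of a symmetrized wave. -/
def genericCoeff (ε : ℝ) (k j : ℤ) : ℤ × ℤ →₀ ℝ :=
  Finsupp.single (k, j) 1 + Finsupp.single (k + j, -k) 1 + Finsupp.single (j, -(k + j)) 1 +
    (Finsupp.single (j, k) ε + Finsupp.single (k + j, -j) ε + Finsupp.single (k, -(k + j)) ε)

theorem cosSum_genericCoeff (ε : ℝ) (k j : ℤ) : cosSum (genericCoeff ε k j) = genericSum ε k j := by
  simp only [genericCoeff, map_add, cosSum_single, one_smul, genericSum, smul_add]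

/-- The chamber is a fundamental domain: no orbit meets it in two different points, even with
frequencies taken up to sign. -/
theorem genericCoeff_eq_zero (ε : ℝ) {k j k' j' : ℤ} (h1 : 0 ≤ j) (h2 : j ≤ k) (h1' : 0 ≤ j')
    (h2' : j' ≤ k') (hne : ¬(k = k' ∧ j = j')) :
    genericCoeff ε k j (k', j') = 0 ∧ genericCoeff ε k j (-k', -j') = 0 := by
  simp only [genericCoeff, Finsupp.add_apply, Finsupp.single_apply, Prod.mk.injEq]
  constructor
  · rw [if_neg (by omega), if_neg (by omega), if_neg (by omega), if_neg (by omega),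
      if_neg (by omega), if_neg (by omega)]
    simp
  · rw [if_neg (by omega), if_neg (by omega), if_neg (by omega), if_neg (by omega),
      if_neg (by omega), if_neg (by omega)]
    simp

theorem linearIndependent_uPlus (lam : ℝ) :
    LinearIndependent ℝ fun q : plusIndex lam => uPlus q.1.1 q.1.2 := by
  have e : (fun q : plusIndex lam => uPlus q.1.1 q.1.2) = fun q : plusIndex lam =>
      cosSum ((orbitWeight q.1.1 q.1.2)⁻¹ • genericCoeff 1 q.1.1 q.1.2) := by
    funext q
    rw [map_smul, cosSum_genericCoeff, genericSum_one_eq, smul_smul,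
      inv_mul_cancel₀ (orbitWeight_pos _ _).ne', one_smul]
  rw [e]
  refine linearIndependent_cosSum _ (fun q => q.1) ?_ ?_
  · rintro ⟨⟨k, j⟩, h1, h2, h⟩ ⟨⟨k', j'⟩, h1', h2', h'⟩ hne
    obtain ⟨z1, z2⟩ := genericCoeff_eq_zero 1 h1 h2 h1' h2'
      fun h => hne (Subtype.ext (Prod.ext h.1 h.2))
    simp only [Finsupp.smul_apply, Prod.neg_mk]
    rw [z1, z2]
    simp
  · rintro ⟨⟨k, j⟩, h1, h2, h⟩
    have hw := orbitWeight_pos k j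
    apply ne_of_gt
    simp only [Finsupp.smul_apply, Prod.neg_mk, genericCoeff, Finsupp.add_apply,
      Finsupp.single_apply, smul_eq_mul]
    -- The term of `(k, j)` itself contributes 1 and all others are non-negative, so coincidences on
    -- the walls do no harm.
    rw [if_pos trivial]
    positivity

theorem linearIndependent_uMinus (lam : ℝ) :
    LinearIndependent ℝ fun q : minusIndex lam => uMinus q.1.1 q.1.2 := by
  have e : (fun q : minusIndex lam => uMinus q.1.1 q.1.2) = fun q : minusIndex lam =>
      cosSum (genericCoeff (-1) q.1.1 q.1.2) := by
    funext q
    rw [cosSum_genericCoeff, uMinus]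
  rw [e]
  refine linearIndependent_cosSum _ (fun q => q.1) ?_ ?_
  · rintro ⟨⟨k, j⟩, h1, h2, h⟩ ⟨⟨k', j'⟩, h1', h2', h'⟩ hne
    obtain ⟨z1, z2⟩ := genericCoeff_eq_zero (-1) (le_of_lt h1) (le_of_lt h2) (le_of_lt h1')
      (le_of_lt h2') fun h => hne (Subtype.ext (Prod.ext h.1 h.2))
    simp only [Prod.neg_mk]
    rw [z1, z2, add_zero]
  · rintro ⟨⟨k, j⟩, h1, h2, h⟩
    simp only at h1 h2
    simp only [Prod.neg_mk, genericCoeff, Finsupp.add_apply, Finsupp.single_apply, Prod.mk.injEq]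
    -- In the interior of the chamber the twelve signed frequencies are distinct, so no term with
    -- coefficient `-1` can cancel the leading one.
    repeat rw [if_neg (show ¬(_ ∧ _) by omega)]
    simp

/-! ### The dihedral group of the dual lattice -/

theorem dualVec_sub (k j k' j' : ℤ) : dualVec k j - dualVec k' j' = dualVec (k - k') (j - j') := by
  refine plane_ext ?_ ?_ <;> simp only [PiLp.sub_apply, dualVec_zero, dualVec_one] <;>
    push_cast <;> ring

theorem neg_dualVec (k j : ℤ) : -dualVec k j = dualVec (-k) (-j) := by
  refine plane_ext ?_ ?_ <;> simp only [PiLp.neg_apply, dualVec_zero, dualVec_one] <;>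
    push_cast <;> ring

theorem reflH_dualVec (k j : ℤ) : reflH (dualVec k j) = dualVec k (-(k + j)) := by
  refine plane_ext ?_ ?_ <;> rw [reflH_apply] <;> simp [dualVec_zero, dualVec_one]
  ring

theorem reflD_dualVec (k j : ℤ) : reflD (dualVec k j) = dualVec (k + j) (-j) := by
  refine plane_ext ?_ ?_ <;> rw [reflD_apply] <;> simp [dualVec_zero, dualVec_one]
  · linear_combination (((k : ℝ) / 6 + j / 3) / 2) * sqrt_three_sq
  · ring

/-- The rotations and reflections of the dual lattice, up to sign. -/
def dihedral : Fin 6 → (Plane ≃ₗᵢ[ℝ] Plane) :=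
  ![1, reflH * reflD, reflD * reflH, reflH, reflD, reflH * reflD * reflH]

/-- The action of the dihedral group on the coordinates in the dual lattice. -/
def dihedralAct (k j : ℤ) : Fin 6 → ℤ × ℤ :=
  ![(k, j), (k + j, -k), (-j, k + j), (k, -(k + j)), (k + j, -j), (-j, -k)]

theorem dihedral_dualVec (i : Fin 6) (k j : ℤ) :
    dihedral i (dualVec k j) = dualVec (dihedralAct k j i).1 (dihedralAct k j i).2 := by
  fin_cases i
  · rfl
  · change reflH (reflD _) = dualVec (k + j) (-k)
    rw [reflD_dualVec, reflH_dualVec]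
    congr 1
    ring
  · change reflD (reflH _) = dualVec (-j) (k + j)
    rw [reflH_dualVec, reflD_dualVec]
    congr 1 <;> ring
  · exact reflH_dualVec k j
  · exact reflD_dualVec k j
  · change reflH (reflD (reflH _)) = dualVec (-j) (-k)
    rw [reflH_dualVec, reflD_dualVec, reflH_dualVec]
    congr 1 <;> ring

/-- The dihedral group with its signs. -/
def signedDihedral (q : Bool × Fin 6) : Plane ≃ₗᵢ[ℝ] Plane :=
  if q.1 then LinearIsometryEquiv.neg ℝ * dihedral q.2 else dihedral q.2

/-- The action of the dihedral group with its signs. -/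
def signedAct (k j : ℤ) (q : Bool × Fin 6) : ℤ × ℤ :=
  if q.1 then -dihedralAct k j q.2 else dihedralAct k j q.2

theorem signedDihedral_dualVec (q : Bool × Fin 6) (k j : ℤ) :
    signedDihedral q (dualVec k j) = dualVec (signedAct k j q).1 (signedAct k j q).2 := by
  obtain ⟨s, i⟩ := q
  cases s
  · exact dihedral_dualVec i k j
  · change -dihedral i (dualVec k j) = dualVec (-_) (-_)
    rw [dihedral_dualVec, neg_dualVec]

theorem mul_mem_hexSymmetries {A B : Plane ≃ₗᵢ[ℝ] Plane} (hA : A ∈ hexSymmetries)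
    (hB : B ∈ hexSymmetries) : A * B ∈ hexSymmetries := by
  change (A * B) '' dualLattice = dualLattice
  rw [LinearIsometryEquiv.coe_mul, Set.image_comp]
  exact (congrArg (A '' ·) hB).trans hA

theorem mem_hexSymmetries_of_involutive {A : Plane ≃ₗᵢ[ℝ] Plane} (hA : ∀ x, A (A x) = x)
    (h : ∀ k j, ∃ k' j', A (dualVec k j) = dualVec k' j') : A ∈ hexSymmetries := by
  have hm : ∀ w ∈ dualLattice, A w ∈ dualLattice := by
    intro w hw
    obtain ⟨k, j, rfl⟩ := mem_dualLattice_iff.1 hw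
    exact mem_dualLattice_iff.2 (h k j)
  refine Set.Subset.antisymm ?_ fun w hw => ⟨A w, hm w hw, hA w⟩
  rintro _ ⟨w, hw, rfl⟩
  exact hm w hw

theorem reflH_mem : reflH ∈ hexSymmetries :=
  mem_hexSymmetries_of_involutive (fun x => coord_ext (by simp) (by simp))
    fun k j => ⟨_, _, reflH_dualVec k j⟩

theorem reflD_mem : reflD ∈ hexSymmetries :=
  mem_hexSymmetries_of_involutive (fun x => coord_ext (by simp) (by simp))
    fun k j => ⟨_, _, reflD_dualVec k j⟩

theorem neg_mem_hexSymmetries : LinearIsometryEquiv.neg ℝ ∈ hexSymmetries :=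
  mem_hexSymmetries_of_involutive (fun x => neg_neg x) fun k j => ⟨_, _, neg_dualVec k j⟩

theorem one_mem_hexSymmetries : (1 : Plane ≃ₗᵢ[ℝ] Plane) ∈ hexSymmetries := Set.image_id _

theorem signedDihedral_mem (q : Bool × Fin 6) : signedDihedral q ∈ hexSymmetries := by
  have h : ∀ i, dihedral i ∈ hexSymmetries := by
    intro i
    fin_cases i
    · exact one_mem_hexSymmetries
    · exact mul_mem_hexSymmetries reflH_mem reflD_mem
    · exact mul_mem_hexSymmetries reflD_mem reflH_mem
    · exact reflH_mem
    · exact reflD_mem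
    · exact mul_mem_hexSymmetries (mul_mem_hexSymmetries reflH_mem reflD_mem) reflH_mem
  obtain ⟨s, i⟩ := q
  cases s
  · exact h i
  · exact mul_mem_hexSymmetries neg_mem_hexSymmetries (h i)

theorem linearIsometryEquiv_ext {A B : Plane ≃ₗᵢ[ℝ] Plane}
    (h1 : A (dualVec 1 0) = B (dualVec 1 0)) (h2 : A (dualVec 0 1) = B (dualVec 0 1)) : A = B := by
  ext1 x
  have hx : x = (2 * x 0) • dualVec 1 0 + (√3 * x 1 - x 0) • dualVec 0 1 := by
    refine plane_ext ?_ ?_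
    · simp [dualVec_zero]
      ring
    · simp [dualVec_one]
      linear_combination (-x 1 / 3) * sqrt_three_sq
  rw [hx, map_add, map_add, map_smul, map_smul, map_smul, map_smul, h1, h2]

/-- The six shortest non-zero vectors of the hexagonal lattice. Since `4(a² + ab + b²) = 3a² + (a +
2b)²`, and likewise for `b`, only finitely many pairs need checking. -/
theorem eq_of_form_eq_one {a b : ℤ} (h : a ^ 2 + a * b + b ^ 2 = 1) :
    (a, b) = (1, 0) ∨ (a, b) = (-1, 0) ∨ (a, b) = (0, 1) ∨ (a, b) = (0, -1) ∨
      (a, b) = (1, -1) ∨ (a, b) = (-1, 1) := by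
  have ha : a ^ 2 < 2 ^ 2 := by nlinarith [sq_nonneg (a + 2 * b)]
  have hb : b ^ 2 < 2 ^ 2 := by nlinarith [sq_nonneg (b + 2 * a)]
  obtain ⟨a1, a2⟩ := abs_lt.1 (abs_lt_of_sq_lt_sq ha (by norm_num))
  obtain ⟨b1, b2⟩ := abs_lt.1 (abs_lt_of_sq_lt_sq hb (by norm_num))
  interval_cases a <;> interval_cases b <;> simp_all

theorem exists_signedAct {a b c d : ℤ} (h1 : a ^ 2 + a * b + b ^ 2 = 1)
    (h2 : c ^ 2 + c * d + d ^ 2 = 1)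
    (h3 : (a - c) ^ 2 + (a - c) * (b - d) + (b - d) ^ 2 = 1) :
    ∃ q, signedAct 1 0 q = (a, b) ∧ signedAct 0 1 q = (c, d) := by
  have e1 := eq_of_form_eq_one h1
  have e2 := eq_of_form_eq_one h2
  simp only [Prod.mk.injEq] at e1 e2
  rcases e1 with ⟨rfl, rfl⟩ | ⟨rfl, rfl⟩ | ⟨rfl, rfl⟩ | ⟨rfl, rfl⟩ | ⟨rfl, rfl⟩ | ⟨rfl, rfl⟩ <;>
  rcases e2 with ⟨rfl, rfl⟩ | ⟨rfl, rfl⟩ | ⟨rfl, rfl⟩ | ⟨rfl, rfl⟩ | ⟨rfl, rfl⟩ | ⟨rfl, rfl⟩ <;>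
  first
  | (exfalso; revert h3; decide)
  | decide

theorem form_of_norm_eq {k j k' j' : ℤ} (h : ‖dualVec k j‖ = ‖dualVec k' j'‖) :
    k ^ 2 + k * j + j ^ 2 = k' ^ 2 + k' * j' + j' ^ 2 := by
  have h2 := congrArg (fun t : ℝ => t ^ 2) h
  simp only [norm_sq_dualVec] at h2
  have h3 : (k : ℝ) ^ 2 + k * j + (j : ℝ) ^ 2 = (k' : ℝ) ^ 2 + k' * j' + (j' : ℝ) ^ 2 := by linarith
  exact_mod_cast h3

/-- A symmetry sends `u`, `v` and `u - v`, all of minimal length, to lattice vectors of the same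
length. `exists_signedAct` shows that the listed elements account for all such images of the basis
`u`, `v`, and an isometry is determined by them. -/
theorem range_signedDihedral : Set.range signedDihedral = hexSymmetries := by
  refine Set.Subset.antisymm ?_ fun A hA => ?_
  · rintro _ ⟨q, rfl⟩
    exact signedDihedral_mem q
  · have hm : ∀ k j, ∃ k' j', A (dualVec k j) = dualVec k' j' := by
      intro k j
      refine mem_dualLattice_iff.1 ?_
      have h : A '' dualLattice = dualLattice := hA
      rw [← h]
      exact ⟨_, dualVec_mem_dualLattice k j, rfl⟩
    obtain ⟨a, b, hab⟩ := hm 1 0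
    obtain ⟨c, d, hcd⟩ := hm 0 1
    have n1 : ‖dualVec a b‖ = ‖dualVec 1 0‖ := by rw [← hab, A.norm_map]
    have n2 : ‖dualVec c d‖ = ‖dualVec 0 1‖ := by rw [← hcd, A.norm_map]
    have n3 : ‖dualVec (a - c) (b - d)‖ = ‖dualVec (1 - 0) (0 - 1)‖ := by
      rw [← dualVec_sub, ← dualVec_sub, ← hab, ← hcd, ← map_sub, A.norm_map]
    obtain ⟨q, h1, h2⟩ := exists_signedAct ((form_of_norm_eq n1).trans (by norm_num))
      ((form_of_norm_eq n2).trans (by norm_num)) ((form_of_norm_eq n3).trans (by norm_num))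
    refine ⟨q, linearIsometryEquiv_ext ?_ ?_⟩
    · rw [signedDihedral_dualVec, h1, hab]
    · rw [signedDihedral_dualVec, h2, hcd]

theorem signedDihedral_injective : Function.Injective signedDihedral := by
  intro q q' h
  have h1 := congrArg (fun A : Plane ≃ₗᵢ[ℝ] Plane => A (dualVec 1 0)) h
  have h2 := congrArg (fun A : Plane ≃ₗᵢ[ℝ] Plane => A (dualVec 0 1)) h
  simp only [signedDihedral_dualVec] at h1 h2
  have key : ∀ q q' : Bool × Fin 6, signedAct 1 0 q = signedAct 1 0 q' →
      signedAct 0 1 q = signedAct 0 1 q' → q = q' := by decide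
  exact key q q' (Prod.ext (dualVec_injective h1).1 (dualVec_injective h1).2)
    (Prod.ext (dualVec_injective h2).1 (dualVec_injective h2).2)

/-! ### Determinants -/

theorem det_mul (A B : Plane ≃ₗᵢ[ℝ] Plane) :
    LinearMap.det ((A * B).toLinearEquiv : Plane →ₗ[ℝ] Plane) =
      LinearMap.det (A.toLinearEquiv : Plane →ₗ[ℝ] Plane) *
        LinearMap.det (B.toLinearEquiv : Plane →ₗ[ℝ] Plane) := by
  rw [← LinearMap.det_comp]
  rfl

theorem det_eq (A : Plane ≃ₗᵢ[ℝ] Plane) :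
    LinearMap.det (A.toLinearEquiv : Plane →ₗ[ℝ] Plane) =
      A (EuclideanSpace.single 0 1) 0 * A (EuclideanSpace.single 1 1) 1 -
        A (EuclideanSpace.single 1 1) 0 * A (EuclideanSpace.single 0 1) 1 := by
  rw [← LinearMap.det_toMatrix (EuclideanSpace.basisFun (Fin 2) ℝ).toBasis, Matrix.det_fin_two]
  simp [LinearMap.toMatrix_apply]

theorem det_reflH : LinearMap.det (reflH.toLinearEquiv : Plane →ₗ[ℝ] Plane) = -1 := by
  rw [det_eq]
  simp [reflH_apply]

theorem det_reflD : LinearMap.det (reflD.toLinearEquiv : Plane →ₗ[ℝ] Plane) = -1 := by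
  rw [det_eq]
  simp [reflD_apply]
  linear_combination (-1 / 4 : ℝ) * sqrt_three_sq

theorem det_neg_one :
    LinearMap.det ((LinearIsometryEquiv.neg ℝ : Plane ≃ₗᵢ[ℝ] Plane).toLinearEquiv :
      Plane →ₗ[ℝ] Plane) = 1 := by
  rw [det_eq]
  simp

theorem det_one_isometry : LinearMap.det ((1 : Plane ≃ₗᵢ[ℝ] Plane).toLinearEquiv :
    Plane →ₗ[ℝ] Plane) = 1 := LinearMap.det_id

theorem cosWave_neg_prod (k j : ℤ) (i : Fin 6) (x : Plane) :
    cosWave (dualVec (-dihedralAct k j i).1 (-dihedralAct k j i).2) x =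
      cosWave (dualVec (dihedralAct k j i).1 (dihedralAct k j i).2) x :=
  congrFun (planeCos_neg _ _) x

/-- In the plane `-1` has determinant 1 and it fixes every cosine, so the twelve terms are the six
signed ones counted twice. The sum runs over the group, so coincidences in the orbit play no role.
-/
theorem sum_det_cosWave (k j : ℤ) (x : Plane) :
    ∑ᶠ A ∈ hexSymmetries, LinearMap.det (A.toLinearEquiv : Plane →ₗ[ℝ] Plane) *
      cosWave (A (dualVec k j)) x = 2 * uMinus k j x := by
  have e1 : planeCos (-j) (k + j) = planeCos j (-(k + j)) := planeCos_eq (by ring) (by ring)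
  rw [← range_signedDihedral, finsum_mem_range signedDihedral_injective,
    finsum_eq_sum_of_fintype, Fintype.sum_prod_type, Fintype.sum_bool]
  have hdet : ∀ i, LinearMap.det ((signedDihedral (true, i)).toLinearEquiv : Plane →ₗ[ℝ] Plane) =
      LinearMap.det ((dihedral i).toLinearEquiv : Plane →ₗ[ℝ] Plane) := by
    intro i
    change LinearMap.det ((LinearIsometryEquiv.neg ℝ * dihedral i).toLinearEquiv :
      Plane →ₗ[ℝ] Plane) = _
    rw [det_mul, det_neg_one, one_mul]
  simp only [hdet, signedDihedral_dualVec]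
  simp only [signedAct, signedDihedral, if_true, cosWave_neg_prod, Bool.false_eq_true, if_false,
    Fin.sum_univ_six]
  simp only [dihedral, dihedralAct, Matrix.cons_val, det_mul, det_reflH, det_reflD, det_one_isometry]
  change _ = 2 * genericSum (-1) k j x
  simp only [genericSum, Pi.add_apply, Pi.smul_apply, smul_eq_mul, ← e1, ← planeCos_neg j k]
  simp only [planeCos]
  ring

theorem hexOrbit_eq_range (k j : ℤ) : hexOrbit (dualVec k j) =
    Set.range fun q => dualVec (signedAct k j q).1 (signedAct k j q).2 := by
  ext w
  constructor
  · rintro ⟨A, hA, rfl⟩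
    rw [← range_signedDihedral] at hA
    obtain ⟨q, rfl⟩ := hA
    exact ⟨q, (signedDihedral_dualVec q k j).symm⟩
  · rintro ⟨q, rfl⟩
    exact ⟨signedDihedral q, signedDihedral_mem q, signedDihedral_dualVec q k j⟩

/-- Strictly inside the chamber the twelve images are distinct, so the sum over the orbit is the sum
over the group. -/
theorem sum_hexOrbit_generic {k j : ℤ} (h0 : 0 < j) (h1 : j < k) (x : Plane) :
    ∑ᶠ w ∈ hexOrbit (dualVec k j), cosWave w x = 2 * uPlus k j x := by
  have hinj : Function.Injective fun q => dualVec (signedAct k j q).1 (signedAct k j q).2 := by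
    rintro ⟨s, i⟩ ⟨s', i'⟩ h
    obtain ⟨h2, h3⟩ := dualVec_injective h
    cases s <;> cases s' <;> fin_cases i <;> fin_cases i' <;>
      simp [signedAct, dihedralAct] at h2 h3 ⊢ <;> omega
  have e1 : planeCos (-j) (k + j) = planeCos j (-(k + j)) := planeCos_eq (by ring) (by ring)
  rw [hexOrbit_eq_range, finsum_mem_range hinj, finsum_eq_sum_of_fintype, Fintype.sum_prod_type,
    Fintype.sum_bool, uPlus, if_neg h0.ne', if_neg h1.ne]
  simp only [signedAct, if_true, cosWave_neg_prod, Bool.false_eq_true, if_false, Fin.sum_univ_six]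
  simp only [dihedralAct, Matrix.cons_val, genericSum, Pi.add_apply, Pi.smul_apply, smul_eq_mul,
    ← e1, ← planeCos_neg j k]
  simp only [planeCos]
  ring

/-- Three waves and their negatives. -/
def signedTriple (t : Fin 3 → ℤ × ℤ) (q : Bool × Fin 3) : ℤ × ℤ :=
  if q.1 then -t q.2 else t q.2

/-- On a wall the orbit has only six points, each to be counted once. It is therefore reparametrized
by three frequencies and their negatives. -/
theorem sum_hexOrbit_triple {k j : ℤ} (t : Fin 3 → ℤ × ℤ)
    (hinj : Function.Injective (signedTriple t))
    (h1 : ∀ q, ∃ q', signedAct k j q = signedTriple t q')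
    (h2 : ∀ q', ∃ q, signedAct k j q = signedTriple t q') (x : Plane) :
    ∑ᶠ w ∈ hexOrbit (dualVec k j), cosWave w x =
      2 * ∑ i, planeCos (t i).1 (t i).2 x := by
  have hr : hexOrbit (dualVec k j) =
      Set.range fun q => dualVec (signedTriple t q).1 (signedTriple t q).2 := by
    rw [hexOrbit_eq_range]
    refine Set.Subset.antisymm ?_ ?_
    · rintro _ ⟨q, rfl⟩
      obtain ⟨q', hq⟩ := h1 q
      exact ⟨q', by simp only [hq]⟩
    · rintro _ ⟨q, rfl⟩
      obtain ⟨q', hq⟩ := h2 q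
      exact ⟨q', by simp only [hq]⟩
  have hi : Function.Injective fun q => dualVec (signedTriple t q).1 (signedTriple t q).2 :=
    fun q q' h => hinj (Prod.ext (dualVec_injective h).1 (dualVec_injective h).2)
  have hneg : ∀ i, cosWave (dualVec (-(t i).1) (-(t i).2)) x = planeCos (t i).1 (t i).2 x :=
    fun i => congrFun (planeCos_neg _ _) x
  rw [hr, finsum_mem_range hi, finsum_eq_sum_of_fintype, Fintype.sum_prod_type, Fintype.sum_bool]
  simp only [signedTriple, if_true, Prod.fst_neg, Prod.snd_neg, hneg, Bool.false_eq_true, if_false]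
  rw [two_mul]
  rfl

theorem sum_hexOrbit {k j : ℤ} (h0 : 0 ≤ j) (h1 : j ≤ k) (hk : k ≠ 0) (x : Plane) :
    ∑ᶠ w ∈ hexOrbit (dualVec k j), cosWave w x = 2 * uPlus k j x := by
  rcases h0.eq_or_lt with rfl | h0
  · have := sum_hexOrbit_triple (k := k) (j := 0) ![(k, 0), (k, -k), (0, k)] ?_ ?_ ?_ x
    · rw [this, uPlus, if_pos rfl, if_neg hk]
      simp [Fin.sum_univ_three]
    · rintro ⟨s, i⟩ ⟨s', i'⟩ h
      have h2 := congrArg Prod.fst h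
      have h3 := congrArg Prod.snd h
      cases s <;> cases s' <;> fin_cases i <;> fin_cases i' <;>
        simp [signedTriple] at h2 h3 ⊢ <;> omega
    -- An element and its negative are matched simultaneously, with opposite signs and the same
    -- index.
    · have key : ∀ i, ∃ s i', dihedralAct k 0 i = signedTriple ![(k, 0), (k, -k), (0, k)] (s, i') ∧
          -dihedralAct k 0 i = signedTriple ![(k, 0), (k, -k), (0, k)] (!s, i') := by
        intro i
        fin_cases i
        · exact ⟨false, 0, by simp [signedTriple, dihedralAct]⟩
        · exact ⟨false, 1, by simp [signedTriple, dihedralAct]⟩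
        · exact ⟨false, 2, by simp [signedTriple, dihedralAct]⟩
        · exact ⟨false, 1, by simp [signedTriple, dihedralAct]⟩
        · exact ⟨false, 0, by simp [signedTriple, dihedralAct]⟩
        · exact ⟨true, 2, by simp [signedTriple, dihedralAct]⟩
      rintro ⟨s, i⟩
      obtain ⟨s', i', h2, h3⟩ := key i
      cases s
      · exact ⟨_, h2⟩
      · exact ⟨_, h3⟩
    · rintro ⟨s, i⟩
      fin_cases i
      · exact ⟨(s, 0), by cases s <;> simp [signedTriple, signedAct, dihedralAct]⟩
      · exact ⟨(s, 1), by cases s <;> simp [signedTriple, signedAct, dihedralAct]⟩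
      · exact ⟨(s, 2), by cases s <;> simp [signedTriple, signedAct, dihedralAct]⟩
  · rcases h1.eq_or_lt with rfl | h1
    · have := sum_hexOrbit_triple (k := j) (j := j) ![(j, j), (2 * j, -j), (j, -(2 * j))]
        ?_ ?_ ?_ x
      · rw [this, uPlus, if_neg hk, if_pos rfl]
        simp [Fin.sum_univ_three]
      · rintro ⟨s, i⟩ ⟨s', i'⟩ h
        have h2 := congrArg Prod.fst h
        have h3 := congrArg Prod.snd h
        cases s <;> cases s' <;> fin_cases i <;> fin_cases i' <;>
          simp [signedTriple] at h2 h3 ⊢ <;> omega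
      · have key : ∀ i, ∃ s i', dihedralAct j j i =
            signedTriple ![(j, j), (2 * j, -j), (j, -(2 * j))] (s, i') ∧
            -dihedralAct j j i =
            signedTriple ![(j, j), (2 * j, -j), (j, -(2 * j))] (!s, i') := by
          intro i
          fin_cases i
          · exact ⟨false, 0, by simp [signedTriple, dihedralAct, two_mul]⟩
          · exact ⟨false, 1, by simp [signedTriple, dihedralAct, two_mul]⟩
          · exact ⟨true, 2, by simp [signedTriple, dihedralAct, two_mul]⟩
          · exact ⟨false, 2, by simp [signedTriple, dihedralAct, two_mul]⟩
          · exact ⟨false, 1, by simp [signedTriple, dihedralAct, two_mul]⟩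
          · exact ⟨true, 0, by simp [signedTriple, dihedralAct, two_mul]⟩
        rintro ⟨s, i⟩
        obtain ⟨s', i', h2, h3⟩ := key i
        cases s
        · exact ⟨_, h2⟩
        · exact ⟨_, h3⟩
      · rintro ⟨s, i⟩
        fin_cases i
        · exact ⟨(s, 0), by cases s <;> simp [signedTriple, signedAct, dihedralAct, two_mul]⟩
        · exact ⟨(s, 1), by cases s <;> simp [signedTriple, signedAct, dihedralAct, two_mul]⟩
        · exact ⟨(s, 3), by cases s <;> simp [signedTriple, signedAct, dihedralAct, two_mul]⟩
    · exact sum_hexOrbit_generic h0 h1 x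

end Tetra

end

open Tetra in
theorem mainTheorem1 (p : Fin 4 → Space) (hp : ∀ i j, i ≠ j → dist (p i) (p j) = 1) :
    ∃ π : C(HexTorus, Surface p),
      -- the two-fold branched cover by the torus
      IsTwofoldBranchedCover p π ∧
      -- smoothness off the vertices may be tested on the torus
      (∀ f : Surface p → ℝ,
        (∀ e, ContDiffOn ℝ ∞ (pull p e f) rhombus) ↔
          ContDiffOn ℝ ∞ (fun x => f (π (toTorus x))) {x | π (toTorus x) ∉ vertexSet p}) ∧
      -- every eigenfunction is nonsingular and lifts to an invariant eigenfunction on the torus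
      (∀ (lam : ℝ) (u : Surface p → ℝ), IsLaplaceSolution p lam u →
        ∃ v ∈ eigenspace p lam, AEEqSurface p u v ∧
          (∀ w : C(Surface p, ℝ), AEEqSurface p u w → w = v) ∧
          Nonsingular π v ∧
          (∀ z, v (π (halfTurn z)) = v (π z)) ∧
          (∀ x, -Laplacian.laplacian (lift π v) x = lam * lift π v x)) ∧
      -- every invariant eigenfunction on the torus comes from an eigenfunction
      (∀ (lam : ℝ) (w : HexTorus → ℝ), (∀ z, w (halfTurn z) = w z) →
        ContDiff ℝ 2 (fun x => w (toTorus x)) →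
        (∀ x, -Laplacian.laplacian (fun x => w (toTorus x)) x = lam * w (toTorus x)) →
        ∃ v ∈ eigenspace p lam, ∀ z, v (π z) = w z) ∧
      -- the eigenspaces are spanned by cosines
      (∀ lam : ℝ, (eigenspace p lam).map (lift π) =
        Submodule.span ℝ {f | ∃ k j : ℤ, lam = eigenvalue k j ∧ f = planeCos k j}) ∧
      -- the eigenvalues
      (∀ lam : ℝ, eigenspace p lam ≠ ⊥ ↔ ∃ k j : ℤ, lam = eigenvalue k j) ∧
      -- the multiplicities
      (∀ N : ℕ, (representations N).Finite ∧
        FiniteDimensional ℝ (eigenspace p (4 * Real.pi ^ 2 / 3 * N)) ∧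
        Module.finrank ℝ (eigenspace p (4 * Real.pi ^ 2 / 3 * N)) = (representations N).ncard) ∧
      -- the eigenfunctions of type `1⁺`: a basis
      (∀ lam : ℝ, LinearIndependent ℝ (fun q : plusIndex lam => uPlus q.1.1 q.1.2) ∧
        (eigenspace p lam ⊓ symmetryType p 1).map (lift π) =
          Submodule.span ℝ (Set.range fun q : plusIndex lam => uPlus q.1.1 q.1.2)) ∧
      -- the eigenfunctions of type `1⁻`: a basis
      (∀ lam : ℝ, LinearIndependent ℝ (fun q : minusIndex lam => uMinus q.1.1 q.1.2) ∧
        (eigenspace p lam ⊓ symmetryType p (-1)).map (lift π) =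
          Submodule.span ℝ (Set.range fun q : minusIndex lam => uMinus q.1.1 q.1.2)) ∧
      -- these are sums over orbits in the dual lattice
      dualLattice = {w | ∃ k j : ℤ, w = dualVec k j} ∧
      (∀ k j : ℤ, 0 ≤ j → j ≤ k → k ≠ 0 → ∀ x,
        ∑ᶠ w ∈ hexOrbit (dualVec k j), cosWave w x = 2 * uPlus k j x) ∧
      (∀ k j : ℤ, 0 < j → j < k → ∀ x,
        ∑ᶠ A ∈ hexSymmetries,
          LinearMap.det (A.toLinearEquiv : Plane →ₗ[ℝ] Plane) * cosWave (A (dualVec k j)) x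
            = 2 * uMinus k j x) := by
  refine ⟨cover p, isTwofoldBranchedCover_cover hp, contDiffOn_pull_iff hp,
    fun lam u hu => hu.exists_continuous hp, fun lam w hw hd h => exists_mem_eigenspace hp hw hd h,
    map_eigenspace hp, eigenspace_ne_bot_iff hp,
    fun N => ⟨finite_representations N, finrank_eigenspace hp N⟩,
    fun lam => ⟨linearIndependent_uPlus lam, map_eigenspace_plus hp lam⟩,
    fun lam => ⟨linearIndependent_uMinus lam, map_eigenspace_minus hp lam⟩,
    Set.ext fun w => mem_dualLattice_iff,
    fun k j h0 h1 hk x => sum_hexOrbit h0 h1 hk x, fun k j _ _ x => sum_det_cosWave k j x⟩
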